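/- Notation. Let $n\ge 1$ and let $e_1,\dots,e_n$ be the standard basis of $\mathbb R^n$. For integers $j$ put $\partial_j^n=\{r\in[0,\infty)^n:\ |\{i: r_i>0\}|\le j\}$. For $0\le j\le n$ let $p_j^n(r)=\sum_{1\le i_1<\dots<i_j\le n}r_{i_1}\cdots r_{i_j}$ (with $p_0^n=1$) be the elementary symmetric polynomials. For $1\le k\le n$ define $$H_k^n(r)=p_n^n(r)+\sum_{j=0}^{k-1}(-1)^{k-j}\binom{n-j-1}{n-k}p_j^n(r),\qquad E_k^n(s)=H_k^n(e^{-s_1},\dots,e^{-s_n}).$$ Write $r\odot t=(r_1t_1,\dots,r_nt_n)$ and $\vec 1=(1,\dots,1)$. For $F\subset\{1,\dots,n\}$ put $\vec 1_F=\sum_{i\in F}e_i$ and $t_F=(t_i)_{i\in F}\in[0,\infty)^{|F|}$ (coordinates in increasing order of index). A function $h:(0,\infty)^n\to\mathbb R$ is completely monotone if $h\in C^\infty((0,\infty)^n)$ and $(-1)^{|\alpha|}\partial^\alpha h(t)\ge 0$ for every multi-index $\alpha\in\mathbb Z_+^n$ and every $t\in(0,\infty)^n$. A function $g$ is a Bernstein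 function of order $k$ in $(0,\infty)^n$ if $g\in C^\infty((0,\infty)^n)$ and $\partial^{\vec 1_F}g$ is completely monotone for every $F\subset\{1,\dots,n\}$ with $|F|=k$. Theorem. Let $n>k\ge 1$ and let $g:[0,\infty)^n\to\mathbb R$ be continuous with $g(t)=0$ for every $t\in\partial_{k-1}^n$. Then $g$ is a Bernstein function of order $k$ in $(0,\infty)^n$ if and only if it can be represented as $$g(t)=\sum_{|F|=k}\psi^F(t_F)+\int_{[0,\infty)^n\setminus\partial_k^n}(-1)^kE_k^n(r\odot t)\,\frac{p_k^n(\vec 1+r)}{p_k^n(r)}\,d\eta(r),\qquad t\in[0,\infty)^n,$$ where $\eta$ is a finite nonnegative Borel measure on $[0,\infty)^n\setminus\partial_k^n$ and, for each $F\subset\{1,\dots,n\}$ with $|F|=k$, $\psi^F:[0,\infty)^k\to\mathbb R$ is a continuous function that is a Bernstein function of order $k$ in $(0,\infty)^k$ and vanishes on $\partial_{k-1}^k$. For every such measure $\eta$ and every $t\in[0,\infty)^n$ the integral converges absolutely. The representation is unique: the functions $\psi^F$ and the measure $\eta$ are determined by $g$. -/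

import Mathlib

open scoped ContDiff

noncomputable section

/-- The closed orthant `[0, ∞)^n`. -/
def closedOrthant (n : ℕ) : Set (Fin n → ℝ) := {t | ∀ i, 0 ≤ t i}

/-- The open orthant `(0, ∞)^n`. -/
def openOrthant (n : ℕ) : Set (Fin n → ℝ) := {t | ∀ i, 0 < t i}

/-- The points of `[0, ∞)^n` with fewer than `m` positive coordinates. This is the set written
`∂_{m-1}^n`, so `∂_{k-1}^n` is `sparsePoints n k` and `∂_k^n` is `sparsePoints n (k + 1)`. -/
def sparsePoints (n m : ℕ) : Set (Fin n → ℝ) :=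
  {r | r ∈ closedOrthant n ∧ Set.ncard {i | 0 < r i} < m}

/-- The partial derivative `∂f/∂t_i`. -/
def partialDeriv {n : ℕ} (i : Fin n) (f : (Fin n → ℝ) → ℝ) : (Fin n → ℝ) → ℝ :=
  fun t => lineDeriv ℝ f t (Pi.single i 1)

/-- The derivative `∂^α f = ∂_0^{α_0} ∂_1^{α_1} ⋯ ∂_{n-1}^{α_{n-1}} f` for a multi-index `α`. -/
def multiDeriv {n : ℕ} (α : Fin n → ℕ) (f : (Fin n → ℝ) → ℝ) : (Fin n → ℝ) → ℝ :=
  (List.finRange n).foldr (fun i h => (partialDeriv i)^[α i] h) f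

/-- The multi-index `1_F`. -/
def indicatorIndex {n : ℕ} (F : Finset (Fin n)) : Fin n → ℕ := fun i => if i ∈ F then 1 else 0

/-- Complete monotonicity on `(0, ∞)^n`; only the values of `h` on the open orthant matter. -/
def IsCompletelyMonotone {n : ℕ} (h : (Fin n → ℝ) → ℝ) : Prop :=
  ContDiffOn ℝ ∞ h (openOrthant n) ∧
    ∀ α : Fin n → ℕ, ∀ t ∈ openOrthant n, 0 ≤ (-1 : ℝ) ^ (∑ i, α i) * multiDeriv α h t

/-- Bernstein functions of order `k` on `(0, ∞)^n`; only the values of `g` on the open orthant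
matter. -/
def IsBernsteinOfOrder {n : ℕ} (k : ℕ) (g : (Fin n → ℝ) → ℝ) : Prop :=
  ContDiffOn ℝ ∞ g (openOrthant n) ∧
    ∀ F : Finset (Fin n), F.card = k → IsCompletelyMonotone (multiDeriv (indicatorIndex F) g)

/-- The elementary symmetric polynomial `p_k^n` evaluated at `r`. -/
def elemSymm (n k : ℕ) (r : Fin n → ℝ) : ℝ :=
  MvPolynomial.eval r (MvPolynomial.esymm (Fin n) ℝ k)

/-- `H_k^n(r) = p_n^n(r) + ∑_{j<k} (-1)^{k-j} C(n-j-1, n-k) p_j^n(r)`. -/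
def HFun (n k : ℕ) (r : Fin n → ℝ) : ℝ :=
  elemSymm n n r +
    ∑ j ∈ Finset.range k, (-1 : ℝ) ^ (k - j) * ((n - j - 1).choose (n - k) : ℝ) * elemSymm n j r

/-- `E_k^n(s) = H_k^n(e^{-s_1}, …, e^{-s_n})`. -/
def EFun (n k : ℕ) (s : Fin n → ℝ) : ℝ := HFun n k (fun i => Real.exp (-s i))

/-- The domain `[0, ∞)^n \ ∂_k^n` of integration. -/
def levyDomain (n k : ℕ) : Set (Fin n → ℝ) := closedOrthant n \ sparsePoints n (k + 1)

/-- A nonnegative finite Borel measure on `[0, ∞)^n \ ∂_k^n`, as a finite measure on `ℝ^n`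
concentrated on that set. -/
def IsLevyMeasure (n k : ℕ) (η : MeasureTheory.Measure (Fin n → ℝ)) : Prop :=
  MeasureTheory.IsFiniteMeasure η ∧ η (levyDomain n k)ᶜ = 0

/-- The integrand `(-1)^k E_k^n(r ⊙ t) p_k^n(1 + r) / p_k^n(r)`. -/
def levyIntegrand (n k : ℕ) (t r : Fin n → ℝ) : ℝ :=
  (-1 : ℝ) ^ k * EFun n k (fun i => r i * t i) *
    (elemSymm n k (fun i => 1 + r i) / elemSymm n k r)

/-- For `|F| = k`, the vector `t_F = (t_i)_{i ∈ F}` as a point of `ℝ^k`, the elements of `F` being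
listed in increasing order. -/
def subvector {n k : ℕ} (F : {F : Finset (Fin n) // F.card = k}) (t : Fin n → ℝ) : Fin k → ℝ :=
  fun j => t (F.1.orderEmbOfFin F.2 j)

/-- The pair `((ψ^F)_{|F| = k}, η)` represents `g` on `[0, ∞)^n`: each `ψ^F` is continuous on
`[0, ∞)^k`, is Bernstein of order `k` on `(0, ∞)^k` and vanishes on `∂_{k-1}^k`; `η` is a finite
measure on `[0, ∞)^n \ ∂_k^n`; and `g` is the sum of the `ψ^F(t_F)` and the integral. -/
def IsBernsteinRepresentation {n : ℕ} (k : ℕ) (g : (Fin n → ℝ) → ℝ)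
    (ψ : {F : Finset (Fin n) // F.card = k} → (Fin k → ℝ) → ℝ)
    (η : MeasureTheory.Measure (Fin n → ℝ)) : Prop :=
  (∀ F, ContinuousOn (ψ F) (closedOrthant k) ∧ IsBernsteinOfOrder k (ψ F) ∧
      ∀ u ∈ sparsePoints k k, ψ F u = 0) ∧
    IsLevyMeasure n k η ∧
    ∀ t ∈ closedOrthant n,
      g t = (∑ F, ψ F (subvector F t)) + ∫ r in levyDomain n k, levyIntegrand n k t r ∂η

end

/-! ### Iterated partial derivatives and their signs on the open orthant. -/

noncomputable section

variable {n : ℕ}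

/-! The engine is Newton-type inclusion–exclusion. Let `T_i^c` be translation by `c` in direction
`i`, and let `Δ^B_s` be the product of the operators `T_i^{s_i} - 1` over `i ∈ B`. Expanding the
product of the factors `1 + (T_i^{s_i} - 1)` gives `g(s) = ∑_B (Δ^B_s g)(0)`. The terms with `|B| <
k` involve only values of `g` at points with fewer than `k` positive coordinates, hence vanish
(`restrictOrthant_eq_sum_diffOp`). The same expansion identifies `H_k^n(x)` with the sum of `∏_{i ∈
B} (x_i - 1)` over `|B| ≥ k` (`HFun_eq_sum`), so the kernel of the representation is an exponential
with its terms of order below `k` removed.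

Necessity. For `|F| = k` the sign conditions on derivatives pass to iterated differences of `Δ^F g`.
A Bernstein theorem on the orthant (`exists_measure_laplaceChar`), obtained from the Hausdorff
moment problem on the cube, represents such differences by a finite measure. Comparing step sizes
gives one measure `μ_F` for all steps, with kernel `∏_{i ∈ F} (1 - e^{-r_i s_i}) / (1 - e^{-r_i})`
(`HasAlternatingDerivs.exists_measure`). Computing `Δ^{F ∪ F'} g` in two ways shows that `μ_F` and
`μ_{F'}` are compatible (`weighted_eq_weighted`). Where more than `k` coordinates are positive, all
`μ_F` therefore have explicit densities with respect to their sum, which produces `η`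
(`restrict_manyPositive_eq`). On the remaining set `μ_F` charges only frequencies supported in `F`
(`ae_support_subset`), and this part produces `ψ^F`. Any `B` with `|B| ≥ k` contains some `F`, so
`Δ^B g` is computed from `μ_F` (`shiftFunctional_diffOp_eq`); summation over `B` gives the
representation.

Sufficiency and convergence. Each term of the expanded integrand is a bounded weight
(`levyWeight_le`) times a kernel of at most polynomial growth in `t`. This gives absolute
convergence and allows differentiation under the integral in the open orthant. A derivative `∂^β`
with at least `k` nonzero orders annihilates the removed terms, so only the derivative of one
exponential remains and its sign is visible (`sum_prod_decay_mul_kernelProd`, `levy_sign`).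

Uniqueness. For `|B| = k + 1` the operator `Δ^B` kills every `ψ^F` and all lower terms of the
integrand, leaving the Laplace transform of a weighted `η`. The weights, summed over `B`, are
positive on the whole domain, so `η` is determined (`measure_unique`). Evaluation at points
supported in `F` then isolates `ψ^F` (`functions_unique`). -/

lemma isOpen_openOrthant (n : ℕ) : IsOpen (openOrthant n) := by
  have : openOrthant n = Set.pi Set.univ (fun _ => Set.Ioi (0 : ℝ)) := by
    ext t; simp [openOrthant]
  rw [this]
  exact isOpen_set_pi Set.finite_univ fun _ _ => isOpen_Ioi

lemma partialDeriv_eq_fderiv {f : (Fin n → ℝ) → ℝ} {t : Fin n → ℝ} (i : Fin n)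
    (h : DifferentiableAt ℝ f t) : partialDeriv i f t = fderiv ℝ f t (Pi.single i 1) :=
  h.lineDeriv_eq_fderiv

section Open

variable {U : Set (Fin n → ℝ)} (hU : IsOpen U)
include hU

lemma partialDeriv_congr {f g : (Fin n → ℝ) → ℝ} (h : Set.EqOn f g U) (i : Fin n) :
    Set.EqOn (partialDeriv i f) (partialDeriv i g) U := fun _ ht =>
  (Filter.eventuallyEq_of_mem (hU.mem_nhds ht) h).lineDeriv_eq

lemma iterate_partialDeriv_congr {f g : (Fin n → ℝ) → ℝ} (h : Set.EqOn f g U) (i : Fin n) (m : ℕ) :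
    Set.EqOn ((partialDeriv i)^[m] f) ((partialDeriv i)^[m] g) U := by
  induction m generalizing f g with
  | zero => exact h
  | succ m ih => exact ih (partialDeriv_congr hU h i)

lemma contDiffOn_partialDeriv {f : (Fin n → ℝ) → ℝ} (hf : ContDiffOn ℝ ∞ f U) (i : Fin n) :
    ContDiffOn ℝ ∞ (partialDeriv i f) U := by
  have h : ContDiffOn ℝ ∞ (fun t => fderiv ℝ f t (Pi.single i 1)) U :=
    (hf.fderiv_of_isOpen hU (by simp)).clm_apply contDiffOn_const
  exact h.congr fun t ht => partialDeriv_eq_fderiv i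
    ((hf.differentiableOn (by simp)).differentiableAt (hU.mem_nhds ht))

lemma partialDeriv_comm {f : (Fin n → ℝ) → ℝ} (hf : ContDiffOn ℝ ∞ f U) (i j : Fin n) :
    Set.EqOn (partialDeriv i (partialDeriv j f)) (partialDeriv j (partialDeriv i f)) U := by
  have hd : ∀ t ∈ U, DifferentiableAt ℝ f t := fun t ht =>
    (hf.differentiableOn (by simp)).differentiableAt (hU.mem_nhds ht)
  have h1 : ContDiffOn ℝ ∞ (fderiv ℝ f) U := hf.fderiv_of_isOpen hU (by simp)
  have key : ∀ a b : Fin n, ∀ t ∈ U, partialDeriv a (partialDeriv b f) t =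
      fderiv ℝ (fderiv ℝ f) t (Pi.single a 1) (Pi.single b 1) := by
    intro a b t ht
    have h2 : DifferentiableAt ℝ (fderiv ℝ f) t :=
      (h1.differentiableOn (by simp)).differentiableAt (hU.mem_nhds ht)
    rw [partialDeriv_congr hU (g := fun t => fderiv ℝ f t (Pi.single b 1))
      (fun s hs => partialDeriv_eq_fderiv b (hd s hs)) a ht,
      partialDeriv_eq_fderiv a (h2.clm_apply (differentiableAt_const _)),
      fderiv_clm_apply h2 (differentiableAt_const _)]
    simp
  intro t ht
  rw [key i j t ht, key j i t ht]
  have hs : IsSymmSndFDerivAt ℝ f t :=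
    (hf.contDiffAt (hU.mem_nhds ht)).isSymmSndFDerivAt
      (by simp only [minSmoothness_of_isRCLikeNormedField]; exact WithTop.coe_le_coe.2 le_top)
  exact hs.eq _ _

/-- If a family indexed by multi-indices is stable under partial derivatives, then iterated
derivatives shift the index. -/
lemma multiDeriv_of_partialDeriv_family (J : (Fin n → ℕ) → (Fin n → ℝ) → ℝ)
    (hJ : ∀ α i, Set.EqOn (partialDeriv i (J α)) (J (α + Pi.single i 1)) U) (α β : Fin n → ℕ) :
    Set.EqOn (multiDeriv β (J α)) (J (α + β)) U := by
  have h1 : ∀ (m : ℕ) (i : Fin n) (α : Fin n → ℕ),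
      Set.EqOn ((partialDeriv i)^[m] (J α)) (J (α + Pi.single i m)) U := by
    intro m i
    induction m with
    | zero => intro α t _; simp
    | succ m ih =>
      intro α
      rw [Function.iterate_succ_apply]
      refine (iterate_partialDeriv_congr hU (hJ α i) i m).trans ((ih _).trans ?_)
      rw [add_assoc, ← Pi.single_add, add_comm 1 m]
      exact fun _ _ => rfl
  have h2 : ∀ l : List (Fin n),
      Set.EqOn (l.foldr (fun i h => (partialDeriv i)^[β i] h) (J α))
        (J (α + (l.map fun i => Pi.single i (β i)).sum)) U := by
    intro l
    induction l with
    | nil => intro t _; simp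
    | cons i l ih =>
      simp only [List.foldr_cons, List.map_cons, List.sum_cons]
      refine (iterate_partialDeriv_congr hU ih i _).trans ((h1 _ _ _).trans ?_)
      rw [add_assoc, add_comm (List.sum _)]
      exact fun _ _ => rfl
  have h3 : ((List.finRange n).map fun i => Pi.single i (β i)).sum = β := by
    rw [← List.ofFn_eq_map, List.sum_ofFn]
    exact Finset.univ_sum_single β
  have := h2 (List.finRange n)
  rwa [h3] at this

lemma multiDeriv_congr {f g : (Fin n → ℝ) → ℝ} (h : Set.EqOn f g U) (α : Fin n → ℕ) :
    Set.EqOn (multiDeriv α f) (multiDeriv α g) U := by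
  unfold multiDeriv
  induction List.finRange n with
  | nil => exact h
  | cons i l ih => exact iterate_partialDeriv_congr hU ih i _

lemma contDiffOn_iterate_partialDeriv {f : (Fin n → ℝ) → ℝ} (hf : ContDiffOn ℝ ∞ f U) (i : Fin n)
    (m : ℕ) : ContDiffOn ℝ ∞ ((partialDeriv i)^[m] f) U := by
  induction m generalizing f with
  | zero => exact hf
  | succ m ih => exact ih (contDiffOn_partialDeriv hU hf i)

lemma contDiffOn_multiDeriv {f : (Fin n → ℝ) → ℝ} (hf : ContDiffOn ℝ ∞ f U) (α : Fin n → ℕ) :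
    ContDiffOn ℝ ∞ (multiDeriv α f) U := by
  unfold multiDeriv
  induction List.finRange n with
  | nil => exact hf
  | cons i l ih => exact contDiffOn_iterate_partialDeriv hU ih i _

lemma partialDeriv_iterate_comm {f : (Fin n → ℝ) → ℝ} (hf : ContDiffOn ℝ ∞ f U) (i j : Fin n)
    (m : ℕ) : Set.EqOn (partialDeriv i ((partialDeriv j)^[m] f))
      ((partialDeriv j)^[m] (partialDeriv i f)) U := by
  induction m generalizing f with
  | zero => exact fun _ _ => rfl
  | succ m ih =>
    exact (ih (contDiffOn_partialDeriv hU hf j)).trans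
      (iterate_partialDeriv_congr hU (partialDeriv_comm hU hf i j) j m)

/-- Commutation of partial derivatives moves the extra `∂_i` inwards through the ordered product
until it meets the block `∂_i^{α_i}`. -/
lemma partialDeriv_multiDeriv {f : (Fin n → ℝ) → ℝ} (hf : ContDiffOn ℝ ∞ f U) (i : Fin n)
    (α : Fin n → ℕ) :
    Set.EqOn (partialDeriv i (multiDeriv α f)) (multiDeriv (α + Pi.single i 1) f) U := by
  have h0 : ∀ l : List (Fin n), ContDiffOn ℝ ∞ (l.foldr (fun i h => (partialDeriv i)^[α i] h) f) U := by
    intro l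
    induction l with
    | nil => exact hf
    | cons i l ih => exact contDiffOn_iterate_partialDeriv hU ih i _
  -- The order of differentiation in `i` changes only if `i` occurs in the list, and then exactly
  -- once because the list has no repetition; the induction carries both cases.
  have h1 : ∀ l : List (Fin n), l.Nodup →
      (i ∉ l → Set.EqOn (l.foldr (fun j h => (partialDeriv j)^[(α + Pi.single i 1 : Fin n → ℕ) j] h) f)
        (l.foldr (fun j h => (partialDeriv j)^[α j] h) f) U) ∧
      (i ∈ l → Set.EqOn (l.foldr (fun j h => (partialDeriv j)^[(α + Pi.single i 1 : Fin n → ℕ) j] h) f)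
        (partialDeriv i (l.foldr (fun j h => (partialDeriv j)^[α j] h) f)) U) := by
    intro l hl
    induction l with
    | nil => simp [Set.EqOn]
    | cons j l ih =>
      have ih := ih hl.of_cons
      have hjl : j ∉ l := (List.nodup_cons.1 hl).1
      simp only [List.foldr_cons]
      refine ⟨fun hi => ?_, fun hi => ?_⟩
      · have hij : j ≠ i := fun h => hi (by simp [h])
        have : (α + Pi.single i 1 : Fin n → ℕ) j = α j := by simp [hij]
        rw [this]
        exact iterate_partialDeriv_congr hU (ih.1 fun h => hi (List.mem_cons_of_mem _ h)) j _
      · by_cases hij : j = i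
        · subst hij
          have : (α + Pi.single j 1 : Fin n → ℕ) j = α j + 1 := by simp
          rw [this, Function.iterate_succ_apply']
          exact partialDeriv_congr hU (iterate_partialDeriv_congr hU (ih.1 hjl) j _) j
        · have hil : i ∈ l := by
            rcases List.mem_cons.1 hi with h | h
            · exact absurd h.symm hij
            · exact h
          have : (α + Pi.single i 1 : Fin n → ℕ) j = α j := by simp [hij]
          rw [this]
          refine (iterate_partialDeriv_congr hU (ih.2 hil) j _).trans ?_
          exact (partialDeriv_iterate_comm hU (h0 l) i j _).symm
  exact ((h1 _ (List.nodup_finRange n)).2 (List.mem_finRange i)).symm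

lemma multiDeriv_multiDeriv {f : (Fin n → ℝ) → ℝ} (hf : ContDiffOn ℝ ∞ f U) (α β : Fin n → ℕ) :
    Set.EqOn (multiDeriv β (multiDeriv α f)) (multiDeriv (α + β) f) U :=
  multiDeriv_of_partialDeriv_family hU (fun α => multiDeriv α f)
    (fun α i => partialDeriv_multiDeriv hU hf i α) α β

/-- A family of functions indexed by multi-indices that is stable under differentiation consists
of smooth functions. -/
lemma contDiffOn_of_hasFDerivAt_family (J : (Fin n → ℕ) → (Fin n → ℝ) → ℝ)
    (hJ : ∀ α, ∀ t ∈ U, HasFDerivAt (J α)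
      (∑ i, J (α + Pi.single i 1) t • ContinuousLinearMap.proj (R := ℝ) (φ := fun _ => ℝ) i) t)
    (α : Fin n → ℕ) : ContDiffOn ℝ ∞ (J α) U := by
  rw [contDiffOn_infty]
  intro m
  induction m generalizing α with
  | zero =>
    exact contDiffOn_zero.2 fun t ht => (hJ α t ht).continuousAt.continuousWithinAt
  | succ m ih =>
    have : ((m + 1 : ℕ) : WithTop ℕ∞) = (m : WithTop ℕ∞) + 1 := by norm_cast
    rw [this, contDiffOn_succ_iff_fderiv_of_isOpen hU]
    refine ⟨fun t ht => (hJ α t ht).differentiableAt.differentiableWithinAt, by simp, ?_⟩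
    refine ContDiffOn.congr (f := fun t => ∑ i, J (α + Pi.single i 1) t •
      ContinuousLinearMap.proj (R := ℝ) (φ := fun _ => ℝ) i) ?_ fun t ht => (hJ α t ht).fderiv
    exact ContDiffOn.sum fun i _ => (ih _).smul contDiffOn_const

lemma multiDeriv_of_hasFDerivAt_family (J : (Fin n → ℕ) → (Fin n → ℝ) → ℝ)
    (hJ : ∀ α, ∀ t ∈ U, HasFDerivAt (J α)
      (∑ i, J (α + Pi.single i 1) t • ContinuousLinearMap.proj (R := ℝ) (φ := fun _ => ℝ) i) t)
    (β : Fin n → ℕ) : Set.EqOn (multiDeriv β (J 0)) (J β) U := by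
  have := multiDeriv_of_partialDeriv_family hU J (fun α i t ht => ?_) 0 β
  · rwa [zero_add] at this
  · rw [partialDeriv_eq_fderiv i (hJ α t ht).differentiableAt, (hJ α t ht).fderiv]
    simp [Pi.single_apply]

end Open

lemma partialDeriv_translate (f : (Fin n → ℝ) → ℝ) (c : Fin n → ℝ) (i : Fin n) :
    partialDeriv i (fun t => f (t + c)) = fun t => partialDeriv i f (t + c) := by
  funext t
  simp only [partialDeriv, lineDeriv]
  congr 1
  funext s
  congr 1
  abel

lemma multiDeriv_translate (f : (Fin n → ℝ) → ℝ) (c : Fin n → ℝ) (α : Fin n → ℕ) :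
    multiDeriv α (fun t => f (t + c)) = fun t => multiDeriv α f (t + c) := by
  unfold multiDeriv
  induction List.finRange n with
  | nil => rfl
  | cons i l ih =>
    simp only [List.foldr_cons]
    rw [ih]
    generalize l.foldr (fun i h => (partialDeriv i)^[α i] h) f = h
    induction α i generalizing h with
    | zero => rfl
    | succ m ihm => rw [Function.iterate_succ_apply, partialDeriv_translate, ihm]; rfl

lemma multiDeriv_zero (f : (Fin n → ℝ) → ℝ) : multiDeriv 0 f = f := by
  unfold multiDeriv
  induction List.finRange n with
  | nil => rfl
  | cons _ _ _ => simp

/-- The family of differences of derivatives is itself stable under differentiation, so no induction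
over the iterated derivative is needed. -/
lemma multiDeriv_sub {U : Set (Fin n → ℝ)} (hU : IsOpen U) {f g : (Fin n → ℝ) → ℝ}
    (hf : ContDiffOn ℝ ∞ f U) (hg : ContDiffOn ℝ ∞ g U) (α : Fin n → ℕ) :
    Set.EqOn (multiDeriv α (fun t => f t - g t)) (fun t => multiDeriv α f t - multiDeriv α g t) U := by
  have := multiDeriv_of_partialDeriv_family hU
    (fun α t => multiDeriv α f t - multiDeriv α g t) (fun α i t ht => ?_) 0 α
  · simpa only [multiDeriv_zero, zero_add] using this
  · have hd : ∀ f : (Fin n → ℝ) → ℝ, ContDiffOn ℝ ∞ f U → DifferentiableAt ℝ (multiDeriv α f) t :=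
      fun f hf => ((contDiffOn_multiDeriv hU hf α).differentiableOn (by simp)).differentiableAt
        (hU.mem_nhds ht)
    rw [partialDeriv_eq_fderiv i ((hd f hf).fun_sub (hd g hg)), fderiv_fun_sub (hd f hf) (hd g hg)]
    simp only [sub_apply, ← partialDeriv_eq_fderiv i (hd f hf),
      ← partialDeriv_eq_fderiv i (hd g hg)]
    rw [partialDeriv_multiDeriv hU hf i α ht, partialDeriv_multiDeriv hU hg i α ht]

/-! ### Sign conditions on derivatives and their passage to differences. -/

/-- Smooth functions on the open orthant whose derivatives `∂^α` with `α ≥ 1_G` have the sign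
`(-1)^{|α| - |G|}`. -/
def HasAlternatingDerivs (G : Finset (Fin n)) (f : (Fin n → ℝ) → ℝ) : Prop :=
  ContDiffOn ℝ ∞ f (openOrthant n) ∧ ∀ α : Fin n → ℕ, (∀ i ∈ G, 1 ≤ α i) →
    ∀ t ∈ openOrthant n, 0 ≤ (-1 : ℝ) ^ (∑ i, α i + G.card) * multiDeriv α f t

lemma sum_indicatorIndex (F : Finset (Fin n)) : ∑ i, indicatorIndex F i = F.card := by
  simp [indicatorIndex]

/-- A multi-index dominating `1_F` is `1_F + β`, and `(-1)^{|β|}` equals `(-1)^{|α| + |F|}` because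
the two differ by an even exponent. -/
lemma IsBernsteinOfOrder.hasAlternatingDerivs {k : ℕ} {g : (Fin n → ℝ) → ℝ}
    (hg : IsBernsteinOfOrder k g) {F : Finset (Fin n)} (hF : F.card = k) :
    HasAlternatingDerivs F g := by
  refine ⟨hg.1, fun α hα t ht => ?_⟩
  obtain ⟨β, rfl⟩ : ∃ β, α = indicatorIndex F + β := by
    refine ⟨fun i => α i - indicatorIndex F i, funext fun i => ?_⟩
    by_cases hi : i ∈ F
    · have := hα i hi
      simp [indicatorIndex, hi]; omega
    · simp [indicatorIndex, hi]
  have h := (hg.2 F hF).2 β t ht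
  rw [multiDeriv_multiDeriv (isOpen_openOrthant n) hg.1 _ _ ht] at h
  convert h using 2
  simp only [Pi.add_apply, Finset.sum_add_distrib, sum_indicatorIndex]
  rw [show F.card + ∑ i, β i + F.card = ∑ i, β i + 2 * F.card by ring, pow_add, pow_mul]
  simp

lemma add_single_mem_openOrthant {t : Fin n → ℝ} (ht : t ∈ openOrthant n) (i : Fin n) {c : ℝ}
    (hc : 0 ≤ c) : t + Pi.single i c ∈ openOrthant n := by
  intro j
  have h1 := ht j
  have h2 : 0 ≤ (Pi.single i c : Fin n → ℝ) j := by
    by_cases h : j = i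
    · subst h; simpa
    · simp [h]
  simp only [Pi.add_apply]
  linarith

lemma contDiffOn_translate {f : (Fin n → ℝ) → ℝ} (hf : ContDiffOn ℝ ∞ f (openOrthant n))
    (i : Fin n) {c : ℝ} (hc : 0 ≤ c) :
    ContDiffOn ℝ ∞ (fun t => f (t + Pi.single i c)) (openOrthant n) := by
  have h : ContDiff ℝ ∞ (fun t : Fin n → ℝ => t + Pi.single i c) := contDiff_id.add contDiff_const
  exact hf.comp h.contDiffOn fun _ ht => add_single_mem_openOrthant ht i hc

/-- The derivative along the `i`-th axis is a multiple of `∂^{α + e_i} f`, whose sign is known. Only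
`α + e_i` has to dominate `1_G`; thus `α` itself may miss the index `i ∈ G`, which is the case
needed when a difference replaces a derivative. -/
lemma HasAlternatingDerivs.monotone {G : Finset (Fin n)} {f : (Fin n → ℝ) → ℝ}
    (hf : HasAlternatingDerivs G f) {α : Fin n → ℕ} {i : Fin n}
    (hα : ∀ j ∈ G, 1 ≤ (α + Pi.single i 1 : Fin n → ℕ) j) {t : Fin n → ℝ} (ht : t ∈ openOrthant n) {c : ℝ}
    (hc : 0 ≤ c) :
    0 ≤ (-1 : ℝ) ^ (∑ i, α i + 1 + G.card) *
      (multiDeriv α f (t + Pi.single i c) - multiDeriv α f t) := by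
  have hU := isOpen_openOrthant n
  have hmem : ∀ s : ℝ, 0 ≤ s → t + Pi.single i s ∈ openOrthant n :=
    fun s hs => add_single_mem_openOrthant ht i hs
  have hder : ∀ s : ℝ, 0 ≤ s → HasDerivAt
      (fun s : ℝ => (-1 : ℝ) ^ (∑ i, α i + 1 + G.card) * multiDeriv α f (t + Pi.single i s))
      ((-1 : ℝ) ^ (∑ i, α i + 1 + G.card) *
        multiDeriv (α + Pi.single i 1) f (t + Pi.single i s)) s := by
    intro s hs
    have hd : DifferentiableAt ℝ (multiDeriv α f) (t + Pi.single i s) :=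
      ((contDiffOn_multiDeriv hU hf.1 α).differentiableOn (by simp)).differentiableAt
        (hU.mem_nhds (hmem s hs))
    have h1 : HasDerivAt (fun s : ℝ => t + Pi.single i s) (Pi.single i (1 : ℝ)) s := by
      have : (fun s : ℝ => t + Pi.single i s) = fun s : ℝ => t + s • (Pi.single i (1 : ℝ) : Fin n → ℝ) := by
        funext s; rw [← Pi.single_smul]; simp
      rw [this]
      simpa using ((hasDerivAt_id s).smul_const (Pi.single i (1 : ℝ) : Fin n → ℝ)).const_add t
    have h2 := hd.hasFDerivAt.comp_hasDerivAt s h1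
    rw [← partialDeriv_multiDeriv hU hf.1 i α (hmem s hs), partialDeriv_eq_fderiv i hd]
    exact h2.const_mul _
  have hmono : MonotoneOn
      (fun s : ℝ => (-1 : ℝ) ^ (∑ i, α i + 1 + G.card) * multiDeriv α f (t + Pi.single i s))
      (Set.Ici 0) := by
    refine monotoneOn_of_deriv_nonneg (convex_Ici 0)
      (fun s hs => (hder s hs).continuousAt.continuousWithinAt) (fun s hs => ?_) fun s hs => ?_
    · exact (hder s (interior_subset hs)).differentiableAt.differentiableWithinAt
    · rw [(hder s (interior_subset hs)).deriv]
      have := hf.2 (α + Pi.single i 1) hα _ (hmem s (interior_subset hs))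
      simpa [Finset.sum_add_distrib] using this
  have := hmono (Set.mem_Ici.2 le_rfl) (Set.mem_Ici.2 hc) hc
  simp only [Pi.single_zero, add_zero] at this
  rw [mul_sub]
  linarith

/-- A difference in a direction of `G` takes the place of one of the required derivatives, so that
direction leaves `G`. -/
lemma HasAlternatingDerivs.sub_mem {G : Finset (Fin n)} {f : (Fin n → ℝ) → ℝ}
    (hf : HasAlternatingDerivs G f) {i : Fin n} (hi : i ∈ G) {c : ℝ} (hc : 0 ≤ c) :
    HasAlternatingDerivs (G.erase i) (fun t => f (t + Pi.single i c) - f t) := by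
  refine ⟨(contDiffOn_translate hf.1 i hc).sub hf.1, fun α hα t ht => ?_⟩
  rw [multiDeriv_sub (isOpen_openOrthant n) (contDiffOn_translate hf.1 i hc) hf.1 α ht,
    multiDeriv_translate]
  have := hf.monotone (α := α) (i := i) (fun j hj => ?_) ht hc
  · have hc := Finset.card_erase_add_one hi
    rw [← hc, show ∑ i, α i + 1 + ((G.erase i).card + 1) = (∑ i, α i + (G.erase i).card) + 2 by
      ring, pow_add] at this
    simpa using this
  · by_cases hji : j = i
    · subst hji; simp
    · simpa [hji] using hα j (Finset.mem_erase.2 ⟨hji, hj⟩)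

/-- The negative of a difference preserves the class in every direction, in `G` or not: the one
further derivative contributes exactly the extra sign. -/
lemma HasAlternatingDerivs.sub_translate {G : Finset (Fin n)} {f : (Fin n → ℝ) → ℝ}
    (hf : HasAlternatingDerivs G f) (i : Fin n) {c : ℝ} (hc : 0 ≤ c) :
    HasAlternatingDerivs G (fun t => f t - f (t + Pi.single i c)) := by
  refine ⟨hf.1.sub (contDiffOn_translate hf.1 i hc), fun α hα t ht => ?_⟩
  rw [multiDeriv_sub (isOpen_openOrthant n) hf.1 (contDiffOn_translate hf.1 i hc) α ht,
    multiDeriv_translate]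
  have := hf.monotone (α := α) (i := i) (fun j hj => ?_) ht hc
  · rw [show ∑ i, α i + 1 + G.card = (∑ i, α i + G.card) + 1 by ring, pow_succ] at this
    linarith
  · exact (hα j hj).trans (by simp)

end

noncomputable section

/-! ### The Hausdorff moment problem on the cube -/

/-- The identity `C(j,m) C(N,j) = C(N,m) C(N-m,j-m)` reduces the sum to the binomial expansion of
`(x + (1-x))^{N-m}`. An arbitrary commutative ring is allowed because `x` will be a translation
operator. -/
lemma sum_choose_mul_choose_mul_pow {A : Type*} [CommRing A] (x : A) {m N : ℕ} (h : m ≤ N) :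
    ∑ j ∈ Finset.range (N + 1), ((j.choose m : A) * (N.choose j : A)) * x ^ j * (1 - x) ^ (N - j) =
      (N.choose m : A) * x ^ m := by
  obtain ⟨d, rfl⟩ := Nat.exists_eq_add_of_le h
  rw [add_assoc, Finset.sum_range_add, Finset.sum_eq_zero, zero_add]
  · have hb : ∑ j ∈ Finset.range (d + 1), x ^ j * (1 - x) ^ (d - j) * (d.choose j : A) = 1 := by
      rw [← add_pow]; simp
    rw [← mul_one ((((m + d).choose m : ℕ) : A) * x ^ m)]
    conv_rhs => rw [← hb, Finset.mul_sum]
    refine Finset.sum_congr rfl fun j hj => ?_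
    have hj' : j ≤ d := by simpa [Nat.lt_succ_iff] using hj
    have hc := Nat.choose_mul (n := m + d) (k := m + j) (s := m) (by omega)
    rw [show m + d - m = d by omega, show m + j - m = j by omega] at hc
    have hc' : (((m + j).choose m : ℕ) : A) * ((m + d).choose (m + j) : ℕ) =
        ((m + d).choose m : ℕ) * (d.choose j : ℕ) := by
      rw [mul_comm]; exact_mod_cast congrArg (Nat.cast (R := A)) hc
    rw [hc', show m + d - (m + j) = d - j by omega, pow_add]
    ring
  · intro j hj
    rw [Nat.choose_eq_zero_of_lt (Finset.mem_range.1 hj)]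
    simp

lemma choose_div_choose_mem_Icc {j N : ℕ} (hj : j ≤ N) (m : ℕ) :
    (j.choose m : ℝ) / (N.choose m : ℝ) ∈ Set.Icc (0 : ℝ) 1 :=
  ⟨by positivity, div_le_one_of_le₀ (by exact_mod_cast Nat.choose_le_choose m hj) (by positivity)⟩

/-- Passing from `m` to `m + 1` multiplies the two quantities by `(j-m)/(N-m)` (truncated at zero)
and `j/N`, which differ by at most `m/N`. All factors lie in `[0,1]`, so the errors add, and `m² + m
≤ (m+1)²`. -/
lemma abs_choose_div_choose_sub_pow_le {j m N : ℕ} (hj : j ≤ N) (hm : m ≤ N) :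
    |(j.choose m : ℝ) / (N.choose m : ℝ) - ((j : ℝ) / N) ^ m| ≤ (m : ℝ) ^ 2 / N := by
  induction m with
  | zero => simp
  | succ m ih =>
    have ih := ih (by omega)
    have hN : (0 : ℝ) < N := by exact_mod_cast (by omega : 0 < N)
    have hNm : (0 : ℝ) < ((N - m : ℕ) : ℝ) := by exact_mod_cast (by omega : 0 < N - m)
    have hrec : ∀ i : ℕ, (i.choose (m + 1) : ℝ) * (m + 1) = i.choose m * ((i - m : ℕ) : ℝ) := by
      intro i; exact_mod_cast Nat.choose_succ_right_eq i m
    have h1 : (j.choose (m + 1) : ℝ) / (N.choose (m + 1) : ℝ) =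
        ((j.choose m : ℝ) / N.choose m) * (((j - m : ℕ) : ℝ) / ((N - m : ℕ) : ℝ)) := by
      have hm1 : (0 : ℝ) < (m : ℝ) + 1 := by positivity
      rw [← mul_div_mul_right _ _ hm1.ne', hrec, hrec, mul_div_mul_comm]
    obtain ⟨ha0, ha1⟩ := choose_div_choose_mem_Icc hj m
    have hc0 : 0 ≤ (j : ℝ) / N := by positivity
    have hc1 : (j : ℝ) / N ≤ 1 := div_le_one_of_le₀ (by exact_mod_cast hj) hN.le
    have h2 : |((j - m : ℕ) : ℝ) / ((N - m : ℕ) : ℝ) - (j : ℝ) / N| ≤ m / N := by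
      have hNc : ((N - m : ℕ) : ℝ) = N - m := by push_cast [Nat.cast_sub (by omega : m ≤ N)]; ring
      have hjN : (j : ℝ) ≤ N := by exact_mod_cast hj
      rcases le_total m j with h | h
      · have hjc : ((j - m : ℕ) : ℝ) = j - m := by push_cast [Nat.cast_sub h]; ring
        have hmj : (m : ℝ) ≤ j := by exact_mod_cast h
        have hmN : (0 : ℝ) < N - m := hNc ▸ hNm
        rw [hNc, hjc]
        have : ((j : ℝ) - m) / (N - m) - j / N = - (m * (N - j) / (N * (N - m))) := by
          rw [div_sub_div _ _ hmN.ne' hN.ne', neg_div', div_eq_div_iff (by positivity) (by positivity)]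
          ring
        rw [this, abs_neg, abs_of_nonneg (by
          have : (0 : ℝ) ≤ N - j := by linarith
          positivity)]
        rw [div_le_div_iff₀ (by positivity) hN]
        have : (m : ℝ) * (N - j) * N ≤ m * (N - m) * N := by gcongr
        linarith
      · have : j - m = 0 := by omega
        have hmj : (j : ℝ) ≤ m := by exact_mod_cast h
        rw [this]
        simp only [Nat.cast_zero, zero_div, zero_sub, abs_neg, abs_of_nonneg hc0]
        gcongr
    have hb0 : 0 ≤ ((j : ℝ) / N) ^ m := by positivity
    rw [h1, pow_succ]
    have : ∀ a b c d : ℝ, a * b - c * d = a * (b - d) + (a - c) * d := by intros; ring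
    rw [this]
    calc _ ≤ 1 * (m / N) + (m : ℝ) ^ 2 / N * 1 := by
          refine (abs_add_le _ _).trans ?_
          rw [abs_mul, abs_mul, abs_of_nonneg ha0, abs_of_nonneg hc0]
          gcongr
      _ ≤ _ := by
          rw [one_mul, mul_one, ← add_div]
          gcongr
          push_cast; nlinarith

/-- Factors are exchanged one at a time, the others being bounded by one. -/
lemma abs_prod_sub_prod_le {ι : Type*} (s : Finset ι) (a b : ι → ℝ)
    (ha : ∀ i ∈ s, a i ∈ Set.Icc (0 : ℝ) 1) (hb : ∀ i ∈ s, b i ∈ Set.Icc (0 : ℝ) 1) :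
    |∏ i ∈ s, a i - ∏ i ∈ s, b i| ≤ ∑ i ∈ s, |a i - b i| := by
  classical
  induction s using Finset.induction_on with
  | empty => simp
  | insert i s hi ih =>
    rw [Finset.prod_insert hi, Finset.prod_insert hi, Finset.sum_insert hi]
    have ih := ih (fun j hj => ha j (Finset.mem_insert_of_mem hj))
      (fun j hj => hb j (Finset.mem_insert_of_mem hj))
    have h1 := hb i (Finset.mem_insert_self i s)
    have h2 : |∏ i ∈ s, a i| ≤ 1 := by
      rw [abs_of_nonneg (Finset.prod_nonneg fun j hj => (ha j (Finset.mem_insert_of_mem hj)).1)]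
      exact Finset.prod_le_one (fun j hj => (ha j (Finset.mem_insert_of_mem hj)).1)
        fun j hj => (ha j (Finset.mem_insert_of_mem hj)).2
    have : a i * ∏ i ∈ s, a i - b i * ∏ i ∈ s, b i =
      (a i - b i) * ∏ i ∈ s, a i + b i * (∏ i ∈ s, a i - ∏ i ∈ s, b i) := by ring
    rw [this]
    refine (abs_add_le _ _).trans ?_
    rw [abs_mul, abs_mul, abs_of_nonneg h1.1]
    refine add_le_add (mul_le_of_le_one_right (abs_nonneg _) h2) ?_
    exact (mul_le_of_le_one_left (abs_nonneg _) h1.2).trans ih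

open MeasureTheory Filter Topology CompactlySupported

/-- A sequence of uniformly bounded positive linear functionals on `C(X)`, `X` compact, that
converges on a set of functions, has a limit on this set given by a finite measure. -/
lemma exists_measure_of_tendsto {X : Type*} [TopologicalSpace X] [T2Space X] [CompactSpace X]
    [MeasurableSpace X] [BorelSpace X] (L : ℕ → C(X, ℝ) →ₗ[ℝ] ℝ)
    (hpos : ∀ N f, 0 ≤ f → 0 ≤ L N f) {C : ℝ} (hC : ∀ N, L N 1 ≤ C) :
    ∃ μ : Measure X, IsFiniteMeasure μ ∧ ∀ (f : C(X, ℝ)) (c : ℝ),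
      Tendsto (fun N => L N f) atTop (𝓝 c) → ∫ x, f x ∂μ = c := by
  have hC0 : 0 ≤ C := (hpos 0 1 zero_le_one).trans (hC 0)
  -- Positivity applied to `‖f‖ · 1 ± f` bounds the functionals uniformly in `N`.
  have hbd : ∀ N f, L N f ∈ Set.Icc (-(C * ‖f‖)) (C * ‖f‖) := by
    intro N f
    have hle : ∀ g : C(X, ℝ), ‖g‖ ≤ ‖f‖ → L N g ≤ C * ‖f‖ := by
      intro g hg
      have h1 : 0 ≤ L N (‖f‖ • 1 - g) := by
        refine hpos N _ fun x => ?_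
        have := (le_abs_self _).trans ((g.norm_coe_le_norm x).trans hg)
        simpa using this
      rw [map_sub, map_smul, smul_eq_mul] at h1
      have h2 := mul_le_mul_of_nonneg_left (hC N) (norm_nonneg f)
      linarith
    have h1 := hle f le_rfl
    have h2 := hle (-f) (by simp)
    rw [map_neg] at h2
    exact ⟨by linarith, h1⟩
  -- A limit along one fixed ultrafilter exists for all `f` simultaneously and is linear and
  -- positive, so Riesz–Markov applies to it. It agrees with every ordinary limit that exists.
  have hlim : ∀ f : C(X, ℝ), ∃ c, Tendsto (fun N => L N f) (hyperfilter ℕ) (𝓝 c) := by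
    intro f
    obtain ⟨c, -, hc⟩ := (isCompact_Icc (a := -(C * ‖f‖)) (b := C * ‖f‖)).ultrafilter_le_nhds'
      ((hyperfilter ℕ).map fun N => L N f) (by
        rw [Ultrafilter.mem_map]; exact Filter.univ_mem' fun N => hbd N f)
    exact ⟨c, hc⟩
  choose Λ hΛ using hlim
  let Φ : C_c(X, ℝ) →ₗ[ℝ] ℝ :=
    { toFun := fun f => Λ f.toContinuousMap
      map_add' := fun f g => by
        refine tendsto_nhds_unique (hΛ _) ?_
        have hfg : (f + g).toContinuousMap = f.toContinuousMap + g.toContinuousMap := rfl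
        simpa [hfg] using (hΛ f.toContinuousMap).add (hΛ g.toContinuousMap)
      map_smul' := fun a f => by
        refine tendsto_nhds_unique (hΛ _) ?_
        have haf : (a • f).toContinuousMap = a • f.toContinuousMap := rfl
        simpa [haf] using (hΛ f.toContinuousMap).const_mul a }
  let Ψ : C_c(X, ℝ) →ₚ[ℝ] ℝ := PositiveLinearMap.mk₀ Φ fun f hf =>
    ge_of_tendsto (hΛ f.toContinuousMap) (Eventually.of_forall fun N => hpos N _ hf)
  refine ⟨RealRMK.rieszMeasure Ψ, inferInstance, fun f c hc => ?_⟩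
  have h := RealRMK.integral_rieszMeasure Ψ (CompactlySupportedContinuousMap.continuousMapEquiv f)
  refine h.trans ?_
  exact tendsto_nhds_unique (hΛ f) (hc.mono_left Nat.hyperfilter_le_atTop)

variable {n : ℕ}

/-- The monomial `x^m` on the cube. -/
def cubeMonomial (m : Fin n → ℕ) : C(Fin n → unitInterval, ℝ) :=
  ⟨fun x => ∏ i, (x i : ℝ) ^ m i, by fun_prop⟩

/-- Applying `L` to the Bernstein basis of degree `N` gives nonnegative masses at the grid points
`j/N`. The exact formula for `L(X^m)` uses `∏ C(j_i,m_i)/C(N,m_i)` in place of `∏ (j_i/N)^{m_i}`,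
and the discrepancy is `O(1/N)`. The total mass is always `L 1`, so the discrete measures have a
limit with the required moments. -/
theorem exists_measure_hausdorff {A : Type*} [CommRing A] [Algebra ℝ A] (X : Fin n → A)
    (L : A →ₗ[ℝ] ℝ) (hL : ∀ a b : Fin n → ℕ, 0 ≤ L (∏ i, X i ^ a i * (1 - X i) ^ b i)) :
    ∃ μ : Measure (Fin n → unitInterval), IsFiniteMeasure μ ∧
      ∀ m : Fin n → ℕ, ∫ x, cubeMonomial m x ∂μ = L (∏ i, X i ^ m i) := by
  let J : ℕ → Finset (Fin n → ℕ) := fun N => Fintype.piFinset fun _ => Finset.range (N + 1)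
  let w : ℕ → (Fin n → ℕ) → ℝ := fun N j =>
    (∏ i, (N.choose (j i) : ℝ)) * L (∏ i, X i ^ j i * (1 - X i) ^ (N - j i))
  -- The clamping only makes the point well defined for every `j`; on the grid `J N` it has no
  -- effect, also for `N = 0`, where the quotient is zero.
  let pt : ℕ → (Fin n → ℕ) → (Fin n → unitInterval) := fun N j i =>
    ⟨max 0 (min 1 ((j i : ℝ) / N)), by simp, by simp⟩
  have hw : ∀ N j, 0 ≤ w N j := fun N j => mul_nonneg (by positivity) (hL _ _)
  let ev : ℕ → C(Fin n → unitInterval, ℝ) →ₗ[ℝ] ℝ := fun N =>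
    ∑ j ∈ J N, w N j • (ContinuousMap.evalCLM ℝ (pt N j)).toLinearMap
  have hev : ∀ N f, ev N f = ∑ j ∈ J N, w N j * f (pt N j) := by
    intro N f; simp [ev, LinearMap.sum_apply]
  have hpt : ∀ N, ∀ j ∈ J N, ∀ i, ((pt N j i : unitInterval) : ℝ) = (j i : ℝ) / N := by
    intro N j hj i
    have h1 : j i ≤ N := by
      simpa [J, Nat.lt_succ_iff] using Fintype.mem_piFinset.1 hj i
    have h2 : (j i : ℝ) / N ≤ 1 := div_le_one_of_le₀ (by exact_mod_cast h1) (by positivity)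
    have h3 : 0 ≤ (j i : ℝ) / N := by positivity
    simp [pt, h2, h3]
  have hmom : ∀ (m : Fin n → ℕ) (N : ℕ), (∀ i, m i ≤ N) →
      L (∏ i, X i ^ m i) =
        ∑ j ∈ J N, w N j * ∏ i, (((j i).choose (m i) : ℝ) / (N.choose (m i) : ℝ)) := by
    intro m N hm
    have h1 : ∏ i, X i ^ m i = ∑ j ∈ J N, ((∏ i, (N.choose (j i) : ℝ)) *
        ∏ i, (((j i).choose (m i) : ℝ) / (N.choose (m i) : ℝ))) •
          ∏ i, X i ^ j i * (1 - X i) ^ (N - j i) := by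
      have h2 : ∀ i, X i ^ m i = ∑ j ∈ Finset.range (N + 1),
          ((N.choose j : ℝ) * ((j.choose (m i) : ℝ) / (N.choose (m i) : ℝ))) •
            (X i ^ j * (1 - X i) ^ (N - j)) := by
        intro i
        have hne : ((N.choose (m i) : ℕ) : ℝ) ≠ 0 := by
          exact_mod_cast (Nat.choose_pos (hm i)).ne'
        have h3 := sum_choose_mul_choose_mul_pow (X i) (hm i)
        have h4 : X i ^ m i = ((N.choose (m i) : ℕ) : ℝ)⁻¹ • (((N.choose (m i) : ℕ) : A) * X i ^ m i) := by
          rw [← nsmul_eq_mul, ← Nat.cast_smul_eq_nsmul ℝ, smul_smul, inv_mul_cancel₀ hne, one_smul]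
        rw [h4, ← h3, Finset.smul_sum]
        refine Finset.sum_congr rfl fun j _ => ?_
        rw [← Nat.cast_mul, mul_assoc, ← nsmul_eq_mul, ← Nat.cast_smul_eq_nsmul ℝ, smul_smul]
        congr 1
        push_cast
        field_simp
      rw [Finset.prod_congr rfl fun i _ => h2 i, Finset.prod_univ_sum]
      refine Finset.sum_congr rfl fun j _ => ?_
      rw [← Finset.prod_mul_distrib, Finset.prod_smul]
    rw [h1, map_sum]
    refine Finset.sum_congr rfl fun j _ => ?_
    rw [map_smul, smul_eq_mul]
    ring
  have hmass : ∀ N, ∑ j ∈ J N, w N j = L 1 := by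
    intro N
    have := hmom 0 N (by simp)
    simpa using this.symm
  obtain ⟨μ, hμ, h⟩ := exists_measure_of_tendsto ev
    (fun N f hf => by
      rw [hev]; exact Finset.sum_nonneg fun j _ => mul_nonneg (hw N j) (hf _))
    (C := L 1) (fun N => by rw [hev]; simp [hmass])
  refine ⟨μ, hμ, fun m => h _ _ ?_⟩
  rw [tendsto_iff_norm_sub_tendsto_zero]
  have hlim : Tendsto (fun N : ℕ => L 1 * ∑ i, (m i : ℝ) ^ 2 / N) atTop (𝓝 0) := by
    have : Tendsto (fun N : ℕ => L 1 * ∑ i, (m i : ℝ) ^ 2 / N) atTop (𝓝 (L 1 * ∑ i : Fin n, 0)) :=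
      (tendsto_finsetSum _ fun i _ => tendsto_const_div_atTop_nhds_zero_nat _).const_mul _
    simpa using this
  refine squeeze_zero' (Eventually.of_forall fun N => norm_nonneg _) ?_ hlim
  -- This range of `N` ensures `m_i ≤ N` for every `i`, as the moment formula requires.
  filter_upwards [eventually_ge_atTop (∑ i, m i)] with N hN
  have hmN : ∀ i, m i ≤ N := fun i =>
    (Finset.single_le_sum (fun _ _ => Nat.zero_le _) (Finset.mem_univ i)).trans hN
  rw [hev, hmom m N hmN, ← Finset.sum_sub_distrib, ← hmass N, Finset.sum_mul]
  refine (norm_sum_le _ _).trans (Finset.sum_le_sum fun j hj => ?_)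
  have hjN : ∀ i, j i ≤ N := fun i => by
    simpa [J, Nat.lt_succ_iff] using Fintype.mem_piFinset.1 hj i
  rw [← mul_sub, norm_mul, Real.norm_of_nonneg (hw N j)]
  refine mul_le_mul_of_nonneg_left ?_ (hw N j)
  have hcm : cubeMonomial m (pt N j) = ∏ i, ((j i : ℝ) / N) ^ m i := by
    simp only [cubeMonomial, ContinuousMap.coe_mk, hpt N j hj]
  rw [hcm, norm_sub_rev, Real.norm_eq_abs]
  refine (abs_prod_sub_prod_le _ _ _ (fun i _ => choose_div_choose_mem_Icc (hjN i) _)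
    fun i _ => ⟨by positivity, pow_le_one₀ (by positivity)
      (div_le_one_of_le₀ (by exact_mod_cast hjN i) (by positivity))⟩).trans
    (Finset.sum_le_sum fun i _ => abs_choose_div_choose_sub_pow_le (hjN i) (hmN i))

/-! ### Uniqueness -/

/-- Finite measures are determined by the integrals of a point-separating multiplicative family of
bounded continuous functions. -/
lemma measure_ext_of_multiplicative_family {E M : Type*} [MeasurableSpace E] [TopologicalSpace E]
    [PolishSpace E] [BorelSpace E] [AddMonoid M] {μ ν : Measure E} [IsFiniteMeasure μ]
    [IsFiniteMeasure ν] (φ : Multiplicative M →* BoundedContinuousFunction E ℝ)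
    (hsep : ∀ x y : E, x ≠ y → ∃ m, φ m x ≠ φ m y)
    (h : ∀ m, ∫ x, φ m x ∂μ = ∫ x, φ m x ∂ν) : μ = ν := by
  let A : StarSubalgebra ℝ (BoundedContinuousFunction E ℝ) :=
    { Algebra.adjoin ℝ (Set.range φ) with
      star_mem' := fun {a} ha => by
        have : star a = a := by ext x; simp
        rw [this]; exact ha }
  refine ext_of_forall_mem_subalgebra_integral_eq_of_polish (𝕜 := ℝ) (A := A) ?_ fun g hg => ?_
  · intro x y hxy
    obtain ⟨m, hm⟩ := hsep x y hxy
    refine ⟨φ m, ⟨(φ m).toContinuousMap, ?_, rfl⟩, hm⟩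
    exact ⟨φ m, Algebra.subset_adjoin ⟨m, rfl⟩, rfl⟩
  -- The range of the family is closed under products, so the algebra that it generates is only its
  -- linear span.
  · have hg' : g ∈ Submodule.span ℝ (Set.range φ) := by
      have : g ∈ Algebra.adjoin ℝ (Set.range φ) := hg
      rw [← Subalgebra.mem_toSubmodule, Algebra.adjoin_eq_span, ← MonoidHom.coe_mrange,
        Submonoid.closure_eq] at this
      exact this
    clear hg
    induction hg' using Submodule.span_induction with
    | mem x hx => obtain ⟨m, rfl⟩ := hx; exact h m
    | zero => simp
    | add x y _ _ hx hy =>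
      simp only [BoundedContinuousFunction.coe_add, Pi.add_apply]
      rw [integral_add (x.integrable _) (y.integrable _),
        integral_add (x.integrable _) (y.integrable _), hx, hy]
    | smul a x _ hx =>
      simp only [BoundedContinuousFunction.coe_smul]
      rw [integral_smul, integral_smul, hx]

end

noncomputable section

open MeasureTheory Filter Topology NNReal

variable {n : ℕ}

/-! ### The algebra of shifts of the closed orthant -/

/-- The algebra of formal real combinations of points of the closed orthant. -/
abbrev ShiftAlgebra (n : ℕ) : Type := AddMonoidAlgebra ℝ (Fin n → ℝ≥0)

/-- The point `s` as an element of the shift algebra. -/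
def shift (s : Fin n → ℝ≥0) : ShiftAlgebra n := AddMonoidAlgebra.single s 1

/-- The shift by `c` in the direction of the `i`-th coordinate axis. -/
def axisShift (i : Fin n) (c : ℝ≥0) : ShiftAlgebra n := shift (Pi.single i c)

lemma shift_zero : (shift 0 : ShiftAlgebra n) = 1 := rfl

lemma shift_add (s t : Fin n → ℝ≥0) : shift (s + t) = shift s * shift t := by
  simp [shift, AddMonoidAlgebra.single_mul_single]

lemma shift_nsmul (m : ℕ) (s : Fin n → ℝ≥0) : shift (m • s) = shift s ^ m := by
  induction m with
  | zero => simp [shift_zero]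
  | succ m ih => rw [succ_nsmul, shift_add, ih, pow_succ]

lemma shift_sum {ι : Type*} (F : Finset ι) (s : ι → Fin n → ℝ≥0) :
    shift (∑ i ∈ F, s i) = ∏ i ∈ F, shift (s i) := by
  classical
  induction F using Finset.induction_on with
  | empty => simp [shift_zero]
  | insert i F hi ih => rw [Finset.sum_insert hi, Finset.prod_insert hi, shift_add, ih]

lemma shift_eq_prod (s : Fin n → ℝ≥0) : shift s = ∏ i, axisShift i (s i) := by
  simp only [axisShift]
  rw [← shift_sum, Finset.univ_sum_single]

lemma axisShift_pow (i : Fin n) (c : ℝ≥0) (m : ℕ) : axisShift i c ^ m = axisShift i (m * c) := by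
  rw [axisShift, ← shift_nsmul, ← Pi.single_smul, nsmul_eq_mul, axisShift]

lemma axisShift_zero (i : Fin n) : axisShift i 0 = 1 := by
  rw [axisShift, Pi.single_zero, shift_zero]

lemma shiftAlgebra_induction {p : ShiftAlgebra n → Prop} (P : ShiftAlgebra n)
    (zero : p 0) (add : ∀ P Q, p P → p Q → p (P + Q)) (smul : ∀ (c : ℝ) s, p (c • shift s)) : p P := by
  induction P using AddMonoidAlgebra.induction_linear with
  | zero => exact zero
  | add P Q hP hQ => exact add P Q hP hQ
  | single s c =>
    have : AddMonoidAlgebra.single s c = c • shift s := by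
      simp [shift, AddMonoidAlgebra.smul_single]
    rw [this]; exact smul c s

/-- The evaluation `∑ c_j [s_j] ↦ ∑ c_j f(s_j)`. -/
def shiftFunctional (f : (Fin n → ℝ≥0) → ℝ) : ShiftAlgebra n →ₗ[ℝ] ℝ :=
  Finsupp.linearCombination ℝ f ∘ₗ (AddMonoidAlgebra.coeffLinearEquiv ℝ).toLinearMap

@[simp] lemma shiftFunctional_shift (f : (Fin n → ℝ≥0) → ℝ) (s : Fin n → ℝ≥0) :
    shiftFunctional f (shift s) = f s := by
  simp [shiftFunctional, shift]

lemma shiftFunctional_mul_shift (f : (Fin n → ℝ≥0) → ℝ) (P : ShiftAlgebra n) (s : Fin n → ℝ≥0) :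
    shiftFunctional f (P * shift s) = shiftFunctional (fun t => f (t + s)) P := by
  induction P using shiftAlgebra_induction with
  | zero => simp
  | add P Q hP hQ => rw [add_mul, map_add, map_add, hP, hQ]
  | smul c t => rw [smul_mul_assoc, ← shift_add, map_smul, map_smul]; simp

lemma shiftFunctional_sub (f g : (Fin n → ℝ≥0) → ℝ) (P : ShiftAlgebra n) :
    shiftFunctional (fun t => f t - g t) P = shiftFunctional f P - shiftFunctional g P := by
  induction P using shiftAlgebra_induction with
  | zero => simp
  | add P Q hP hQ => rw [map_add, map_add, map_add, hP, hQ]; ring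
  | smul c t => simp [mul_sub]

lemma continuous_shiftFunctional_mul_shift {f : (Fin n → ℝ≥0) → ℝ} (hf : Continuous f)
    (P : ShiftAlgebra n) : Continuous fun s => shiftFunctional f (P * shift s) := by
  induction P using shiftAlgebra_induction with
  | zero => simpa using continuous_const
  | add P Q hP hQ => simp only [add_mul, map_add]; exact hP.add hQ
  | smul c t =>
    simp only [smul_mul_assoc, ← shift_add, map_smul, shiftFunctional_shift]
    exact (hf.comp (continuous_const.add continuous_id)).const_smul c

/-! ### Characters of the shift algebra and the Bernstein theorem on the orthant. -/

/-- The character `[t] ↦ exp(-⟨r, t⟩)` of the shift algebra. -/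
def laplaceChar (r : Fin n → ℝ≥0) : ShiftAlgebra n →ₐ[ℝ] ℝ :=
  AddMonoidAlgebra.lift ℝ ℝ (Fin n → ℝ≥0)
    { toFun := fun t => ∏ i, Real.exp (-((r i : ℝ) * (t.toAdd i : ℝ)))
      map_one' := by simp
      map_mul' := fun s t => by
        rw [← Finset.prod_mul_distrib]
        refine Finset.prod_congr rfl fun i _ => ?_
        rw [← Real.exp_add]
        congr 1
        simp only [toAdd_mul, Pi.add_apply, NNReal.coe_add]
        ring }

@[simp] lemma laplaceChar_shift (r t : Fin n → ℝ≥0) :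
    laplaceChar r (shift t) = ∏ i, Real.exp (-((r i : ℝ) * (t i : ℝ))) := by
  simp [laplaceChar, shift]

@[simp] lemma laplaceChar_axisShift (r : Fin n → ℝ≥0) (i : Fin n) (c : ℝ≥0) :
    laplaceChar r (axisShift i c) = Real.exp (-((r i : ℝ) * c)) := by
  rw [axisShift, laplaceChar_shift, Finset.prod_eq_single i]
  · simp
  · intro j _ hj; simp [hj]
  · simp

lemma prod_exp_neg_mem_Icc (r t : Fin n → ℝ≥0) :
    ∏ i, Real.exp (-((r i : ℝ) * (t i : ℝ))) ∈ Set.Icc (0 : ℝ) 1 :=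
  ⟨Finset.prod_nonneg fun _ _ => (Real.exp_pos _).le,
    Finset.prod_le_one (fun _ _ => (Real.exp_pos _).le) fun i _ => by
      rw [Real.exp_le_one_iff]
      have : (0 : ℝ) ≤ r i * t i := by positivity
      linarith⟩

/-- `laplaceChar` as a bounded continuous function of the frequency. -/
lemma exists_boundedContinuous_laplaceChar (P : ShiftAlgebra n) :
    ∃ φ : BoundedContinuousFunction (Fin n → ℝ≥0) ℝ, ∀ r, φ r = laplaceChar r P := by
  induction P using shiftAlgebra_induction with
  | zero => exact ⟨0, by simp⟩
  | add P Q hP hQ =>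
    obtain ⟨φ, hφ⟩ := hP
    obtain ⟨ψ, hψ⟩ := hQ
    exact ⟨φ + ψ, by simp [hφ, hψ]⟩
  | smul c t =>
    refine ⟨c • BoundedContinuousFunction.ofNormedAddCommGroup
      (fun r => ∏ i, Real.exp (-((r i : ℝ) * (t i : ℝ)))) (by fun_prop) 1 fun r => ?_, by simp⟩
    rw [Real.norm_of_nonneg (prod_exp_neg_mem_Icc r t).1]
    exact (prod_exp_neg_mem_Icc r t).2

lemma continuous_laplaceChar (P : ShiftAlgebra n) : Continuous fun r => laplaceChar r P := by
  obtain ⟨φ, hφ⟩ := exists_boundedContinuous_laplaceChar P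
  simpa only [← hφ] using φ.continuous

lemma exists_bound_laplaceChar (P : ShiftAlgebra n) : ∃ C, ∀ r, ‖laplaceChar r P‖ ≤ C := by
  obtain ⟨φ, hφ⟩ := exists_boundedContinuous_laplaceChar P
  exact ⟨‖φ‖, fun r => by rw [← hφ]; exact φ.norm_coe_le_norm r⟩

lemma integrable_laplaceChar (μ : Measure (Fin n → ℝ≥0)) [IsFiniteMeasure μ] (P : ShiftAlgebra n) :
    Integrable (fun r => laplaceChar r P) μ := by
  obtain ⟨φ, hφ⟩ := exists_boundedContinuous_laplaceChar P
  simpa only [← hφ] using φ.integrable μ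

/-- The exponentials are multiplicative in `t`, and those with `t = e_i` already separate
frequencies. -/
theorem measure_ext_of_laplaceChar {μ ν : Measure (Fin n → ℝ≥0)} [IsFiniteMeasure μ]
    [IsFiniteMeasure ν]
    (h : ∀ t, ∫ r, laplaceChar r (shift t) ∂μ = ∫ r, laplaceChar r (shift t) ∂ν) : μ = ν := by
  choose φ hφ using fun t : Fin n → ℝ≥0 => exists_boundedContinuous_laplaceChar (shift t)
  refine measure_ext_of_multiplicative_family (M := Fin n → ℝ≥0)
    { toFun := fun t => φ t.toAdd
      map_one' := by ext r; simp [hφ]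
      map_mul' := fun s t => by ext r; simp only [hφ, toAdd_mul, shift_add, map_mul]; simp [hφ] }
    (fun x y hxy => ?_) fun t => ?_
  · obtain ⟨i, hi⟩ := Function.ne_iff.1 hxy
    refine ⟨Multiplicative.ofAdd (Pi.single i 1), ?_⟩
    have h1 : ∀ r, φ (Pi.single i 1) r = Real.exp (-(r i : ℝ)) := by
      intro r; rw [hφ, ← axisShift, laplaceChar_axisShift]; simp
    simpa [h1] using hi
  · simpa [hφ] using h t.toAdd

theorem measure_ext_of_cubeMonomial {μ ν : Measure (Fin n → unitInterval)} [IsFiniteMeasure μ]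
    [IsFiniteMeasure ν]
    (h : ∀ m : Fin n → ℕ, ∫ x, cubeMonomial m x ∂μ = ∫ x, cubeMonomial m x ∂ν) : μ = ν := by
  refine measure_ext_of_multiplicative_family (M := Fin n → ℕ)
    { toFun := fun m => BoundedContinuousFunction.mkOfCompact (cubeMonomial m.toAdd)
      map_one' := by ext x; simp [cubeMonomial]
      map_mul' := fun a b => by ext x; simp [cubeMonomial, pow_add, Finset.prod_mul_distrib] }
    (fun x y hxy => ?_) fun t => by simpa using h t.toAdd
  obtain ⟨i, hi⟩ := Function.ne_iff.1 hxy
  refine ⟨Multiplicative.ofAdd (Pi.single i 1), ?_⟩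
  have h1 : ∀ x, cubeMonomial (Pi.single i 1) x = (x i : ℝ) := by
    intro x
    simp only [cubeMonomial, ContinuousMap.coe_mk]
    rw [Finset.prod_eq_single i (fun j _ hj => by simp [hj]) (by simp)]
    simp
  simpa [h1] using fun h => hi (Subtype.ext h)

lemma continuous_integral_laplaceChar_shift (μ : Measure (Fin n → ℝ≥0)) [IsFiniteMeasure μ] :
    Continuous fun t => ∫ r, laplaceChar r (shift t) ∂μ := by
  refine continuous_of_dominated (bound := fun _ => 1)
    (fun t => (continuous_laplaceChar _).aestronglyMeasurable)
    (fun t => Eventually.of_forall fun r => ?_) (integrable_const _)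
    (Eventually.of_forall fun r => ?_)
  · rw [laplaceChar_shift, Real.norm_of_nonneg (prod_exp_neg_mem_Icc r t).1]
    exact (prod_exp_neg_mem_Icc r t).2
  · simp only [laplaceChar_shift]; fun_prop

/-- Every point of the closed orthant is a limit of points with coordinates in `p⁻¹ ℕ`. -/
lemma tendsto_floor_mul_div (t : Fin n → ℝ≥0) :
    Tendsto (fun p : ℕ => fun i => (⌊t i * ((p + 1 : ℕ) : ℝ≥0)⌋₊ : ℝ≥0) / ((p + 1 : ℕ) : ℝ≥0)) atTop (𝓝 t) := by
  rw [tendsto_pi_nhds]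
  intro i
  rw [← NNReal.tendsto_coe]
  have h := (tendsto_nat_floor_mul_div_atTop (R := ℝ) (a := t i) (NNReal.coe_nonneg _)).comp
    (tendsto_natCast_atTop_atTop.comp (tendsto_add_atTop_nat 1))
  refine h.congr fun p => ?_
  simp only [Function.comp_apply, NNReal.coe_div, NNReal.coe_natCast]
  congr 2

/-- A multivariate **Bernstein theorem**: a continuous function on the closed orthant with
alternating iterated differences is the Laplace transform of a finite measure. -/
theorem exists_measure_laplaceChar (L : ShiftAlgebra n →ₗ[ℝ] ℝ)
    (hpos : ∀ (c : ℝ≥0) (a b : Fin n → ℕ),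
      0 ≤ L (∏ i, axisShift i c ^ a i * (1 - axisShift i c) ^ b i))
    (hcont : Continuous fun t => L (shift t)) :
    ∃ μ : Measure (Fin n → ℝ≥0), IsFiniteMeasure μ ∧ ∀ P, L P = ∫ r, laplaceChar r P ∂μ := by
  -- For each mesh `1/(p+1)` the moment problem is solved with the variables `X_i` equal to the
  -- translations by that mesh.
  choose μ hμ hmom using fun p : ℕ => exists_measure_hausdorff
    (fun i : Fin n => axisShift i ((p + 1 : ℕ) : ℝ≥0)⁻¹) L (hpos _)
  have hprod : ∀ (p : ℕ) (m : Fin n → ℕ),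
      ∏ i, axisShift i ((p + 1 : ℕ) : ℝ≥0)⁻¹ ^ m i =
        shift (fun i => (m i : ℝ≥0) / ((p + 1 : ℕ) : ℝ≥0)) := by
    intro p m
    rw [shift_eq_prod]
    simp only [axisShift_pow, div_eq_mul_inv]
  let π : ℕ → (Fin n → unitInterval) → (Fin n → unitInterval) := fun p x i => x i ^ (p + 1)
  have hπ : ∀ p, Measurable (π p) := fun p => by
    have : Continuous (π p) := by fun_prop
    exact this.measurable
  -- The power `p + 1` of the small translation is the unit translation, so the two measures have
  -- the same moments. Hence `μ 0` alone encodes `L` at all points with rational coordinates,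
  -- through fractional powers.
  have hmap : ∀ p, (μ p).map (π p) = μ 0 := by
    intro p
    have := hμ p
    have := hμ 0
    have : IsFiniteMeasure ((μ p).map (π p)) := by infer_instance
    refine measure_ext_of_cubeMonomial fun m => ?_
    rw [integral_map (hπ p).aemeasurable (cubeMonomial m).continuous.aestronglyMeasurable]
    have h1 : ∀ x, cubeMonomial m (π p x) = cubeMonomial (fun i => (p + 1) * m i) x := by
      intro x; simp [cubeMonomial, π, pow_mul]
    simp only [h1]
    rw [hmom, hmom, hprod, hprod]
    congr 2
    funext i
    push_cast
    field_simp
  have hrat : ∀ (p : ℕ) (m : Fin n → ℕ),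
      ∫ y, ∏ i, (y i : ℝ) ^ ((m i : ℝ) / ((p + 1 : ℕ) : ℝ)) ∂(μ 0) =
        L (shift (fun i => (m i : ℝ≥0) / ((p + 1 : ℕ) : ℝ≥0))) := by
    intro p m
    have hc : Continuous fun y : Fin n → unitInterval =>
        ∏ i, (y i : ℝ) ^ ((m i : ℝ) / ((p + 1 : ℕ) : ℝ)) :=
      continuous_finsetProd _ fun i _ =>
        (Real.continuous_rpow_const (by positivity)).comp (by fun_prop)
    rw [← hmap p, integral_map (hπ p).aemeasurable hc.aestronglyMeasurable, ← hprod, ← hmom p]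
    refine integral_congr_ae (Eventually.of_forall fun x => ?_)
    refine Finset.prod_congr rfl fun i _ => ?_
    have hx : (0 : ℝ) ≤ x i := (x i).2.1
    change ((x i ^ (p + 1) : unitInterval) : ℝ) ^ _ = _
    rw [show ((x i ^ (p + 1) : unitInterval) : ℝ) = (x i : ℝ) ^ (p + 1) from rfl]
    rw [← Real.rpow_natCast (x i : ℝ) (p + 1), ← Real.rpow_mul hx, mul_div_cancel₀,
      Real.rpow_natCast]
    positivity
  have h0 := hμ 0
  have hle : ∀ (s : Fin n → ℝ) (_ : ∀ i, 0 ≤ s i) (y : Fin n → unitInterval),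
      ∏ i, (y i : ℝ) ^ s i ∈ Set.Icc (0 : ℝ) 1 := fun s hs y =>
    ⟨Finset.prod_nonneg fun i _ => Real.rpow_nonneg (y i).2.1 _,
      Finset.prod_le_one (fun i _ => Real.rpow_nonneg (y i).2.1 _) fun i _ =>
        Real.rpow_le_one (y i).2.1 (y i).2.2 (hs i)⟩
  -- no mass on the faces `y i = 0`
  have hae : ∀ᵐ y ∂(μ 0), ∀ i, 0 < (y i : ℝ) := by
    let ind : (Fin n → unitInterval) → ℝ := fun y => ∏ i, if 0 < (y i : ℝ) then 1 else 0
    -- The powers `y^{1/(p+1)}` tend to the indicator of `y > 0`, while continuity of `L` at the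
    -- origin makes their integrals tend to the total mass. The set where some coordinate vanishes
    -- is therefore null.
    have hlim1 : Tendsto (fun p : ℕ => ∫ y, ∏ i, (y i : ℝ) ^ ((1 : ℝ) / ((p + 1 : ℕ) : ℝ)) ∂(μ 0))
        atTop (𝓝 (∫ y, ind y ∂(μ 0))) := by
      refine tendsto_integral_of_dominated_convergence (fun _ => 1) (fun p => ?_)
        (integrable_const _) (fun p => Eventually.of_forall fun y => ?_)
        (Eventually.of_forall fun y => ?_)
      · refine Continuous.aestronglyMeasurable (continuous_finsetProd _ fun i _ =>
          (Real.continuous_rpow_const (by positivity)).comp (by fun_prop))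
      · have := hle (fun _ => 1 / ((p + 1 : ℕ) : ℝ)) (fun _ => by positivity) y
        rw [Real.norm_of_nonneg this.1]; exact this.2
      · refine tendsto_finsetProd _ fun i _ => ?_
        have hlim : Tendsto (fun p : ℕ => (1 : ℝ) / ((p + 1 : ℕ) : ℝ)) atTop (𝓝 0) := by
          simpa using tendsto_one_div_add_atTop_nhds_zero_nat (𝕜 := ℝ)
        split_ifs with h
        · have := (Real.continuousAt_const_rpow h.ne' (b := 0)).tendsto.comp hlim
          simpa [Function.comp_def] using this
        · have hy : (y i : ℝ) = 0 := le_antisymm (not_lt.1 h) (y i).2.1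
          rw [hy]
          refine tendsto_const_nhds.congr fun p => ?_
          rw [Real.zero_rpow (by positivity)]
    have hlim2 : Tendsto (fun p : ℕ => ∫ y, ∏ i, (y i : ℝ) ^ ((1 : ℝ) / ((p + 1 : ℕ) : ℝ)) ∂(μ 0))
        atTop (𝓝 (∫ _, 1 ∂(μ 0))) := by
      have h1 : ∫ _, (1 : ℝ) ∂(μ 0) = L (shift 0) := by
        have := hrat 0 0
        simpa [Pi.zero_def] using this
      have h2 : ∀ p : ℕ, ∫ y, ∏ i, (y i : ℝ) ^ ((1 : ℝ) / ((p + 1 : ℕ) : ℝ)) ∂(μ 0) =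
          L (shift (fun i => (1 : ℝ≥0) / ((p + 1 : ℕ) : ℝ≥0))) := by
        intro p; simpa using hrat p (fun _ => 1)
      simp only [h1, h2]
      refine (hcont.tendsto 0).comp (tendsto_pi_nhds.2 fun i => ?_)
      rw [← NNReal.tendsto_coe]
      simpa using tendsto_one_div_add_atTop_nhds_zero_nat (𝕜 := ℝ)
    have heq := tendsto_nhds_unique hlim1 hlim2
    have hind : ∀ y, ind y = if ∀ i, 0 < (y i : ℝ) then 1 else 0 := by
      intro y
      split_ifs with h
      · exact Finset.prod_eq_one fun i _ => if_pos (h i)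
      · obtain ⟨i, hi⟩ := not_forall.1 h
        exact Finset.prod_eq_zero (Finset.mem_univ i) (if_neg hi)
    have hmeas : Measurable ind := by
      refine Finset.measurable_prod _ fun i _ => ?_
      exact Measurable.ite (measurableSet_lt measurable_const
        ((measurable_subtype_coe).comp (measurable_pi_apply i))) measurable_const measurable_const
    have hint : Integrable ind (μ 0) := by
      refine Integrable.of_bound hmeas.aestronglyMeasurable 1 (Eventually.of_forall fun y => ?_)
      rw [hind]; split_ifs <;> simp
    have h3 : ∫ y, (1 - ind y) ∂(μ 0) = 0 := by
      rw [integral_sub (integrable_const _) hint, heq, sub_self]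
    have h4 := (integral_eq_zero_iff_of_nonneg (fun y => by
      show 0 ≤ 1 - ind y
      rw [hind]; split_ifs <;> simp) ((integrable_const _).sub hint)).1 h3
    filter_upwards [h4] with y hy
    by_contra hcon
    have : (1 : ℝ) - ind y = 0 := hy
    rw [hind, if_neg hcon] at this
    norm_num at this
  -- With `y_i = e^{-r_i}` the fractional moments become Laplace transforms.
  let lg : (Fin n → unitInterval) → (Fin n → ℝ≥0) := fun y i => (-Real.log (y i)).toNNReal
  have hlg : Measurable lg := measurable_pi_lambda _ fun i =>
    (Real.measurable_log.comp (measurable_subtype_coe.comp (measurable_pi_apply i))).neg.real_toNNReal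
  have hfin : IsFiniteMeasure ((μ 0).map lg) := by infer_instance
  refine ⟨(μ 0).map lg, hfin, fun P => ?_⟩
  have hshift : ∀ t, L (shift t) = ∫ r, laplaceChar r (shift t) ∂((μ 0).map lg) := by
    intro t
    have h1 := (hcont.tendsto t).comp (tendsto_floor_mul_div t)
    have h2 := ((continuous_integral_laplaceChar_shift ((μ 0).map lg)).tendsto t).comp
      (tendsto_floor_mul_div t)
    refine tendsto_nhds_unique h1 (h2.congr fun p => ?_)
    simp only [Function.comp_apply]
    rw [← hrat, integral_map hlg.aemeasurable (continuous_laplaceChar _).aestronglyMeasurable]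
    refine integral_congr_ae ?_
    filter_upwards [hae] with y hy
    rw [laplaceChar_shift]
    refine Finset.prod_congr rfl fun i _ => ?_
    have hlog : Real.log (y i) ≤ 0 := Real.log_nonpos (y i).2.1 (y i).2.2
    rw [Real.rpow_def_of_pos (hy i)]
    simp only [lg, Real.coe_toNNReal _ (neg_nonneg.2 hlog), NNReal.coe_div, NNReal.coe_natCast]
    ring_nf
  induction P using shiftAlgebra_induction with
  | zero => simp
  | add P Q hP hQ =>
    simp only [map_add]
    rw [integral_add (integrable_laplaceChar _ _) (integrable_laplaceChar _ _), hP, hQ]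
  | smul c s =>
    simp only [map_smul, smul_eq_mul]
    rw [integral_const_mul, hshift]

/-! ### Positivity of differences -/

/-- The restriction of a function on `ℝ^n` to the closed orthant. -/
def restrictOrthant (f : (Fin n → ℝ) → ℝ) (s : Fin n → ℝ≥0) : ℝ := f fun i => s i

lemma continuous_restrictOrthant {f : (Fin n → ℝ) → ℝ} (hf : ContinuousOn f (closedOrthant n)) :
    Continuous (restrictOrthant f) :=
  hf.comp_continuous (f := fun s : Fin n → ℝ≥0 => fun i => (s i : ℝ)) (by fun_prop)
    fun s i => (s i).2

lemma restrictOrthant_add_single (f : (Fin n → ℝ) → ℝ) (i : Fin n) (c : ℝ≥0) (s : Fin n → ℝ≥0) :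
    restrictOrthant f (s + Pi.single i c) = restrictOrthant (fun t => f (t + Pi.single i (c : ℝ))) s := by
  unfold restrictOrthant
  congr 1
  funext j
  by_cases h : j = i
  · subst h; simp
  · simp [h]

lemma shiftFunctional_mul_axisShift_sub_one (f : (Fin n → ℝ) → ℝ) (i : Fin n) (c : ℝ≥0)
    (P : ShiftAlgebra n) :
    shiftFunctional (restrictOrthant f) (P * (axisShift i c - 1)) =
      shiftFunctional (restrictOrthant fun t => f (t + Pi.single i (c : ℝ)) - f t) P := by
  rw [mul_sub, mul_one, map_sub, axisShift, shiftFunctional_mul_shift, ← shiftFunctional_sub]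
  simp only [restrictOrthant_add_single]
  rfl

lemma shiftFunctional_mul_one_sub_axisShift (f : (Fin n → ℝ) → ℝ) (i : Fin n) (c : ℝ≥0)
    (P : ShiftAlgebra n) :
    shiftFunctional (restrictOrthant f) (P * (1 - axisShift i c)) =
      shiftFunctional (restrictOrthant fun t => f t - f (t + Pi.single i (c : ℝ))) P := by
  rw [mul_sub, mul_one, map_sub, axisShift, shiftFunctional_mul_shift, ← shiftFunctional_sub]
  simp only [restrictOrthant_add_single]
  rfl

/-- The product of the difference operators with steps `c i`, `i ∈ F`. -/
def diffOp (F : Finset (Fin n)) (c : Fin n → ℝ≥0) : ShiftAlgebra n := ∏ i ∈ F, (axisShift i (c i) - 1)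

/-- Each difference factor consumes one index of `G`; once `G` is empty, the condition at order zero
is nonnegativity of the function. -/
lemma HasAlternatingDerivs.shiftFunctional_diffOp_nonneg {G : Finset (Fin n)}
    {f : (Fin n → ℝ) → ℝ} (hf : HasAlternatingDerivs G f) (c : Fin n → ℝ≥0) {s : Fin n → ℝ≥0}
    (hs : ∀ i, 0 < s i) :
    0 ≤ shiftFunctional (restrictOrthant f) (shift s * diffOp G c) := by
  induction G using Finset.induction_on generalizing f with
  | empty =>
    have := hf.2 0 (by simp) (fun i => (s i : ℝ)) fun i => hs i
    simpa [diffOp, multiDeriv_zero, restrictOrthant] using this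
  | insert i G hi ih =>
    rw [diffOp, Finset.prod_insert hi, mul_comm (axisShift i (c i) - 1), ← mul_assoc,
      shiftFunctional_mul_axisShift_sub_one]
    have := hf.sub_mem (Finset.mem_insert_self i G) (c i).2
    rw [Finset.erase_insert hi] at this
    exact ih this

/-- This is the positivity demanded by the Bernstein theorem for the function `Δ^G g`. It is first
obtained at base points in the open orthant, where derivatives are available, and reaches boundary
base points by continuity. -/
lemma HasAlternatingDerivs.shiftFunctional_nonneg {G : Finset (Fin n)} {f : (Fin n → ℝ) → ℝ}
    (hf : HasAlternatingDerivs G f) (hc : ContinuousOn f (closedOrthant n)) (c : Fin n → ℝ≥0)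
    (d : ℝ≥0) (a b : Fin n → ℕ) :
    0 ≤ shiftFunctional (restrictOrthant f)
      (diffOp G c * ∏ i, axisShift i d ^ a i * (1 - axisShift i d) ^ b i) := by
  have hopen : ∀ (T : Finset (Fin n)) (f : (Fin n → ℝ) → ℝ), HasAlternatingDerivs G f →
      ∀ s : Fin n → ℝ≥0, (∀ i, 0 < s i) → 0 ≤ shiftFunctional (restrictOrthant f)
        (shift s * diffOp G c * ∏ i ∈ T, (1 - axisShift i d) ^ b i) := by
    intro T
    induction T using Finset.induction_on with
    | empty => intro f hf s hs; simpa using hf.shiftFunctional_diffOp_nonneg c hs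
    | insert i T hi ih =>
      intro f hf s hs
      rw [Finset.prod_insert hi]
      generalize b i = m
      induction m generalizing f with
      | zero => simpa using ih f hf s hs
      | succ m ihm =>
        have h1 : shift s * diffOp G c * ((1 - axisShift i d) ^ (m + 1) *
            ∏ i ∈ T, (1 - axisShift i d) ^ b i) =
            shift s * diffOp G c * ((1 - axisShift i d) ^ m *
              ∏ i ∈ T, (1 - axisShift i d) ^ b i) * (1 - axisShift i d) := by
          generalize shift s * diffOp G c = A
          generalize ∏ i ∈ T, (1 - axisShift i d) ^ b i = B
          ring
        rw [h1, shiftFunctional_mul_one_sub_axisShift]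
        exact ihm _ (hf.sub_translate i d.2)
  -- The base point `a_i d` may lie on the boundary; adding `1/(p+1)` in every coordinate moves it
  -- inside.
  have hlim : Tendsto (fun p : ℕ => fun _ : Fin n => (1 : ℝ≥0) / ((p + 1 : ℕ) : ℝ≥0)) atTop (𝓝 0) := by
    refine tendsto_pi_nhds.2 fun i => ?_
    rw [← NNReal.tendsto_coe]
    simpa using tendsto_one_div_add_atTop_nhds_zero_nat (𝕜 := ℝ)
  have hcont := continuous_shiftFunctional_mul_shift (continuous_restrictOrthant hc)
    (diffOp G c * ∏ i, axisShift i d ^ a i * (1 - axisShift i d) ^ b i)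
  have := (hcont.tendsto 0).comp hlim
  rw [shift_zero, mul_one] at this
  refine ge_of_tendsto this (Eventually.of_forall fun p => ?_)
  have h1 : (∏ i, axisShift i d ^ a i : ShiftAlgebra n) = shift fun i => a i * d := by
    rw [shift_eq_prod]; simp only [axisShift_pow]
  have h2 := hopen Finset.univ f hf ((fun i => a i * d) + fun _ => 1 / ((p + 1 : ℕ) : ℝ≥0))
    (fun i => add_pos_of_nonneg_of_pos zero_le (by positivity))
  rw [shift_add, ← h1] at h2
  simp only [Function.comp_apply]
  have h3 : ∀ A B C D : ShiftAlgebra n, B * D * A * C = A * (B * C) * D := by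
    intros; ring
  rwa [h3, ← Finset.prod_mul_distrib] at h2

end

noncomputable section

open MeasureTheory Filter Topology NNReal

/-! ### The kernel `(1 - e^{-rs}) / (1 - e^{-r})` -/

/-- The function `1 - e^{-r}`. -/
def decay (r : ℝ≥0) : ℝ := 1 - Real.exp (-(r : ℝ))

/-- The derivatives in `s` of the kernel `(1 - e^{-rs}) / (1 - e^{-r})`, extended to `r = 0`. -/
def bernKernel : ℕ → ℝ≥0 → ℝ → ℝ
  | 0, r, s => if r = 0 then s else (1 - Real.exp (-((r : ℝ) * s))) / decay r
  | a + 1, r, s => (if r = 0 then 1 else (r : ℝ) / decay r) * (-(r : ℝ)) ^ a *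
      Real.exp (-((r : ℝ) * s))

lemma decay_nonneg (r : ℝ≥0) : 0 ≤ decay r := by
  simp [decay]

lemma decay_le_one (r : ℝ≥0) : decay r ≤ 1 := by
  simp [decay, (Real.exp_pos _).le]

lemma decay_pos {r : ℝ≥0} : 0 < decay r ↔ 0 < r := by
  simp [decay]

lemma decay_zero : decay 0 = 0 := by simp [decay]

lemma continuous_decay : Continuous decay := by unfold decay; fun_prop

lemma div_one_add_le_decay (r : ℝ≥0) : (r : ℝ) / (1 + r) ≤ decay r := by
  have h : (0 : ℝ) < 1 + r := by positivity
  have h1 : (1 : ℝ) + r ≤ Real.exp r := by rw [add_comm]; exact Real.add_one_le_exp _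
  have h2 : Real.exp (-(r : ℝ)) ≤ 1 / (1 + r) := by
    rw [Real.exp_neg, inv_eq_one_div]; gcongr
  have h3 : (r : ℝ) / (1 + r) = 1 - 1 / (1 + r) := by field_simp; ring
  rw [h3, decay]; linarith

lemma hasDerivAt_bernKernel (a : ℕ) (r : ℝ≥0) (s : ℝ) :
    HasDerivAt (bernKernel a r) (bernKernel (a + 1) r s) s := by
  have hexp : HasDerivAt (fun s : ℝ => Real.exp (-((r : ℝ) * s)))
      (Real.exp (-((r : ℝ) * s)) * (-(r : ℝ))) s := by
    have := ((hasDerivAt_id s).const_mul (r : ℝ)).neg.exp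
    simpa using this
  cases a with
  | zero =>
    by_cases hr : r = 0
    · have h1 : bernKernel 0 r = fun s => s := by funext s; simp [bernKernel, hr]
      have h2 : bernKernel (0 + 1) r s = 1 := by simp [bernKernel, hr]
      rw [h1, h2]; exact hasDerivAt_id s
    · have h1 : bernKernel 0 r = fun s => (1 - Real.exp (-((r : ℝ) * s))) / decay r := by
        funext s; simp [bernKernel, hr]
      have h2 : bernKernel (0 + 1) r s = (0 - Real.exp (-((r : ℝ) * s)) * (-(r : ℝ))) / decay r := by
        simp only [bernKernel, hr, if_false]; ring
      rw [h1, h2]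
      exact ((hasDerivAt_const s 1).sub hexp).div_const _
  | succ a =>
    have h1 : bernKernel (a + 1) r = fun s => ((if r = 0 then 1 else (r : ℝ) / decay r) *
      (-(r : ℝ)) ^ a) * Real.exp (-((r : ℝ) * s)) := by funext s; simp [bernKernel]
    have h2 : bernKernel (a + 1 + 1) r s = ((if r = 0 then 1 else (r : ℝ) / decay r) *
      (-(r : ℝ)) ^ a) * (Real.exp (-((r : ℝ) * s)) * (-(r : ℝ))) := by
      simp only [bernKernel]; ring
    rw [h1, h2]
    exact hexp.const_mul _

lemma measurable_bernKernel (a : ℕ) (s : ℝ) : Measurable fun r => bernKernel a r s := by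
  have hd : Measurable decay := continuous_decay.measurable
  have h0 : MeasurableSet {r : ℝ≥0 | r = 0} := measurableSet_eq
  have he : Measurable fun r : ℝ≥0 => Real.exp (-((r : ℝ) * s)) := by fun_prop
  cases a with
  | zero => exact Measurable.ite h0 measurable_const ((measurable_const.sub he).div hd)
  | succ a =>
    refine Measurable.mul (Measurable.mul (Measurable.ite h0 measurable_const ?_) ?_) he
    · exact Measurable.div (by fun_prop) hd
    · fun_prop

lemma decay_mul_bernKernel (r : ℝ≥0) (s : ℝ) :
    decay r * bernKernel 0 r s = 1 - Real.exp (-((r : ℝ) * s)) := by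
  by_cases hr : r = 0
  · simp [bernKernel, hr, decay_zero]
  · have : decay r ≠ 0 := (decay_pos.2 (pos_iff_ne_zero.2 hr)).ne'
    simp only [bernKernel, hr, if_false]
    field_simp

lemma decay_mul_bernKernel_succ (r : ℝ≥0) (a : ℕ) (s : ℝ) :
    decay r * bernKernel (a + 1) r s = -((-(r : ℝ)) ^ (a + 1) * Real.exp (-((r : ℝ) * s))) := by
  by_cases hr : r = 0
  · simp [bernKernel, hr, decay_zero]
  · have : decay r ≠ 0 := (decay_pos.2 (pos_iff_ne_zero.2 hr)).ne'
    simp only [bernKernel, hr, if_false]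
    field_simp
    ring

lemma bernKernel_zero_right (r : ℝ≥0) : bernKernel 0 r 0 = 0 := by
  simp [bernKernel]

lemma bernKernel_nonneg (r : ℝ≥0) {s : ℝ} (hs : 0 ≤ s) : 0 ≤ bernKernel 0 r s := by
  simp only [bernKernel]
  split_ifs
  · exact hs
  · refine div_nonneg ?_ (decay_nonneg r)
    have : 0 ≤ (r : ℝ) * s := by positivity
    simpa using this

/-- For `s ≤ 1` the numerator is at most the denominator. For `s ≥ 1` Bernoulli's inequality with `1
- e^{-r}` as small quantity bounds the quotient by `s`. The bound is uniform in `r` and remains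
valid at `s = 0`. -/
lemma bernKernel_le (r : ℝ≥0) {s : ℝ} (hs : 0 ≤ s) : bernKernel 0 r s ≤ 1 + s := by
  by_cases hr : r = 0
  · simp [bernKernel, hr]
  have hd : 0 < decay r := decay_pos.2 (pos_iff_ne_zero.2 hr)
  simp only [bernKernel, hr, if_false]
  rw [div_le_iff₀ hd]
  rcases le_total s 1 with h | h
  · have h1 : Real.exp (-(r : ℝ)) ≤ Real.exp (-((r : ℝ) * s)) := by
      apply Real.exp_le_exp.2
      have : (r : ℝ) * s ≤ r := mul_le_of_le_one_right r.2 h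
      linarith
    have h2 : decay r ≤ (1 + s) * decay r := le_mul_of_one_le_left hd.le (by linarith)
    have h3 : decay r = 1 - Real.exp (-(r : ℝ)) := rfl
    linarith
  · have h1 : -1 ≤ -decay r := neg_le_neg (decay_le_one r)
    have h2 := one_add_mul_self_le_rpow_one_add h1 h
    have h3 : (1 + -decay r) ^ s = Real.exp (-((r : ℝ) * s)) := by
      rw [show 1 + -decay r = Real.exp (-(r : ℝ)) by rw [decay]; ring, ← Real.exp_mul]
      ring_nf
    rw [h3] at h2
    nlinarith

/-- The prefactor is at most `1 + r`, and one term of the exponential series gives `r^m e^{-rs} ≤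
m!/ε^m` for `s ≥ ε`; the constant adds the cases `m = a` and `m = a + 1`. The distance from `s = 0`
is essential here. -/
lemma abs_bernKernel_succ_le (a : ℕ) {ε : ℝ} (hε : 0 < ε) :
    ∃ C, ∀ (r : ℝ≥0) (s : ℝ), ε ≤ s → |bernKernel (a + 1) r s| ≤ C := by
  refine ⟨a.factorial / ε ^ a + (a + 1).factorial / ε ^ (a + 1), fun r s hs => ?_⟩
  have hw0 : 0 ≤ (if r = 0 then (1 : ℝ) else (r : ℝ) / decay r) := by
    split_ifs
    · exact zero_le_one
    · exact div_nonneg r.2 (decay_nonneg r)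
  have hw : (if r = 0 then (1 : ℝ) else (r : ℝ) / decay r) ≤ 1 + r := by
    split_ifs with h
    · simp [h]
    · have h1 := div_one_add_le_decay r
      have h2 : 0 < decay r := decay_pos.2 (pos_iff_ne_zero.2 h)
      rw [div_le_iff₀ h2]
      rwa [div_le_iff₀' (by positivity)] at h1
  have hm : ∀ m : ℕ, (r : ℝ) ^ m * Real.exp (-((r : ℝ) * s)) ≤ m.factorial / ε ^ m := by
    intro m
    have h1 := Real.pow_div_factorial_le_exp (ε * r) (by positivity) m
    have h2 : Real.exp (ε * r) ≤ Real.exp (r * s) := by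
      apply Real.exp_le_exp.2
      rw [mul_comm]; gcongr
    have h3 := h1.trans h2
    have hf : (0 : ℝ) < m.factorial := by positivity
    rw [le_div_iff₀ (by positivity), Real.exp_neg]
    rw [div_le_iff₀ hf] at h3
    have he := Real.exp_pos ((r : ℝ) * s)
    calc (r : ℝ) ^ m * (Real.exp (r * s))⁻¹ * ε ^ m = (ε * r) ^ m / Real.exp (r * s) := by
          rw [mul_pow]; ring
      _ ≤ _ := by rw [div_le_iff₀ he, mul_comm (m.factorial : ℝ)]; exact h3
  have h1 := hm a
  have h2 := hm (a + 1)
  simp only [bernKernel]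
  rw [abs_mul, abs_mul, abs_of_nonneg hw0, abs_pow, abs_neg, abs_of_nonneg (NNReal.coe_nonneg r),
    abs_of_nonneg (Real.exp_pos _).le]
  calc _ ≤ (1 + (r : ℝ)) * (r : ℝ) ^ a * Real.exp (-((r : ℝ) * s)) := by gcongr
    _ = (r : ℝ) ^ a * Real.exp (-((r : ℝ) * s)) + (r : ℝ) ^ (a + 1) * Real.exp (-((r : ℝ) * s)) := by
        ring
    _ ≤ _ := add_le_add h1 h2

/-! ### Products of kernels and their integrals against finite measures. -/

variable {n : ℕ}

/-- The derivative `∂^α` in `t` of `∏_{i ∈ B} (1 - e^{-r_i t_i}) / (1 - e^{-r_i})`. -/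
def kernelProd (B : Finset (Fin n)) (α : Fin n → ℕ) (r : Fin n → ℝ≥0) (t : Fin n → ℝ) : ℝ :=
  ∏ i, if i ∈ B then bernKernel (α i) (r i) (t i) else if α i = 0 then 1 else 0

lemma kernelProd_zero (B : Finset (Fin n)) (r : Fin n → ℝ≥0) (t : Fin n → ℝ) :
    kernelProd B 0 r t = ∏ i ∈ B, bernKernel 0 (r i) (t i) := by
  simp [kernelProd, Finset.prod_ite_mem]

lemma measurable_kernelProd (B : Finset (Fin n)) (α : Fin n → ℕ) (t : Fin n → ℝ) :
    Measurable fun r => kernelProd B α r t := by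
  refine Finset.measurable_prod _ fun i _ => ?_
  split_ifs
  · exact (measurable_bernKernel _ _).comp (measurable_pi_apply i)
  · exact measurable_const
  · exact measurable_const

lemma hasFDerivAt_kernelProd (B : Finset (Fin n)) (α : Fin n → ℕ) (r : Fin n → ℝ≥0)
    (t : Fin n → ℝ) : HasFDerivAt (kernelProd B α r)
      (∑ i, kernelProd B (α + Pi.single i 1) r t •
        ContinuousLinearMap.proj (R := ℝ) (φ := fun _ => ℝ) i) t := by
  have h1 : ∀ i : Fin n, HasFDerivAt
      (fun t : Fin n → ℝ => if i ∈ B then bernKernel (α i) (r i) (t i) else if α i = 0 then 1 else 0)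
      ((if i ∈ B then bernKernel (α i + 1) (r i) (t i) else 0) •
        ContinuousLinearMap.proj (R := ℝ) (φ := fun _ => ℝ) i) t := by
    intro i
    by_cases hi : i ∈ B
    · simp only [hi, if_true]
      exact HasDerivAt.comp_hasFDerivAt (h₂ := bernKernel (α i) (r i)) t
        (hasDerivAt_bernKernel (α i) (r i) (t i)) (hasFDerivAt_apply (𝕜 := ℝ) i t)
    · simp only [hi, if_false, zero_smul]
      exact hasFDerivAt_const _ _
  have h2 := HasFDerivAt.finsetProd (u := Finset.univ) fun i _ => h1 i
  refine h2.congr_fderiv (Finset.sum_congr rfl fun i _ => ?_)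
  rw [smul_smul]
  congr 1
  rw [kernelProd, ← Finset.mul_prod_erase _ _ (Finset.mem_univ i), mul_comm]
  congr 1
  · simp
  · refine Finset.prod_congr rfl fun j hj => ?_
    have : (Pi.single i 1 : Fin n → ℕ) j = 0 := by simp [(Finset.mem_erase.1 hj).1]
    simp only [Pi.add_apply, this, add_zero]

lemma exists_bound_kernelProd (B : Finset (Fin n)) (α : Fin n → ℕ) {ε M : ℝ} (hε : 0 < ε) :
    ∃ C, ∀ (r : Fin n → ℝ≥0) (t : Fin n → ℝ), (∀ i, t i ∈ Set.Icc ε M) → |kernelProd B α r t| ≤ C := by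
  have h1 : ∀ i : Fin n, ∃ C, ∀ (r : ℝ≥0) (s : ℝ), s ∈ Set.Icc ε M →
      |if i ∈ B then bernKernel (α i) r s else if α i = 0 then 1 else 0| ≤ C := by
    intro i
    by_cases hi : i ∈ B
    · simp only [hi, if_true]
      rcases h : α i with _ | a
      · refine ⟨1 + M, fun r s hs => ?_⟩
        have h0 : 0 ≤ s := hε.le.trans hs.1
        rw [abs_of_nonneg (bernKernel_nonneg r h0)]
        linarith [bernKernel_le r h0, hs.2]
      · obtain ⟨C, hC⟩ := abs_bernKernel_succ_le a hε
        exact ⟨C, fun r s hs => hC r s hs.1⟩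
    · simp only [hi, if_false]
      exact ⟨1, fun r s _ => by split_ifs <;> simp⟩
  choose C hC using h1
  refine ⟨∏ i, C i, fun r t ht => ?_⟩
  rw [kernelProd, Finset.abs_prod]
  exact Finset.prod_le_prod (fun i _ => abs_nonneg _) fun i _ => hC i _ _ (ht i)

/-- The derivative `∂^α` of `t ↦ ∫ ∏_{i ∈ B} (1 - e^{-r_i t_i}) / (1 - e^{-r_i}) dκ(r)`. -/
def kernelIntegral (B : Finset (Fin n)) (κ : Measure (Fin n → ℝ≥0)) (α : Fin n → ℕ)
    (t : Fin n → ℝ) : ℝ := ∫ r, kernelProd B α r t ∂κ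

/-- A ball with radius at most half the least coordinate stays away from the boundary, which is what
uniform domination of the differentiated kernels needs. -/
lemma exists_box {t : Fin n → ℝ} (ht : t ∈ openOrthant n) :
    ∃ ε > 0, ∃ M, ∀ x ∈ Metric.ball t ε, ∀ i, x i ∈ Set.Icc ε M := by
  have h1 : ∃ ε > 0, ∀ i, 2 * ε ≤ t i := by
    rcases isEmpty_or_nonempty (Fin n) with h | h
    · exact ⟨1, one_pos, fun i => isEmptyElim i⟩
    · obtain ⟨i, -, hi⟩ := Finset.exists_min_image Finset.univ t Finset.univ_nonempty
      exact ⟨t i / 2, half_pos (ht i), fun j => by linarith [hi j (Finset.mem_univ j)]⟩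
  obtain ⟨ε, hε, h⟩ := h1
  refine ⟨ε, hε, ∑ i, t i + ε, fun x hx i => ?_⟩
  have h2 : |x i - t i| < ε := by
    have := (dist_le_pi_dist x t i).trans_lt (Metric.mem_ball.1 hx)
    rwa [Real.dist_eq] at this
  have h3 := abs_lt.1 h2
  have h4 : t i ≤ ∑ i, t i := Finset.single_le_sum (fun j _ => (ht j).le) (Finset.mem_univ i)
  exact ⟨by linarith [h i], by linarith⟩

lemma integrable_kernelProd (B : Finset (Fin n)) (κ : Measure (Fin n → ℝ≥0)) [IsFiniteMeasure κ]
    (α : Fin n → ℕ) {t : Fin n → ℝ} (ht : t ∈ openOrthant n) :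
    Integrable (fun r => kernelProd B α r t) κ := by
  obtain ⟨ε, hε, M, hM⟩ := exists_box ht
  obtain ⟨C, hC⟩ := exists_bound_kernelProd B α (M := M) hε
  exact Integrable.of_bound (measurable_kernelProd B α t).aestronglyMeasurable C
    (Eventually.of_forall fun r => hC r t (hM t (Metric.mem_ball_self hε)))

/-- The derivative of `kernelProd` in the variable `t`. -/
def kernelProdFDeriv (B : Finset (Fin n)) (α : Fin n → ℕ) (t : Fin n → ℝ) (r : Fin n → ℝ≥0) :
    (Fin n → ℝ) →L[ℝ] ℝ :=
  ∑ i, kernelProd B (α + Pi.single i 1) r t •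
    ContinuousLinearMap.proj (R := ℝ) (φ := fun _ => ℝ) i

lemma aestronglyMeasurable_kernelProdFDeriv (B : Finset (Fin n)) (α : Fin n → ℕ) (t : Fin n → ℝ)
    (κ : Measure (Fin n → ℝ≥0)) : AEStronglyMeasurable (kernelProdFDeriv B α t) κ := by
  unfold kernelProdFDeriv
  exact Finset.aestronglyMeasurable_fun_sum _ fun i _ =>
    (measurable_kernelProd B _ t).aestronglyMeasurable.smul_const _

lemma integral_kernelProdFDeriv (B : Finset (Fin n)) (κ : Measure (Fin n → ℝ≥0))
    [IsFiniteMeasure κ] (α : Fin n → ℕ) {t : Fin n → ℝ} (ht : t ∈ openOrthant n) :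
    ∫ r, kernelProdFDeriv B α t r ∂κ = ∑ i, kernelIntegral B κ (α + Pi.single i 1) t •
      ContinuousLinearMap.proj (R := ℝ) (φ := fun _ => ℝ) i := by
  unfold kernelProdFDeriv
  rw [integral_finsetSum _ fun i _ => (integrable_kernelProd B κ _ ht).smul_const _]
  exact Finset.sum_congr rfl fun i _ => integral_smul_const _ _

/-- On the ball of `exists_box` the first derivatives of the kernel are bounded uniformly in the
frequency, and a finite measure integrates constants. -/
lemma hasFDerivAt_kernelIntegral (B : Finset (Fin n)) (κ : Measure (Fin n → ℝ≥0))
    [IsFiniteMeasure κ] (α : Fin n → ℕ) {t : Fin n → ℝ} (ht : t ∈ openOrthant n) :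
    HasFDerivAt (kernelIntegral B κ α) (∑ i, kernelIntegral B κ (α + Pi.single i 1) t •
      ContinuousLinearMap.proj (R := ℝ) (φ := fun _ => ℝ) i) t := by
  obtain ⟨ε, hε, M, hM⟩ := exists_box ht
  choose C hC using fun i : Fin n => exists_bound_kernelProd B (α + Pi.single i 1) (M := M) hε
  have hb : ∀ᵐ r ∂κ, ∀ x ∈ Metric.ball t ε, ‖kernelProdFDeriv B α x r‖ ≤
      ∑ i, C i * ‖ContinuousLinearMap.proj (R := ℝ) (φ := fun _ : Fin n => ℝ) i‖ := by
    refine Eventually.of_forall fun r x hx => ?_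
    refine (norm_sum_le _ _).trans (Finset.sum_le_sum fun i _ => ?_)
    rw [norm_smul]
    exact mul_le_mul_of_nonneg_right (hC i r x (hM x hx)) (norm_nonneg _)
  have hmeas : ∀ᶠ x in 𝓝 t, AEStronglyMeasurable (fun r => kernelProd B α r x) κ :=
    Eventually.of_forall fun x => (measurable_kernelProd B α x).aestronglyMeasurable
  have hdiff : ∀ᵐ r ∂κ, ∀ x ∈ Metric.ball t ε,
      HasFDerivAt (fun x => kernelProd B α r x) (kernelProdFDeriv B α x r) x :=
    Eventually.of_forall fun r x _ => hasFDerivAt_kernelProd B α r x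
  rw [← integral_kernelProdFDeriv B κ α ht]
  exact hasFDerivAt_integral_of_dominated_of_fderiv_le (Metric.ball_mem_nhds t hε) hmeas
    (integrable_kernelProd B κ α ht) (aestronglyMeasurable_kernelProdFDeriv B α t κ) hb
    (integrable_const _) hdiff

lemma kernelProd_zero_mem_Icc (B : Finset (Fin n)) (r : Fin n → ℝ≥0) {t : Fin n → ℝ}
    (ht : t ∈ closedOrthant n) : kernelProd B 0 r t ∈ Set.Icc 0 (∏ i ∈ B, (1 + t i)) := by
  rw [kernelProd_zero]
  exact ⟨Finset.prod_nonneg fun i _ => bernKernel_nonneg _ (ht i),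
    Finset.prod_le_prod (fun i _ => bernKernel_nonneg _ (ht i)) fun i _ => bernKernel_le _ (ht i)⟩

lemma integrable_kernelProd_zero (B : Finset (Fin n)) (κ : Measure (Fin n → ℝ≥0))
    [IsFiniteMeasure κ] {t : Fin n → ℝ} (ht : t ∈ closedOrthant n) :
    Integrable (fun r => kernelProd B 0 r t) κ :=
  Integrable.of_bound (measurable_kernelProd B 0 t).aestronglyMeasurable (∏ i ∈ B, (1 + t i))
    (Eventually.of_forall fun r => by
      rw [Real.norm_of_nonneg (kernelProd_zero_mem_Icc B r ht).1]
      exact (kernelProd_zero_mem_Icc B r ht).2)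

lemma continuous_kernelProd (B : Finset (Fin n)) (α : Fin n → ℕ) (r : Fin n → ℝ≥0) :
    Continuous (kernelProd B α r) :=
  continuous_iff_continuousAt.2 fun t => (hasFDerivAt_kernelProd B α r t).continuousAt

/-- Continuity holds up to the boundary because the undifferentiated kernel is dominated by `∏ (1 +
t_i)`, which is locally bounded. -/
lemma continuousOn_kernelIntegral (B : Finset (Fin n)) (κ : Measure (Fin n → ℝ≥0))
    [IsFiniteMeasure κ] : ContinuousOn (kernelIntegral B κ 0) (closedOrthant n) := by
  intro t ht
  have hcont : Continuous fun t : Fin n → ℝ => ∏ i ∈ B, (1 + t i) := by fun_prop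
  refine continuousWithinAt_of_dominated (bound := fun _ => ∏ i ∈ B, (1 + t i) + 1)
    (Eventually.of_forall fun t => (measurable_kernelProd B 0 t).aestronglyMeasurable)
    ?_ (integrable_const _)
    (Eventually.of_forall fun r => (continuous_kernelProd B 0 r).continuousWithinAt)
  have h1 : ∀ᶠ x in 𝓝[closedOrthant n] t, ∏ i ∈ B, (1 + x i) < ∏ i ∈ B, (1 + t i) + 1 :=
    (hcont.continuousAt.eventually_lt continuousAt_const (by linarith)).filter_mono
      nhdsWithin_le_nhds
  filter_upwards [h1, self_mem_nhdsWithin] with x hx hxo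
  refine Eventually.of_forall fun r => ?_
  rw [Real.norm_of_nonneg (kernelProd_zero_mem_Icc B r hxo).1]
  exact (kernelProd_zero_mem_Icc B r hxo).2.trans hx.le

end

noncomputable section

open MeasureTheory Filter Topology NNReal

/-! ### Measures with bounded densities -/

section Weighted

variable {E : Type*} [MeasurableSpace E]

/-- The measure with density `w` with respect to `μ`. -/
def weighted (μ : Measure E) (w : E → ℝ) : Measure E := μ.withDensity fun x => ENNReal.ofReal (w x)

lemma isFiniteMeasure_weighted (μ : Measure E) [IsFiniteMeasure μ] {w : E → ℝ} {C : ℝ}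
    (hC : ∀ x, w x ≤ C) : IsFiniteMeasure (weighted μ w) := by
  refine isFiniteMeasure_withDensity (ne_of_lt ?_)
  calc ∫⁻ x, ENNReal.ofReal (w x) ∂μ ≤ ∫⁻ _, ENNReal.ofReal C ∂μ :=
        lintegral_mono fun x => ENNReal.ofReal_le_ofReal (hC x)
    _ < ⊤ := by
        rw [lintegral_const]
        exact ENNReal.mul_lt_top ENNReal.ofReal_lt_top (measure_lt_top _ _)

lemma integral_weighted (μ : Measure E) {w : E → ℝ} (hw : Measurable w) (h0 : ∀ x, 0 ≤ w x)
    (f : E → ℝ) : ∫ x, f x ∂(weighted μ w) = ∫ x, w x * f x ∂μ := by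
  rw [weighted, integral_withDensity_eq_integral_toReal_smul hw.ennreal_ofReal
    (Eventually.of_forall fun _ => ENNReal.ofReal_lt_top)]
  simp only [ENNReal.toReal_ofReal (h0 _), smul_eq_mul]

lemma weighted_weighted (μ : Measure E) {w v : E → ℝ} (hw : Measurable w) (hv : Measurable v)
    (h0 : ∀ x, 0 ≤ w x) : weighted (weighted μ w) v = weighted μ (fun x => w x * v x) := by
  rw [weighted, weighted, weighted, ← withDensity_mul _ hw.ennreal_ofReal hv.ennreal_ofReal]
  congr 1
  funext x
  simp [ENNReal.ofReal_mul (h0 x)]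

end Weighted

variable {n : ℕ}

/-! ### Difference operators -/

/-- The vector with the coordinates of `s` in `A` and zeros elsewhere. -/
def truncate (A : Finset (Fin n)) (s : Fin n → ℝ≥0) : Fin n → ℝ≥0 := fun i => if i ∈ A then s i else 0

lemma prod_axisShift (A : Finset (Fin n)) (s : Fin n → ℝ≥0) :
    ∏ i ∈ A, axisShift i (s i) = shift (truncate A s) := by
  rw [shift_eq_prod, ← Finset.prod_subset (Finset.subset_univ A)]
  · exact Finset.prod_congr rfl fun i hi => by simp [truncate, hi]
  · intro i _ hi
    simp [truncate, hi, axisShift_zero]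

lemma diffOp_eq_sum (F : Finset (Fin n)) (s : Fin n → ℝ≥0) :
    diffOp F s = ∑ A ∈ F.powerset, (-1 : ℝ) ^ (F \ A).card • shift (truncate A s) := by
  simp only [diffOp, sub_eq_add_neg]
  rw [Finset.prod_add]
  refine Finset.sum_congr rfl fun A _ => ?_
  rw [prod_axisShift, Finset.prod_const, mul_comm, Algebra.smul_def, map_pow, map_neg, map_one]

lemma shift_eq_sum_diffOp (s : Fin n → ℝ≥0) : shift s = ∑ B : Finset (Fin n), diffOp B s := by
  rw [shift_eq_prod]
  have : ∀ i, axisShift i (s i) = 1 + (axisShift i (s i) - 1) := fun i => by ring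
  rw [Finset.prod_congr rfl fun i _ => this i, Finset.prod_one_add, Finset.powerset_univ]
  rfl

lemma diffOp_mul_diffOp_sdiff {F B : Finset (Fin n)} (h : F ⊆ B) (s : Fin n → ℝ≥0) :
    diffOp F s * diffOp (B \ F) s = diffOp B s := by
  rw [mul_comm]; exact Finset.prod_sdiff h

lemma laplaceChar_diffOp (r : Fin n → ℝ≥0) (B : Finset (Fin n)) (s : Fin n → ℝ≥0) :
    laplaceChar r (diffOp B s) = ∏ i ∈ B, (Real.exp (-((r i : ℝ) * s i)) - 1) := by
  simp [diffOp, map_prod]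

lemma continuous_truncate (A : Finset (Fin n)) : Continuous (truncate A) := by
  refine continuous_pi fun i => ?_
  unfold truncate
  split_ifs <;> fun_prop

lemma continuous_shiftFunctional_diffOp {f : (Fin n → ℝ≥0) → ℝ} (hf : Continuous f)
    (F : Finset (Fin n)) (P : ShiftAlgebra n) :
    Continuous fun s => shiftFunctional f (diffOp F s * P) := by
  simp only [diffOp_eq_sum, Finset.sum_mul, map_sum, smul_mul_assoc, map_smul]
  refine continuous_finsetSum _ fun A _ => ?_
  simp only [smul_eq_mul]
  refine continuous_const.mul ?_
  simp only [mul_comm _ P]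
  exact (continuous_shiftFunctional_mul_shift hf P).comp (continuous_truncate A)

lemma truncate_mem_sparsePoints {A : Finset (Fin n)} {k : ℕ} (hA : A.card < k) (s : Fin n → ℝ≥0) :
    (fun i => (truncate A s i : ℝ)) ∈ sparsePoints n k := by
  refine ⟨fun i => NNReal.coe_nonneg _, lt_of_le_of_lt ?_ hA⟩
  rw [← Set.ncard_coe_finset]
  refine Set.ncard_le_ncard (fun i hi => ?_) (Finset.finite_toSet A)
  by_contra h
  have : i ∉ A := h
  simp [truncate, this] at hi

/-- For `|B| < k`, the difference over `B` is a combination of values of `g` at truncations of `s`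
to subsets of `B`. These have fewer than `k` positive coordinates, so `g` vanishes there. -/
lemma restrictOrthant_eq_sum_diffOp {k : ℕ} {g : (Fin n → ℝ) → ℝ}
    (hg0 : ∀ t ∈ sparsePoints n k, g t = 0) (s : Fin n → ℝ≥0) :
    restrictOrthant g s = ∑ B : Finset (Fin n) with k ≤ B.card,
      shiftFunctional (restrictOrthant g) (diffOp B s) := by
  rw [← shiftFunctional_shift (restrictOrthant g) s, shift_eq_sum_diffOp, map_sum,
    Finset.sum_filter_of_ne]
  intro B _ hB
  by_contra hlt
  refine hB ?_
  rw [diffOp_eq_sum, map_sum]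
  refine Finset.sum_eq_zero fun A hA => ?_
  have hcard : A.card < k := (Finset.card_le_card (Finset.mem_powerset.1 hA)).trans_lt (not_le.1 hlt)
  rw [map_smul, shiftFunctional_shift, restrictOrthant, hg0 _ (truncate_mem_sparsePoints hcard s),
    smul_zero]

/-! ### Integral representation of mixed differences -/

lemma bernKernel_one (r : ℝ≥0) : bernKernel 0 r 1 = 1 := by
  simp only [bernKernel]
  split_ifs with h
  · rfl
  · rw [mul_one]; exact div_self (decay_pos.2 (pos_iff_ne_zero.2 h)).ne'

/-- With `x = e^{-r/(p+1)}` this is cancellation of `1 - x^{p+1}` in `(1-x^m)/(1-x^{p+1}) ·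
(1-x^{p+1})/(1-x)`. It converts measures attached to the step `1/(p+1)` into the one attached to the
unit step. -/
lemma bernKernel_mul_geom_sum (r : ℝ≥0) (p m : ℕ) :
    bernKernel 0 r ((m : ℝ) / ((p + 1 : ℕ) : ℝ)) *
      ∑ j ∈ Finset.range (p + 1), Real.exp (-((r : ℝ) / ((p + 1 : ℕ) : ℝ))) ^ j =
    ∑ j ∈ Finset.range m, Real.exp (-((r : ℝ) / ((p + 1 : ℕ) : ℝ))) ^ j := by
  have hp : ((p + 1 : ℕ) : ℝ) ≠ 0 := by positivity
  by_cases hr : r = 0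
  · subst hr
    simp only [bernKernel, if_true, NNReal.coe_zero, zero_div, neg_zero, Real.exp_zero, one_pow,
      Finset.sum_const, Finset.card_range, nsmul_eq_mul, mul_one]
    field_simp
  · have hr0 : (0 : ℝ) < r := NNReal.coe_pos.2 (pos_iff_ne_zero.2 hr)
    have hd : decay r ≠ 0 := (decay_pos.2 (pos_iff_ne_zero.2 hr)).ne'
    set x := Real.exp (-((r : ℝ) / ((p + 1 : ℕ) : ℝ))) with hx
    have hx1 : 1 - x ≠ 0 := by
      have : x < 1 := by
        rw [hx, Real.exp_lt_one_iff]
        have : 0 < (r : ℝ) / ((p + 1 : ℕ) : ℝ) := by positivity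
        linarith
      linarith
    have hpow : ∀ m : ℕ, Real.exp (-((r : ℝ) * ((m : ℝ) / ((p + 1 : ℕ) : ℝ)))) = x ^ m := by
      intro m
      rw [hx, ← Real.exp_nat_mul]
      congr 1; ring
    have hdx : decay r = 1 - x ^ (p + 1) := by
      rw [← hpow (p + 1), div_self hp, mul_one, decay]
    have hg : ∀ m : ℕ, (∑ j ∈ Finset.range m, x ^ j) * (1 - x) = 1 - x ^ m := by
      intro m
      have := geom_sum_mul x m
      linarith
    apply mul_right_cancel₀ hx1
    rw [mul_assoc, hg, hg, ← hdx]
    simp only [bernKernel, hr, if_false]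
    rw [hpow, div_mul_cancel₀ _ hd]

/-- The mixed differences over `F` of a function whose derivatives `∂^α`, `α ≥ 1_F`, alternate in
sign are represented by a finite measure. -/
theorem HasAlternatingDerivs.exists_measure {F : Finset (Fin n)} {g : (Fin n → ℝ) → ℝ}
    (hF : HasAlternatingDerivs F g) (hg : ContinuousOn g (closedOrthant n)) :
    ∃ μ : Measure (Fin n → ℝ≥0), IsFiniteMeasure μ ∧ ∀ (s : Fin n → ℝ≥0) (P : ShiftAlgebra n),
      shiftFunctional (restrictOrthant g) (diffOp F s * P) =
        ∫ r, kernelProd F 0 r (fun i => s i) * laplaceChar r P ∂μ := by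
  have hgc := continuous_restrictOrthant hg
  set L := shiftFunctional (restrictOrthant g) with hL
  choose μ hμ hrep using fun p : ℕ => exists_measure_laplaceChar
    (L ∘ₗ LinearMap.mulLeft ℝ (diffOp F fun _ => ((p + 1 : ℕ) : ℝ≥0)⁻¹))
    (fun c a b => hF.shiftFunctional_nonneg hg _ c a b) (by
      have := continuous_shiftFunctional_mul_shift hgc (diffOp F fun _ => ((p + 1 : ℕ) : ℝ≥0)⁻¹)
      exact this)
  simp only [LinearMap.comp_apply, LinearMap.mulLeft_apply] at hrep
  -- A difference with step `m_i/(p+1)` is the one with step `1/(p+1)` times a geometric sum of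
  -- translations; `G p m` is the value of that factor under the character `r`.
  let G : ℕ → (Fin n → ℕ) → (Fin n → ℝ≥0) → ℝ := fun p m r => ∏ i ∈ F,
    ∑ j ∈ Finset.range (m i), Real.exp (-((r i : ℝ) / ((p + 1 : ℕ) : ℝ))) ^ j
  have hG0 : ∀ p m r, 0 ≤ G p m r := fun p m r =>
    Finset.prod_nonneg fun i _ => Finset.sum_nonneg fun j _ => by positivity
  have hGm : ∀ p m, Measurable (G p m) := fun p m => by
    have : Continuous (G p m) := by fun_prop
    exact this.measurable
  have hGC : ∀ p m r, G p m r ≤ ∏ i ∈ F, (m i : ℝ) := fun p m r => by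
    refine Finset.prod_le_prod (fun i _ => Finset.sum_nonneg fun j _ => by positivity) fun i _ => ?_
    calc _ ≤ ∑ j ∈ Finset.range (m i), (1 : ℝ) := Finset.sum_le_sum fun j _ =>
          pow_le_one₀ (Real.exp_pos _).le (by
            rw [Real.exp_le_one_iff]
            have : 0 ≤ (r i : ℝ) / ((p + 1 : ℕ) : ℝ) := by positivity
            linarith)
      _ = _ := by simp
  have hstep : ∀ (p : ℕ) (m : Fin n → ℕ) (P : ShiftAlgebra n),
      L (diffOp F (fun i => (m i : ℝ≥0) / ((p + 1 : ℕ) : ℝ≥0)) * P) =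
        ∫ r, G p m r * laplaceChar r P ∂(μ p) := by
    intro p m P
    have h1 : diffOp F (fun i => (m i : ℝ≥0) / ((p + 1 : ℕ) : ℝ≥0)) =
        (diffOp F fun _ => ((p + 1 : ℕ) : ℝ≥0)⁻¹) *
          ∏ i ∈ F, ∑ j ∈ Finset.range (m i), axisShift i (((p + 1 : ℕ) : ℝ≥0)⁻¹) ^ j := by
      simp only [diffOp]
      rw [← Finset.prod_mul_distrib]
      refine Finset.prod_congr rfl fun i _ => ?_
      rw [mul_comm, geom_sum_mul, axisShift_pow, div_eq_mul_inv]
    rw [h1, mul_assoc, hrep]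
    refine integral_congr_ae (Eventually.of_forall fun r => ?_)
    simp only [map_mul, map_prod, map_sum, map_pow, laplaceChar_axisShift, G, NNReal.coe_inv,
      NNReal.coe_natCast, div_eq_mul_inv]
  -- Taking `p + 1` small steps in every direction gives the unit step, so uniqueness of Laplace
  -- transforms identifies the measures.
  have hμ0 : ∀ p, μ 0 = weighted (μ p) (G p fun _ => p + 1) := by
    intro p
    have := hμ 0
    have := hμ p
    have := isFiniteMeasure_weighted (μ p) (hGC p fun _ => p + 1)
    refine measure_ext_of_laplaceChar fun t => ?_
    rw [integral_weighted _ (hGm p _) (hG0 p _), ← hstep, ← hrep]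
    congr 3
    funext i
    simp
  have hrat : ∀ (p : ℕ) (m : Fin n → ℕ) (P : ShiftAlgebra n),
      L (diffOp F (fun i => (m i : ℝ≥0) / ((p + 1 : ℕ) : ℝ≥0)) * P) =
        ∫ r, kernelProd F 0 r (fun i => (m i : ℝ) / ((p + 1 : ℕ) : ℝ)) * laplaceChar r P ∂(μ 0) := by
    intro p m P
    rw [hstep, hμ0 p, integral_weighted _ (hGm p _) (hG0 p _)]
    refine integral_congr_ae (Eventually.of_forall fun r => ?_)
    simp only []
    rw [← mul_assoc]
    congr 1
    rw [kernelProd_zero]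
    simp only [G]
    rw [← Finset.prod_mul_distrib]
    refine Finset.prod_congr rfl fun i _ => ?_
    rw [mul_comm, bernKernel_mul_geom_sum]
  have := hμ 0
  refine ⟨μ 0, hμ 0, fun s P => ?_⟩
  have hs : (fun i => (s i : ℝ)) ∈ closedOrthant n := fun i => NNReal.coe_nonneg _
  induction P using shiftAlgebra_induction with
  | zero => simp
  | add P Q hP hQ =>
    have hi : ∀ P : ShiftAlgebra n, Integrable
        (fun r => kernelProd F 0 r (fun i => s i) * laplaceChar r P) (μ 0) := fun P => by
      obtain ⟨C, hC⟩ := exists_bound_laplaceChar P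
      exact (integrable_kernelProd_zero F (μ 0) hs).mul_bdd (c := C)
        (continuous_laplaceChar P).aestronglyMeasurable (Eventually.of_forall hC)
    simp only [mul_add, map_add]
    rw [integral_add (hi P) (hi Q), hP, hQ]
  | smul c t =>
    rw [mul_smul_comm, map_smul]
    simp only [map_smul, smul_eq_mul, mul_left_comm _ c]
    rw [integral_const_mul]
    congr 1
    -- For a single shift the character is nonnegative and bounded by one, hence can be absorbed in
    -- the measure; continuity in `s` then extends the formula from rational points.
    have hw : Measurable fun r => laplaceChar r (shift t) := (continuous_laplaceChar _).measurable
    have hw0 : ∀ r, 0 ≤ laplaceChar r (shift t) := fun r => by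
      rw [laplaceChar_shift]; exact (prod_exp_neg_mem_Icc r t).1
    have hfin := isFiniteMeasure_weighted (μ 0) (w := fun r => laplaceChar r (shift t)) (C := 1)
      fun r => by rw [laplaceChar_shift]; exact (prod_exp_neg_mem_Icc r t).2
    have hint : ∀ u : Fin n → ℝ, ∫ r, kernelProd F 0 r u * laplaceChar r (shift t) ∂(μ 0) =
        kernelIntegral F (weighted (μ 0) fun r => laplaceChar r (shift t)) 0 u := by
      intro u
      rw [kernelIntegral, integral_weighted _ hw hw0]
      simp only [mul_comm]
    have hc1 : Continuous fun s : Fin n → ℝ≥0 =>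
        kernelIntegral F (weighted (μ 0) fun r => laplaceChar r (shift t)) 0 (fun i => s i) :=
      continuous_restrictOrthant (continuousOn_kernelIntegral F _)
    have hc2 := continuous_shiftFunctional_diffOp hgc F (shift t)
    rw [hint]
    refine tendsto_nhds_unique ((hc2.tendsto s).comp (tendsto_floor_mul_div s))
      (((hc1.tendsto s).comp (tendsto_floor_mul_div s)).congr fun p => ?_)
    simp only [Function.comp_apply]
    rw [← hL, hrat, hint]
    simp

/-- Measures representing the mixed differences over two sets are compatible. -/
lemma weighted_eq_weighted {F F' : Finset (Fin n)} {g : (Fin n → ℝ) → ℝ} (hcard : F.card = F'.card)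
    {μ μ' : Measure (Fin n → ℝ≥0)} [IsFiniteMeasure μ] [IsFiniteMeasure μ']
    (h : ∀ (s : Fin n → ℝ≥0) (P : ShiftAlgebra n),
      shiftFunctional (restrictOrthant g) (diffOp F s * P) =
        ∫ r, kernelProd F 0 r (fun i => s i) * laplaceChar r P ∂μ)
    (h' : ∀ (s : Fin n → ℝ≥0) (P : ShiftAlgebra n),
      shiftFunctional (restrictOrthant g) (diffOp F' s * P) =
        ∫ r, kernelProd F' 0 r (fun i => s i) * laplaceChar r P ∂μ') :
    weighted μ (fun r => ∏ i ∈ F' \ F, decay (r i)) =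
      weighted μ' (fun r => ∏ i ∈ F \ F', decay (r i)) := by
  have hone : ∀ (F : Finset (Fin n)) (r : Fin n → ℝ≥0),
      kernelProd F 0 r (fun _ => ((1 : ℝ≥0) : ℝ)) = 1 := by
    intro F r
    rw [kernelProd_zero]
    exact Finset.prod_eq_one fun i _ => bernKernel_one _
  have hm : ∀ A : Finset (Fin n), Measurable fun r : Fin n → ℝ≥0 => ∏ i ∈ A, decay (r i) :=
    fun A => by
      have : Continuous fun r : Fin n → ℝ≥0 => ∏ i ∈ A, decay (r i) :=
        continuous_finsetProd _ fun i _ => continuous_decay.comp (continuous_apply i)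
      exact this.measurable
  have h0 : ∀ (A : Finset (Fin n)) (r : Fin n → ℝ≥0), 0 ≤ ∏ i ∈ A, decay (r i) :=
    fun A r => Finset.prod_nonneg fun i _ => decay_nonneg _
  have h1 : ∀ (A : Finset (Fin n)) (r : Fin n → ℝ≥0), ∏ i ∈ A, decay (r i) ≤ 1 :=
    fun A r => Finset.prod_le_one (fun i _ => decay_nonneg _) fun i _ => decay_le_one _
  have := isFiniteMeasure_weighted μ (h1 (F' \ F))
  have := isFiniteMeasure_weighted μ' (h1 (F \ F'))
  have hchar : ∀ (A : Finset (Fin n)) (r : Fin n → ℝ≥0),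
      laplaceChar r (diffOp A fun _ => 1) = (-1) ^ A.card * ∏ i ∈ A, decay (r i) := by
    intro A r
    rw [laplaceChar_diffOp, ← Finset.prod_const, ← Finset.prod_mul_distrib]
    refine Finset.prod_congr rfl fun i _ => ?_
    simp [decay]
  have hcd : (F' \ F).card = (F \ F').card := by
    have a1 := Finset.card_sdiff_add_card_inter F' F
    have a2 := Finset.card_sdiff_add_card_inter F F'
    rw [Finset.inter_comm] at a2
    omega
  refine measure_ext_of_laplaceChar fun t => ?_
  rw [integral_weighted _ (hm _) (h0 _), integral_weighted _ (hm _) (h0 _)]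
  have e1 := h (fun _ => 1) (diffOp (F' \ F) (fun _ => 1) * shift t)
  have e2 := h' (fun _ => 1) (diffOp (F \ F') (fun _ => 1) * shift t)
  -- Both sides are the unit difference over `F ∪ F'`, which is thereby evaluated through each of
  -- the two measures.
  have e3 : diffOp F (fun _ => (1 : ℝ≥0)) * (diffOp (F' \ F) (fun _ => 1) * shift t) =
      diffOp F' (fun _ => 1) * (diffOp (F \ F') (fun _ => 1) * shift t) := by
    rw [← mul_assoc, ← mul_assoc]
    congr 1
    rw [← Finset.union_sdiff_left, diffOp_mul_diffOp_sdiff Finset.subset_union_left,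
      Finset.union_comm, ← diffOp_mul_diffOp_sdiff Finset.subset_union_left,
      Finset.union_sdiff_left]
  rw [e3, e2] at e1
  simp only [hone, one_mul, map_mul, hchar, mul_assoc, integral_const_mul, hcd] at e1
  exact (mul_left_cancel₀ (pow_ne_zero _ (by norm_num)) e1).symm

end

noncomputable section

open MeasureTheory Filter Topology NNReal

variable {n : ℕ}

/-! ### Elementary symmetric polynomials and the functions `H_k^n` -/

lemma elemSymm_eq_sum (n j : ℕ) (x : Fin n → ℝ) :
    elemSymm n j x = ∑ A ∈ Finset.powersetCard j Finset.univ, ∏ i ∈ A, x i := by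
  simp [elemSymm, MvPolynomial.esymm]

lemma prod_sub_one (B : Finset (Fin n)) (x : Fin n → ℝ) :
    ∏ i ∈ B, (x i - 1) = ∑ A ∈ B.powerset, (-1 : ℝ) ^ (B \ A).card * ∏ i ∈ A, x i := by
  simp only [sub_eq_add_neg]
  rw [Finset.prod_add]
  refine Finset.sum_congr rfl fun A _ => ?_
  rw [Finset.prod_const, mul_comm]

lemma sum_alternating_card_lt (S : Finset (Fin n)) {d : ℕ} (hd : 0 < d) (hS : d ≤ S.card) :
    ∑ C ∈ S.powerset, (if C.card < d then (-1 : ℝ) ^ C.card else 0) =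
      (-1) ^ (d - 1) * ((S.card - 1).choose (d - 1) : ℝ) := by
  rw [Finset.sum_powerset_apply_card (fun m => if m < d then (-1 : ℝ) ^ m else 0)]
  obtain ⟨e, rfl⟩ : ∃ e, d = e + 1 := ⟨d - 1, by omega⟩
  obtain ⟨N, hN⟩ : ∃ N, S.card = N + 1 := ⟨S.card - 1, by omega⟩
  have h := congrArg (Int.cast (R := ℝ)) (Int.alternating_sum_range_choose_eq_choose (n := N) (m := e))
  push_cast at h
  rw [hN, Nat.add_sub_cancel, Nat.add_sub_cancel, ← h]
  rw [← Finset.sum_subset (Finset.range_subset_range.2 (by omega : e + 1 ≤ N + 1 + 1))]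
  · refine Finset.sum_congr rfl fun m hm => ?_
    rw [if_pos (Finset.mem_range.1 hm), nsmul_eq_mul, mul_comm]
  · intro m _ hm
    rw [if_neg (by simpa using hm), smul_zero]

/-- Writing `B = A ∪ C` with `C` disjoint from `A` leaves a truncated alternating binomial sum. Its
value is, up to sign, the coefficient of `p_{|A|}^n` in `H_k^n`. -/
lemma sum_superset_card_lt (A : Finset (Fin n)) {k : ℕ} (hk : k ≤ n) :
    ∑ B : Finset (Fin n) with A ⊆ B ∧ B.card < k, (-1 : ℝ) ^ (B \ A).card =
      if A.card < k then -((-1) ^ (k - A.card) * ((n - A.card - 1).choose (n - k) : ℝ)) else 0 := by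
  have h1 : ∑ B : Finset (Fin n) with A ⊆ B ∧ B.card < k, (-1 : ℝ) ^ (B \ A).card =
      ∑ C ∈ Aᶜ.powerset, if C.card + A.card < k then (-1 : ℝ) ^ C.card else 0 := by
    rw [← Finset.sum_filter]
    refine Finset.sum_nbij' (fun B => B \ A) (fun C => C ∪ A) ?_ ?_ ?_ ?_ ?_
    · intro B hB
      simp only [Finset.mem_filter, Finset.mem_univ, true_and, Finset.mem_powerset] at hB ⊢
      refine ⟨fun i hi => by simp [(Finset.mem_sdiff.1 hi).2], ?_⟩
      rw [Finset.card_sdiff_add_card_eq_card hB.1]; exact hB.2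
    · intro C hC
      simp only [Finset.mem_filter, Finset.mem_univ, true_and, Finset.mem_powerset] at hC ⊢
      exact ⟨Finset.subset_union_right, (Finset.card_union_le _ _).trans_lt hC.2⟩
    · intro B hB
      simp only [Finset.mem_filter, Finset.mem_univ, true_and] at hB
      exact Finset.sdiff_union_of_subset hB.1
    · intro C hC
      simp only [Finset.mem_filter, Finset.mem_powerset] at hC
      exact Finset.union_sdiff_cancel_right (Finset.disjoint_left.2 fun i hi hA =>
        (Finset.mem_compl.1 (hC.1 hi)) hA)
    · intro B _; rfl
  rw [h1]
  have hcard : Aᶜ.card = n - A.card := by rw [Finset.card_compl, Fintype.card_fin]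
  split_ifs with h
  · have h2 : ∀ C : Finset (Fin n), (C.card + A.card < k) = (C.card < k - A.card) := fun C => by
      rw [eq_iff_iff]; omega
    simp only [h2]
    rw [sum_alternating_card_lt _ (by omega) (by omega), hcard]
    rw [← Nat.choose_symm (by omega : k - A.card - 1 ≤ n - A.card - 1),
      show n - A.card - 1 - (k - A.card - 1) = n - k by omega]
    obtain ⟨d, hd⟩ : ∃ d, k - A.card = d + 1 := ⟨k - A.card - 1, by omega⟩
    rw [hd, Nat.add_sub_cancel, pow_succ]
    ring
  · exact Finset.sum_eq_zero fun C _ => if_neg (by omega)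

/-- The sum over all `B` is the full product `∏ x_i = p_n^n`. Expanding the terms with `|B| < k`
into monomials and collecting coefficients gives the negative of the correction terms in `H_k^n`. -/
lemma HFun_eq_sum {k : ℕ} (hk : k ≤ n) (x : Fin n → ℝ) :
    HFun n k x = ∑ B : Finset (Fin n) with k ≤ B.card, ∏ i ∈ B, (x i - 1) := by
  have hall : ∏ i, x i = ∑ B : Finset (Fin n), ∏ i ∈ B, (x i - 1) := by
    rw [← Finset.powerset_univ, ← Finset.prod_one_add]
    exact Finset.prod_congr rfl fun i _ => by ring
  have hsplit := Finset.sum_filter_add_sum_filter_not (Finset.univ : Finset (Finset (Fin n)))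
    (fun B => k ≤ B.card) (fun B => ∏ i ∈ B, (x i - 1))
  have htop : elemSymm n n x = ∏ i, x i := by
    rw [elemSymm_eq_sum]
    have : Finset.powersetCard n (Finset.univ : Finset (Fin n)) = {Finset.univ} := by
      simpa using Finset.powersetCard_self (Finset.univ : Finset (Fin n))
    rw [this, Finset.sum_singleton]
  have hlow : ∑ B : Finset (Fin n) with ¬ k ≤ B.card, ∏ i ∈ B, (x i - 1) =
      -∑ j ∈ Finset.range k, (-1 : ℝ) ^ (k - j) * ((n - j - 1).choose (n - k) : ℝ) *
        elemSymm n j x := by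
    simp only [prod_sub_one]
    rw [Finset.sum_comm' (t' := Finset.univ)
      (s' := fun A => Finset.univ.filter fun B => A ⊆ B ∧ B.card < k)
      (by intro B A; simp [and_comm])]
    simp only [← Finset.sum_mul, sum_superset_card_lt _ hk]
    simp only [elemSymm_eq_sum, Finset.mul_sum]
    have hfib := Finset.sum_fiberwise_of_maps_to (s := (Finset.univ : Finset (Finset (Fin n))).filter
      fun A => A.card < k) (t := Finset.range k) (g := Finset.card) (by simp)
      (fun A => (-1 : ℝ) ^ (k - A.card) * ((n - A.card - 1).choose (n - k) : ℝ) * ∏ i ∈ A, x i)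
    have h2 : ∀ j ∈ Finset.range k, ∑ A ∈ Finset.powersetCard j Finset.univ,
        (-1 : ℝ) ^ (k - j) * ((n - j - 1).choose (n - k) : ℝ) * ∏ i ∈ A, x i =
        ∑ A ∈ (Finset.univ.filter fun A : Finset (Fin n) => A.card < k) with A.card = j,
          (-1 : ℝ) ^ (k - A.card) * ((n - A.card - 1).choose (n - k) : ℝ) * ∏ i ∈ A, x i := by
      intro j hj
      have hj' := Finset.mem_range.1 hj
      refine Finset.sum_congr ?_ fun A hA => ?_
      · ext A
        simp only [Finset.mem_powersetCard, Finset.subset_univ, true_and, Finset.mem_filter,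
          Finset.mem_univ]
        exact ⟨fun h => ⟨h ▸ hj', h⟩, fun h => h.2⟩
      · rw [(Finset.mem_filter.1 hA).2]
    rw [Finset.sum_congr rfl h2, hfib, Finset.sum_filter, ← Finset.sum_neg_distrib]
    refine Finset.sum_congr rfl fun A _ => ?_
    split_ifs <;> ring
  rw [HFun, htop, hall, ← hsplit, hlow]
  ring

/-! ### The weight `p_k^n(1 + r) / p_k^n(r)` -/

/-- The weight `p_k^n(1 + r) / p_k^n(r)` times `∏_{i ∈ B} (1 - e^{-r_i})`. -/
def levyWeight (k : ℕ) (B : Finset (Fin n)) (r : Fin n → ℝ≥0) : ℝ :=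
  elemSymm n k (fun i => 1 + (r i : ℝ)) / elemSymm n k (fun i => (r i : ℝ)) * ∏ i ∈ B, decay (r i)

lemma elemSymm_nonneg (k : ℕ) {x : Fin n → ℝ} (hx : ∀ i, 0 ≤ x i) : 0 ≤ elemSymm n k x := by
  rw [elemSymm_eq_sum]
  exact Finset.sum_nonneg fun A _ => Finset.prod_nonneg fun i _ => hx i

lemma prod_le_elemSymm {k : ℕ} {x : Fin n → ℝ} (hx : ∀ i, 0 ≤ x i) {A : Finset (Fin n)}
    (hA : A.card = k) : ∏ i ∈ A, x i ≤ elemSymm n k x := by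
  rw [elemSymm_eq_sum]
  exact Finset.single_le_sum (f := fun A => ∏ i ∈ A, x i)
    (fun A _ => Finset.prod_nonneg fun i _ => hx i)
    (Finset.mem_powersetCard.2 ⟨Finset.subset_univ _, hA⟩)

lemma elemSymm_pos_iff {k : ℕ} {x : Fin n → ℝ} (hx : ∀ i, 0 ≤ x i) :
    0 < elemSymm n k x ↔ k ≤ (Finset.univ.filter fun i => 0 < x i).card := by
  constructor
  · intro h
    by_contra hlt
    refine h.ne' ?_
    rw [elemSymm_eq_sum]
    refine Finset.sum_eq_zero fun A hA => ?_
    by_contra hne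
    refine hlt ?_
    rw [← (Finset.mem_powersetCard.1 hA).2]
    refine Finset.card_le_card fun i hi => ?_
    simp only [Finset.mem_filter, Finset.mem_univ, true_and]
    exact lt_of_le_of_ne (hx i) fun h0 => hne (Finset.prod_eq_zero hi h0.symm)
  · intro h
    obtain ⟨A, hA, hcard⟩ := Finset.exists_subset_card_eq h
    refine lt_of_lt_of_le (Finset.prod_pos fun i hi => ?_) (prod_le_elemSymm hx hcard)
    exact (Finset.mem_filter.1 (hA hi)).2

lemma decay_le (r : ℝ≥0) : decay r ≤ r := by
  have := Real.add_one_le_exp (-(r : ℝ))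
  rw [decay]; linarith

lemma continuous_elemSymm (k : ℕ) : Continuous (elemSymm n k) := by
  have : elemSymm n k = fun x => ∑ A ∈ Finset.powersetCard k Finset.univ, ∏ i ∈ A, x i :=
    funext (elemSymm_eq_sum n k)
  rw [this]; fun_prop

lemma measurable_levyWeight (k : ℕ) (B : Finset (Fin n)) : Measurable (levyWeight k B) := by
  have h1 : Continuous fun r : Fin n → ℝ≥0 => elemSymm n k (fun i => 1 + (r i : ℝ)) :=
    (continuous_elemSymm k).comp (by fun_prop)
  have h2 : Continuous fun r : Fin n → ℝ≥0 => elemSymm n k (fun i => (r i : ℝ)) :=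
    (continuous_elemSymm k).comp (by fun_prop)
  have h3 : Continuous fun r : Fin n → ℝ≥0 => ∏ i ∈ B, decay (r i) :=
    continuous_finsetProd _ fun i _ => continuous_decay.comp (continuous_apply i)
  exact (h1.measurable.div h2.measurable).mul h3.measurable

lemma levyWeight_nonneg (k : ℕ) (B : Finset (Fin n)) (r : Fin n → ℝ≥0) : 0 ≤ levyWeight k B r :=
  mul_nonneg (div_nonneg (elemSymm_nonneg _ fun _ => by positivity)
    (elemSymm_nonneg _ fun _ => by positivity)) (Finset.prod_nonneg fun _ _ => decay_nonneg _)

/-- The set `D` is completed to `k` elements by indices from `B \ D`. For these `1 - e^{-r} ≤ r` is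
used; the other decay factors are bounded by one. The result is a single monomial of `p_k^n(r)`. -/
lemma prod_mul_prod_decay_le {k : ℕ} {D B : Finset (Fin n)} (hD : D.card ≤ k) (hB : k ≤ B.card)
    (r : Fin n → ℝ≥0) :
    (∏ i ∈ D, (r i : ℝ)) * ∏ i ∈ B, decay (r i) ≤ elemSymm n k (fun i => (r i : ℝ)) := by
  have h1 : k - D.card ≤ (B \ D).card := by
    have := Finset.le_card_sdiff D B
    omega
  obtain ⟨E, hE, hcard⟩ := Finset.exists_subset_card_eq h1
  have hdis : Disjoint D E := Finset.disjoint_left.2 fun i hi hiE =>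
    (Finset.mem_sdiff.1 (hE hiE)).2 hi
  have hEB : E ⊆ B := hE.trans Finset.sdiff_subset
  have h2 : ∏ i ∈ B, decay (r i) ≤ ∏ i ∈ E, (r i : ℝ) := by
    rw [← Finset.prod_sdiff hEB]
    calc _ ≤ 1 * ∏ i ∈ E, decay (r i) := by
          refine mul_le_mul_of_nonneg_right (Finset.prod_le_one (fun _ _ => decay_nonneg _)
            fun _ _ => decay_le_one _) (Finset.prod_nonneg fun _ _ => decay_nonneg _)
      _ ≤ _ := by
          rw [one_mul]
          exact Finset.prod_le_prod (fun _ _ => decay_nonneg _) fun _ _ => decay_le _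
  calc _ ≤ (∏ i ∈ D, (r i : ℝ)) * ∏ i ∈ E, (r i : ℝ) := by gcongr
    _ = ∏ i ∈ D ∪ E, (r i : ℝ) := (Finset.prod_union hdis).symm
    _ ≤ _ := prod_le_elemSymm (x := fun i => (r i : ℝ)) (fun i => NNReal.coe_nonneg _)
          (by rw [Finset.card_union_of_disjoint hdis]; omega)

/-- Expanding `p_k^n(1 + r)` into monomials over pairs `D ⊆ A` with `|A| = k`, each monomial times
the decay factors is at most `p_k^n(r)`. The constant counts these pairs. -/
lemma levyWeight_le {k : ℕ} {B : Finset (Fin n)} (hB : k ≤ B.card) (r : Fin n → ℝ≥0) :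
    levyWeight k B r ≤ ∑ A ∈ Finset.powersetCard k (Finset.univ : Finset (Fin n)),
      ∑ _D ∈ A.powerset, (1 : ℝ) := by
  have hC : (0 : ℝ) ≤ ∑ A ∈ Finset.powersetCard k (Finset.univ : Finset (Fin n)),
      ∑ _D ∈ A.powerset, (1 : ℝ) :=
    Finset.sum_nonneg fun _ _ => Finset.sum_nonneg fun _ _ => zero_le_one
  rcases (elemSymm_nonneg k (x := fun i => (r i : ℝ)) fun _ => by positivity).eq_or_lt with h | h
  -- Where `p_k^n(r) = 0`, the convention for division by zero makes the weight zero.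
  · rw [levyWeight, ← h]; simpa using hC
  · rw [levyWeight, div_mul_eq_mul_div, div_le_iff₀ h, elemSymm_eq_sum, Finset.sum_mul,
      Finset.sum_mul]
    refine Finset.sum_le_sum fun A hA => ?_
    rw [Finset.prod_one_add, Finset.sum_mul, Finset.sum_mul]
    refine Finset.sum_le_sum fun D hD => ?_
    rw [one_mul]
    refine prod_mul_prod_decay_le ?_ hB r
    rw [← (Finset.mem_powersetCard.1 hA).2]
    exact Finset.card_le_card (Finset.mem_powerset.1 hD)

/-- Monomial by monomial, `p_k^n(1+r)` is bounded below by `∏_{i ∈ F} (1+r_i)`, and `r/(1+r) ≤ 1 -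
e^{-r}`. This makes the density defining `η` at most one, hence `η` finite. -/
lemma elemSymm_div_le_elemSymm_decay (k : ℕ) (r : Fin n → ℝ≥0) :
    elemSymm n k (fun i => (r i : ℝ)) / elemSymm n k (fun i => 1 + (r i : ℝ)) ≤
      elemSymm n k (fun i => decay (r i)) := by
  rw [elemSymm_eq_sum n k fun i => (r i : ℝ), elemSymm_eq_sum n k fun i => decay (r i),
    Finset.sum_div]
  refine Finset.sum_le_sum fun F hF => ?_
  have h0 : 0 < ∏ i ∈ F, (1 + (r i : ℝ)) := Finset.prod_pos fun i _ => by positivity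
  calc _ ≤ (∏ i ∈ F, (r i : ℝ)) / ∏ i ∈ F, (1 + (r i : ℝ)) := by
        gcongr
        exact prod_le_elemSymm (x := fun i => 1 + (r i : ℝ)) (fun i => by positivity)
          (Finset.mem_powersetCard.1 hF).2
    _ = ∏ i ∈ F, (r i : ℝ) / (1 + r i) := (Finset.prod_div_distrib _ _).symm
    _ ≤ _ := Finset.prod_le_prod (fun i _ => by positivity) fun i _ => div_one_add_le_decay _

/-- The singular factor `1/p_k^n(r)` is split off together with exactly the decay factors that keep
it bounded, and what remains is a kernel controlled in `t`. -/
lemma levyIntegrand_coe {k : ℕ} (hk : k ≤ n) (t : Fin n → ℝ) (r : Fin n → ℝ≥0) :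
    levyIntegrand n k t (fun i => (r i : ℝ)) = ∑ B : Finset (Fin n) with k ≤ B.card,
      (-1 : ℝ) ^ (B.card + k) * (levyWeight k B r * kernelProd B 0 r t) := by
  rw [levyIntegrand, EFun, HFun_eq_sum hk, Finset.mul_sum, Finset.sum_mul]
  refine Finset.sum_congr rfl fun B _ => ?_
  have h1 : ∏ i ∈ B, (Real.exp (-((r i : ℝ) * t i)) - 1) =
      (-1) ^ B.card * ((∏ i ∈ B, decay (r i)) * ∏ i ∈ B, bernKernel 0 (r i) (t i)) := by
    rw [← Finset.prod_mul_distrib, ← Finset.prod_const, ← Finset.prod_mul_distrib]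
    refine Finset.prod_congr rfl fun i _ => ?_
    rw [decay_mul_bernKernel]; ring
  rw [h1, levyWeight, kernelProd_zero, pow_add]
  ring

/-! ### Measures on the closed orthant of `ℝ^n` -/

/-- The inclusion of the closed orthant in `ℝ^n`. -/
def orthantCoe (n : ℕ) (r : Fin n → ℝ≥0) : Fin n → ℝ := fun i => r i

lemma measurableSet_closedOrthant (n : ℕ) : MeasurableSet (closedOrthant n) := by
  have : closedOrthant n = ⋂ i, {t | 0 ≤ t i} := by ext; simp [closedOrthant]
  rw [this]
  exact MeasurableSet.iInter fun i => measurableSet_le measurable_const (measurable_pi_apply i)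

lemma measurableEmbedding_orthantCoe (n : ℕ) : MeasurableEmbedding (orthantCoe n) := by
  refine MeasurableEmbedding.of_measurable_inverse (g := fun t i => (t i).toNNReal) ?_ ?_ ?_ ?_
  · unfold orthantCoe; fun_prop
  · have : Set.range (orthantCoe n) = closedOrthant n := by
      ext t
      refine ⟨?_, fun h => ⟨fun i => ⟨t i, h i⟩, rfl⟩⟩
      rintro ⟨r, rfl⟩ i
      exact NNReal.coe_nonneg _
    rw [this]; exact measurableSet_closedOrthant n
  · fun_prop
  · intro r; funext i; simp [orthantCoe]

/-- The points of the closed orthant with more than `k` positive coordinates. -/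
def manyPositive (n k : ℕ) : Set (Fin n → ℝ≥0) :=
  {r | k < (Finset.univ.filter fun i => 0 < r i).card}

lemma orthantCoe_mem_levyDomain {k : ℕ} {r : Fin n → ℝ≥0} :
    orthantCoe n r ∈ levyDomain n k ↔ r ∈ manyPositive n k := by
  have h1 : orthantCoe n r ∈ closedOrthant n := fun i => NNReal.coe_nonneg _
  have h2 : {i | 0 < orthantCoe n r i} = ((Finset.univ.filter fun i => 0 < r i : Finset (Fin n)) : Set (Fin n)) := by
    ext i; simp [orthantCoe]
  simp only [levyDomain, Set.mem_sdiff, h1, true_and, sparsePoints, Set.mem_ofPred_eq, h2,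
    Set.ncard_coe_finset, manyPositive]
  omega

lemma measurableSet_manyPositive (n k : ℕ) : MeasurableSet (manyPositive n k) := by
  have : manyPositive n k = ⋃ A : Finset (Fin n), ⋃ _ : k < A.card, ⋂ i ∈ A, {r | 0 < r i} := by
    ext r
    simp only [manyPositive, Set.mem_ofPred_eq, Set.mem_iUnion, Set.mem_iInter, exists_prop]
    refine ⟨fun h => ⟨_, h, fun i hi => (Finset.mem_filter.1 hi).2⟩, fun ⟨A, hA, h⟩ =>
      hA.trans_le (Finset.card_le_card fun i hi => ?_)⟩
    simpa using h i hi
  rw [this]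
  exact MeasurableSet.iUnion fun A => MeasurableSet.iUnion fun _ =>
    Finset.measurableSet_biInter _ fun i _ => measurableSet_lt measurable_const (measurable_pi_apply i)

/-- The measure lives on the closed orthant, where taking the nonnegative part of each coordinate
inverts the inclusion. -/
lemma IsLevyMeasure.exists_map {k : ℕ} {η : Measure (Fin n → ℝ)} (h : IsLevyMeasure n k η) :
    ∃ ν : Measure (Fin n → ℝ≥0), IsFiniteMeasure ν ∧ ν (manyPositive n k)ᶜ = 0 ∧
      η = ν.map (orthantCoe n) := by
  have := h.1
  have hm : Measurable fun (t : Fin n → ℝ) (i : Fin n) => (t i).toNNReal := by fun_prop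
  have hmap : (η.map fun (t : Fin n → ℝ) (i : Fin n) => (t i).toNNReal).map (orthantCoe n) = η := by
    rw [Measure.map_map (measurableEmbedding_orthantCoe n).measurable hm]
    have hae : (orthantCoe n ∘ fun (t : Fin n → ℝ) (i : Fin n) => (t i).toNNReal) =ᵐ[η] id := by
      have : ∀ᵐ t ∂η, t ∈ levyDomain n k := by
        rw [ae_iff]; exact h.2
      filter_upwards [this] with t ht
      funext i
      simp [orthantCoe, ht.1 i]
    rw [Measure.map_congr hae, Measure.map_id]
  refine ⟨η.map fun t i => (t i).toNNReal, inferInstance, ?_, hmap.symm⟩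
  rw [← (measurableEmbedding_orthantCoe n).injective.preimage_image (manyPositive n k)ᶜ,
    ← (measurableEmbedding_orthantCoe n).map_apply, hmap]
  refine measure_mono_null ?_ h.2
  rintro _ ⟨r, hr, rfl⟩ hmem
  exact hr (orthantCoe_mem_levyDomain.1 hmem)

lemma isLevyMeasure_map {k : ℕ} {ν : Measure (Fin n → ℝ≥0)} [IsFiniteMeasure ν]
    (h : ν (manyPositive n k)ᶜ = 0) : IsLevyMeasure n k (ν.map (orthantCoe n)) := by
  refine ⟨inferInstance, ?_⟩
  rw [(measurableEmbedding_orthantCoe n).map_apply]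
  refine measure_mono_null (fun r hr => ?_) h
  exact fun h => hr (orthantCoe_mem_levyDomain.2 h)

lemma isFiniteMeasure_weighted_levyWeight {k : ℕ} {B : Finset (Fin n)} (hB : k ≤ B.card)
    (ν : Measure (Fin n → ℝ≥0)) [IsFiniteMeasure ν] :
    IsFiniteMeasure (weighted ν (levyWeight k B)) :=
  isFiniteMeasure_weighted ν (levyWeight_le hB)

lemma integrable_levyWeight_mul_kernelProd {k : ℕ} {B : Finset (Fin n)} (hB : k ≤ B.card)
    (ν : Measure (Fin n → ℝ≥0)) [IsFiniteMeasure ν] {t : Fin n → ℝ} (ht : t ∈ closedOrthant n) :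
    Integrable (fun r => levyWeight k B r * kernelProd B 0 r t) ν := by
  refine (integrable_kernelProd_zero B ν ht).bdd_mul (measurable_levyWeight k B).aestronglyMeasurable
    (c := ∑ A ∈ Finset.powersetCard k (Finset.univ : Finset (Fin n)), ∑ _D ∈ A.powerset, (1 : ℝ))
    (Eventually.of_forall fun r => ?_)
  rw [Real.norm_of_nonneg (levyWeight_nonneg k B r)]
  exact levyWeight_le hB r

lemma restrict_levyDomain {k : ℕ} {η : Measure (Fin n → ℝ)} (h : η (levyDomain n k)ᶜ = 0) :
    η.restrict (levyDomain n k) = η :=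
  Measure.restrict_eq_self_of_ae_mem (by rw [ae_iff]; exact h)

lemma integrableOn_levyIntegrand {k : ℕ} (hk : k ≤ n) {η : Measure (Fin n → ℝ)}
    (h : IsLevyMeasure n k η) {t : Fin n → ℝ} (ht : t ∈ closedOrthant n) :
    IntegrableOn (levyIntegrand n k t) (levyDomain n k) η := by
  rw [IntegrableOn, restrict_levyDomain h.2]
  obtain ⟨ν, hν, -, rfl⟩ := h.exists_map
  rw [(measurableEmbedding_orthantCoe n).integrable_map_iff]
  have : levyIntegrand n k t ∘ orthantCoe n = fun r => ∑ B : Finset (Fin n) with k ≤ B.card,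
      (-1 : ℝ) ^ (B.card + k) * (levyWeight k B r * kernelProd B 0 r t) :=
    funext fun r => levyIntegrand_coe hk t r
  rw [this]
  exact integrable_finsetSum _ fun B hB =>
    (integrable_levyWeight_mul_kernelProd (Finset.mem_filter.1 hB).2 ν ht).const_mul _

lemma setIntegral_levyIntegrand {k : ℕ} (hk : k ≤ n) {ν : Measure (Fin n → ℝ≥0)} [IsFiniteMeasure ν]
    (h : ν (manyPositive n k)ᶜ = 0) {t : Fin n → ℝ} (ht : t ∈ closedOrthant n) :
    ∫ r in levyDomain n k, levyIntegrand n k t r ∂(ν.map (orthantCoe n)) =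
      ∑ B : Finset (Fin n) with k ≤ B.card,
        (-1 : ℝ) ^ (B.card + k) * kernelIntegral B (weighted ν (levyWeight k B)) 0 t := by
  rw [restrict_levyDomain (isLevyMeasure_map h).2, (measurableEmbedding_orthantCoe n).integral_map]
  have : ∀ r, levyIntegrand n k t (orthantCoe n r) = ∑ B : Finset (Fin n) with k ≤ B.card,
      (-1 : ℝ) ^ (B.card + k) * (levyWeight k B r * kernelProd B 0 r t) :=
    fun r => levyIntegrand_coe hk t r
  simp only [this]
  rw [integral_finsetSum _ fun B hB =>
    (integrable_levyWeight_mul_kernelProd (Finset.mem_filter.1 hB).2 ν ht).const_mul _]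
  refine Finset.sum_congr rfl fun B _ => ?_
  rw [integral_const_mul, kernelIntegral,
    integral_weighted _ (measurable_levyWeight k B) (levyWeight_nonneg k B)]

end

noncomputable section

open MeasureTheory Filter Topology NNReal

variable {n : ℕ}

/-! ### Sufficiency -/

/-- A family of functions on the open orthant indexed by multi-indices that is stable under
differentiation. -/
def IsDerivFamily (J : (Fin n → ℕ) → (Fin n → ℝ) → ℝ) : Prop :=
  ∀ α, ∀ t ∈ openOrthant n, HasFDerivAt (J α)
    (∑ i, J (α + Pi.single i 1) t • ContinuousLinearMap.proj (R := ℝ) (φ := fun _ => ℝ) i) t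

lemma IsDerivFamily.add {J K : (Fin n → ℕ) → (Fin n → ℝ) → ℝ} (hJ : IsDerivFamily J)
    (hK : IsDerivFamily K) : IsDerivFamily fun α t => J α t + K α t := fun α t ht => by
  refine ((hJ α t ht).fun_add (hK α t ht)).congr_fderiv ?_
  simp only [add_smul, Finset.sum_add_distrib]

lemma IsDerivFamily.sum {ι : Type*} (s : Finset ι) {J : ι → (Fin n → ℕ) → (Fin n → ℝ) → ℝ}
    (hJ : ∀ b ∈ s, IsDerivFamily (J b)) : IsDerivFamily fun α t => ∑ b ∈ s, J b α t :=
  fun α t ht => by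
    refine (HasFDerivAt.fun_sum fun b hb => hJ b hb α t ht).congr_fderiv ?_
    rw [Finset.sum_comm]
    simp only [Finset.sum_smul]

lemma IsDerivFamily.const_mul {J : (Fin n → ℕ) → (Fin n → ℝ) → ℝ} (hJ : IsDerivFamily J) (c : ℝ) :
    IsDerivFamily fun α t => c * J α t := fun α t ht => by
  refine ((hJ α t ht).const_mul c).congr_fderiv ?_
  simp only [Finset.smul_sum, smul_smul]

lemma isDerivFamily_kernelIntegral (B : Finset (Fin n)) (κ : Measure (Fin n → ℝ≥0))
    [IsFiniteMeasure κ] : IsDerivFamily (kernelIntegral B κ) :=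
  fun α _ ht => hasFDerivAt_kernelIntegral B κ α ht

/-- Every derivative that has to be tested has multi-index `1_F + α`, hence at least `k` nonzero
entries. Stating the sign condition through that number treats all `F` at once. -/
lemma IsDerivFamily.isBernsteinOfOrder {k : ℕ} {J : (Fin n → ℕ) → (Fin n → ℝ) → ℝ}
    (hJ : IsDerivFamily J)
    (hsign : ∀ β : Fin n → ℕ, k ≤ (Finset.univ.filter fun i => β i ≠ 0).card →
      ∀ t ∈ openOrthant n, 0 ≤ (-1 : ℝ) ^ (∑ i, β i + k) * J β t)
    {g : (Fin n → ℝ) → ℝ} (hg : Set.EqOn g (J 0) (openOrthant n)) : IsBernsteinOfOrder k g := by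
  have hU := isOpen_openOrthant n
  have hsmooth := contDiffOn_of_hasFDerivAt_family hU J hJ
  have hgs : ContDiffOn ℝ ∞ g (openOrthant n) := (hsmooth 0).congr hg
  have hgJ : ∀ β, Set.EqOn (multiDeriv β g) (J β) (openOrthant n) := fun β =>
    (multiDeriv_congr hU hg β).trans (multiDeriv_of_hasFDerivAt_family hU J hJ β)
  refine ⟨hgs, fun F hF => ⟨(hsmooth _).congr (hgJ _), fun α t ht => ?_⟩⟩
  rw [multiDeriv_multiDeriv hU hgs _ _ ht, hgJ _ ht]
  have h := hsign (indicatorIndex F + α) (by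
    rw [← hF]
    refine Finset.card_le_card fun i hi => ?_
    simp [indicatorIndex, hi]) t ht
  convert h using 2
  simp only [Pi.add_apply, Finset.sum_add_distrib, sum_indicatorIndex]
  rw [show F.card + ∑ i, α i + k = ∑ i, α i + 2 * k by rw [hF]; ring, pow_add, pow_mul]
  simp

lemma neg_one_pow_mul_bernKernel_nonneg {a : ℕ} (ha : a ≠ 0) (r : ℝ≥0) (s : ℝ) :
    0 ≤ (-1 : ℝ) ^ (a + 1) * bernKernel a r s := by
  obtain ⟨b, rfl⟩ := Nat.exists_eq_succ_of_ne_zero ha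
  have h1 : 0 ≤ (if r = 0 then (1 : ℝ) else (r : ℝ) / decay r) := by
    split_ifs
    · exact zero_le_one
    · exact div_nonneg r.2 (decay_nonneg r)
  have h2 : (-1 : ℝ) ^ (b.succ + 1) * bernKernel b.succ r s =
      (if r = 0 then (1 : ℝ) else (r : ℝ) / decay r) * ((r : ℝ) ^ b * Real.exp (-((r : ℝ) * s))) := by
    have h3 : (-1 : ℝ) ^ (b + 2) * (-(r : ℝ)) ^ b = (r : ℝ) ^ b := by
      have h4 : (-1 : ℝ) ^ b * (-1) ^ b = 1 := by rw [← mul_pow]; simp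
      rw [pow_add, neg_pow (r : ℝ)]
      linear_combination (r : ℝ) ^ b * h4
    simp only [bernKernel, Nat.succ_eq_add_one]
    rw [← h3]; ring
  rw [h2]
  positivity

/-- Either the support of `β` is exactly `F`, and each kernel contributes the sign `(-1)^{β_i + 1}`,
or `β` differentiates a variable outside `F`, on which the product does not depend. -/
lemma neg_one_pow_mul_kernelProd_nonneg {k : ℕ} {F : Finset (Fin n)} (hF : F.card = k)
    {β : Fin n → ℕ} (hβ : k ≤ (Finset.univ.filter fun i => β i ≠ 0).card) (r : Fin n → ℝ≥0)
    (t : Fin n → ℝ) : 0 ≤ (-1 : ℝ) ^ (∑ i, β i + k) * kernelProd F β r t := by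
  by_cases hsub : (Finset.univ.filter fun i => β i ≠ 0) ⊆ F
  · have heq := Finset.eq_of_subset_of_card_le hsub (hF ▸ hβ)
    have h0 : ∀ i, i ∈ F ↔ β i ≠ 0 := fun i => by rw [← heq]; simp
    have h1 : (-1 : ℝ) ^ (∑ i, β i + k) = ∏ i, if i ∈ F then (-1 : ℝ) ^ (β i + 1) else 1 := by
      rw [Finset.prod_ite_mem, Finset.univ_inter, Finset.prod_pow_eq_pow_sum,
        Finset.sum_add_distrib, Finset.sum_const, smul_eq_mul, mul_one, hF]
      congr 2
      refine (Finset.sum_subset (Finset.subset_univ F) fun i _ hi => ?_).symm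
      exact not_not.1 fun h => hi ((h0 i).2 h)
    rw [h1, kernelProd, ← Finset.prod_mul_distrib]
    refine Finset.prod_nonneg fun i _ => ?_
    by_cases hi : i ∈ F
    · simp only [hi, if_true]
      exact neg_one_pow_mul_bernKernel_nonneg ((h0 i).1 hi) _ _
    · simp only [hi, if_false, one_mul]
      split_ifs <;> simp
  · obtain ⟨i, hi, hiF⟩ := Finset.not_subset.1 hsub
    have : kernelProd F β r t = 0 := by
      refine Finset.prod_eq_zero (Finset.mem_univ i) ?_
      rw [if_neg hiF, if_neg (Finset.mem_filter.1 hi).2]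
    rw [this, mul_zero]

lemma isBernsteinOfOrder_kernelIntegral_univ {k : ℕ} (κ : Measure (Fin k → ℝ≥0))
    [IsFiniteMeasure κ] : IsBernsteinOfOrder k (kernelIntegral Finset.univ κ 0) := by
  refine (isDerivFamily_kernelIntegral Finset.univ κ).isBernsteinOfOrder (fun β hβ t ht => ?_)
    fun _ _ => rfl
  rw [kernelIntegral, ← integral_const_mul]
  exact integral_nonneg fun r => neg_one_pow_mul_kernelProd_nonneg (Finset.card_fin k) hβ r t

/-- If `|B| < k`, some differentiated variable lies outside `B` and the term is zero, so the sum may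
run over all `B` and factorises. Each factor is the derivative of order `β_i` of `1 - (1 - e^{-r_i
t_i}) = e^{-r_i t_i}`. -/
lemma sum_prod_decay_mul_kernelProd {k : ℕ} {β : Fin n → ℕ}
    (hβ : k ≤ (Finset.univ.filter fun i => β i ≠ 0).card) (r : Fin n → ℝ≥0) (t : Fin n → ℝ) :
    ∑ B : Finset (Fin n) with k ≤ B.card,
      (-1 : ℝ) ^ B.card * ((∏ i ∈ B, decay (r i)) * kernelProd B β r t) =
    (-1) ^ (∑ i, β i) * ∏ i, (r i : ℝ) ^ β i * Real.exp (-((r i : ℝ) * t i)) := by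
  let a : Fin n → ℝ := fun i => decay (r i) * bernKernel (β i) (r i) (t i)
  let b : Fin n → ℝ := fun i => if β i = 0 then 1 else 0
  have h1 : ∀ B : Finset (Fin n), (-1 : ℝ) ^ B.card * ((∏ i ∈ B, decay (r i)) * kernelProd B β r t) =
      (∏ i ∈ B, -a i) * ∏ i ∈ Finset.univ \ B, b i := by
    intro B
    have h2 : kernelProd B β r t =
        (∏ i ∈ B, bernKernel (β i) (r i) (t i)) * ∏ i ∈ Finset.univ \ B, b i := by
      rw [kernelProd, ← Finset.prod_sdiff (Finset.subset_univ B), mul_comm]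
      congr 1
      · exact Finset.prod_congr rfl fun i hi => if_pos hi
      · exact Finset.prod_congr rfl fun i hi => if_neg (Finset.mem_sdiff.1 hi).2
    rw [h2, Finset.prod_neg, Finset.prod_mul_distrib]
    ring
  simp only [h1]
  rw [Finset.sum_filter_of_ne]
  · rw [← Finset.powerset_univ, ← Finset.prod_add, ← Finset.prod_pow_eq_pow_sum,
      ← Finset.prod_mul_distrib]
    refine Finset.prod_congr rfl fun i _ => ?_
    simp only [a, b]
    rcases h : β i with _ | c
    · rw [decay_mul_bernKernel]; simp
    · rw [decay_mul_bernKernel_succ, if_neg (Nat.succ_ne_zero c), neg_pow (r i : ℝ)]; ring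
  · intro B _ hB
    by_contra hlt
    refine hB (mul_eq_zero_of_right _ ?_)
    have : ¬ (Finset.univ.filter fun i => β i ≠ 0) ⊆ B := fun h =>
      hlt (hβ.trans (Finset.card_le_card h))
    obtain ⟨i, hi, hiB⟩ := Finset.not_subset.1 this
    exact Finset.prod_eq_zero (i := i) (by simp [hiB]) (if_neg (Finset.mem_filter.1 hi).2)

/-- The coefficients of the terms alternate with `|B|`, so positivity is sought only after all of
them are combined under one integral, where they collapse to the derivative of a single exponential.
-/
lemma levy_sign {k : ℕ} {β : Fin n → ℕ} (hβ : k ≤ (Finset.univ.filter fun i => β i ≠ 0).card)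
    (ν : Measure (Fin n → ℝ≥0)) [IsFiniteMeasure ν] {t : Fin n → ℝ} (ht : t ∈ openOrthant n) :
    0 ≤ (-1 : ℝ) ^ (∑ i, β i + k) * ∑ B : Finset (Fin n) with k ≤ B.card,
      (-1 : ℝ) ^ (B.card + k) * kernelIntegral B (weighted ν (levyWeight k B)) β t := by
  have h1 : ∀ B : Finset (Fin n), kernelIntegral B (weighted ν (levyWeight k B)) β t =
      ∫ r, levyWeight k B r * kernelProd B β r t ∂ν := fun B => by
    rw [kernelIntegral, integral_weighted _ (measurable_levyWeight k B) (levyWeight_nonneg k B)]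
  simp only [h1, ← integral_const_mul]
  rw [← integral_finsetSum]
  · rw [← integral_const_mul]
    refine integral_nonneg fun r => ?_
    have h2 : ∑ B : Finset (Fin n) with k ≤ B.card,
        (-1 : ℝ) ^ (B.card + k) * (levyWeight k B r * kernelProd B β r t) =
        (-1) ^ k * (elemSymm n k (fun i => 1 + (r i : ℝ)) / elemSymm n k (fun i => (r i : ℝ))) *
          ((-1) ^ (∑ i, β i) * ∏ i, (r i : ℝ) ^ β i * Real.exp (-((r i : ℝ) * t i))) := by
      rw [← sum_prod_decay_mul_kernelProd hβ, Finset.mul_sum]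
      refine Finset.sum_congr rfl fun B _ => ?_
      rw [levyWeight, pow_add]; ring
    simp only [Pi.zero_apply, h2]
    have h3 : ∀ m : ℕ, (-1 : ℝ) ^ m * (-1) ^ m = 1 := fun m => by
      rw [← mul_pow]; simp
    have h4 : ∀ x y : ℝ, (-1 : ℝ) ^ (∑ i, β i + k) * ((-1) ^ k * x * ((-1) ^ (∑ i, β i) * y)) = x * y := by
      intro x y
      rw [pow_add]
      linear_combination (x * y * ((-1 : ℝ) ^ k * (-1) ^ k)) * h3 (∑ i, β i) + x * y * h3 k
    rw [h4]
    exact mul_nonneg (div_nonneg (elemSymm_nonneg _ fun _ => by positivity)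
      (elemSymm_nonneg _ fun _ => by positivity)) (Finset.prod_nonneg fun i _ => by positivity)
  · intro B hB
    refine Integrable.const_mul ?_ _
    refine (integrable_kernelProd B ν β ht).bdd_mul (measurable_levyWeight k B).aestronglyMeasurable
      (c := ∑ A ∈ Finset.powersetCard k (Finset.univ : Finset (Fin n)), ∑ _D ∈ A.powerset, (1 : ℝ))
      (Eventually.of_forall fun r => ?_)
    rw [Real.norm_of_nonneg (levyWeight_nonneg k B r)]
    exact levyWeight_le (Finset.mem_filter.1 hB).2 r

/-- A Bernstein function of order `k` in `k` variables, vanishing on the boundary, is an integral of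
products of kernels. -/
lemma exists_kernelIntegral_univ {k : ℕ} {ψ : (Fin k → ℝ) → ℝ}
    (hc : ContinuousOn ψ (closedOrthant k)) (hψ : IsBernsteinOfOrder k ψ)
    (h0 : ∀ u ∈ sparsePoints k k, ψ u = 0) :
    ∃ κ : Measure (Fin k → ℝ≥0), IsFiniteMeasure κ ∧
      ∀ u ∈ closedOrthant k, ψ u = kernelIntegral Finset.univ κ 0 u := by
  obtain ⟨κ, hκ, h⟩ := (hψ.hasAlternatingDerivs (Finset.card_fin k)).exists_measure hc
  refine ⟨κ, hκ, fun u hu => ?_⟩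
  have h1 := restrictOrthant_eq_sum_diffOp h0 (fun i => ⟨u i, hu i⟩)
  -- In `k` variables only the full set has `k` elements, so the expansion of `ψ` has a single term.
  have h2 : (Finset.univ.filter fun B : Finset (Fin k) => k ≤ B.card) = {Finset.univ} := by
    ext B
    simp only [Finset.mem_filter, Finset.mem_univ, true_and, Finset.mem_singleton]
    refine ⟨fun h => Finset.eq_univ_of_card _ ?_, fun h => by simp [h]⟩
    have := Finset.card_le_univ B
    simp only [Fintype.card_fin] at this ⊢
    omega
  have h3 := h (fun i => ⟨u i, hu i⟩) 1
  rw [h2, Finset.sum_singleton] at h1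
  rw [mul_one] at h3
  rw [h3] at h1
  simp only [map_one, mul_one] at h1
  exact h1

lemma prod_orderEmbOfFin {M : Type*} [CommMonoid M] {k : ℕ} (F : {F : Finset (Fin n) // F.card = k})
    (f : Fin n → M) : ∏ j, f (F.1.orderEmbOfFin F.2 j) = ∏ i ∈ F.1, f i := by
  conv_rhs => rw [← Finset.map_orderEmbOfFin_univ F.1 F.2]
  rw [Finset.prod_map]
  rfl

lemma measurable_extend {k : ℕ} (e : Fin k → Fin n) :
    Measurable fun ρ : Fin k → ℝ≥0 => Function.extend e ρ (0 : Fin n → ℝ≥0) := by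
  refine measurable_pi_lambda _ fun i => ?_
  classical
  by_cases h : ∃ j, e j = i
  · simp only [Function.extend_def, h, dif_pos]
    exact measurable_pi_apply _
  · simp only [Function.extend_def, h, dif_neg, not_false_eq_true]
    exact measurable_const

/-- Extending frequencies by zero outside `F` turns a function of the `k` variables `t_F` into a
kernel integral in `n` variables, to which the results on derivative families apply. -/
lemma kernelIntegral_subvector {k : ℕ} (F : {F : Finset (Fin n) // F.card = k})
    (κ : Measure (Fin k → ℝ≥0)) (t : Fin n → ℝ) :
    kernelIntegral Finset.univ κ 0 (subvector F t) = kernelIntegral F.1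
      (κ.map fun ρ => Function.extend (F.1.orderEmbOfFin F.2) ρ (0 : Fin n → ℝ≥0)) 0 t := by
  rw [kernelIntegral, kernelIntegral, integral_map (measurable_extend _).aemeasurable
    (measurable_kernelProd _ _ _).aestronglyMeasurable]
  refine integral_congr_ae (Eventually.of_forall fun ρ => ?_)
  simp only [kernelProd_zero]
  rw [← prod_orderEmbOfFin F]
  refine Finset.prod_congr rfl fun j _ => ?_
  rw [(F.1.orderEmbOfFin F.2).injective.extend_apply]
  rfl

lemma subvector_mem_closedOrthant {k : ℕ} (F : {F : Finset (Fin n) // F.card = k}) {t : Fin n → ℝ}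
    (ht : t ∈ closedOrthant n) : subvector F t ∈ closedOrthant k := fun _ => ht _

lemma openOrthant_subset_closedOrthant : openOrthant n ⊆ closedOrthant n :=
  fun _ ht i => (ht i).le

/-- Both parts of the representation are finite combinations of kernel integrals, so all derivatives
of `g` are explicit. The sign condition is checked separately for each `ψ^F` and for the whole
integral. -/
theorem IsBernsteinRepresentation.isBernsteinOfOrder {k : ℕ} (hk : k ≤ n) {g : (Fin n → ℝ) → ℝ}
    {ψ : {F : Finset (Fin n) // F.card = k} → (Fin k → ℝ) → ℝ} {η : Measure (Fin n → ℝ)}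
    (h : IsBernsteinRepresentation k g ψ η) : IsBernsteinOfOrder k g := by
  obtain ⟨hψ, hη, hg⟩ := h
  choose κ hκ hψκ using fun F => exists_kernelIntegral_univ (hψ F).1 (hψ F).2.1 (hψ F).2.2
  obtain ⟨ν, hν, hν0, rfl⟩ := hη.exists_map
  have hfin : ∀ B : Finset (Fin n), B ∈ (Finset.univ.filter fun B : Finset (Fin n) => k ≤ B.card) →
      IsFiniteMeasure (weighted ν (levyWeight k B)) := fun B hB =>
    isFiniteMeasure_weighted_levyWeight (Finset.mem_filter.1 hB).2 ν
  have hJ1 := IsDerivFamily.sum (Finset.univ : Finset {F : Finset (Fin n) // F.card = k})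
    (J := fun F => kernelIntegral F.1
      ((κ F).map fun ρ => Function.extend (F.1.orderEmbOfFin F.2) ρ (0 : Fin n → ℝ≥0)))
    fun F _ => by
      have := hκ F
      exact isDerivFamily_kernelIntegral _ _
  have hJ2 := IsDerivFamily.sum (Finset.univ.filter fun B : Finset (Fin n) => k ≤ B.card)
    (J := fun B α t => (-1 : ℝ) ^ (B.card + k) * kernelIntegral B (weighted ν (levyWeight k B)) α t)
    fun B hB => by
      have := hfin B hB
      exact (isDerivFamily_kernelIntegral _ _).const_mul _
  refine (hJ1.add hJ2).isBernsteinOfOrder (fun β hβ t ht => ?_) fun t ht => ?_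
  · rw [mul_add, Finset.mul_sum]
    refine add_nonneg (Finset.sum_nonneg fun F _ => ?_) (levy_sign hβ ν ht)
    rw [kernelIntegral, ← integral_const_mul]
    exact integral_nonneg fun r => neg_one_pow_mul_kernelProd_nonneg F.2 hβ r t
  · have ht' := openOrthant_subset_closedOrthant ht
    rw [hg t ht', setIntegral_levyIntegrand hk hν0 ht']
    congr 1
    refine Finset.sum_congr rfl fun F _ => ?_
    rw [hψκ F _ (subvector_mem_closedOrthant F ht'), kernelIntegral_subvector]

/-! ### Uniqueness -/

lemma shiftFunctional_eq (Q : ShiftAlgebra n →ₗ[ℝ] ℝ) {f : (Fin n → ℝ≥0) → ℝ}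
    (h : ∀ t, f t = Q (shift t)) (P : ShiftAlgebra n) : shiftFunctional f P = Q P := by
  induction P using shiftAlgebra_induction with
  | zero => simp
  | add P Q' hP hQ => rw [map_add, map_add, hP, hQ]
  | smul c t => rw [map_smul, map_smul, shiftFunctional_shift, h]

lemma integrable_shiftFunctional {E : Type*} [MeasurableSpace E] {ν : Measure E}
    {φ : E → (Fin n → ℝ≥0) → ℝ} (hφ : ∀ t, Integrable (fun r => φ r t) ν) (P : ShiftAlgebra n) :
    Integrable (fun r => shiftFunctional (φ r) P) ν ∧
      shiftFunctional (fun t => ∫ r, φ r t ∂ν) P = ∫ r, shiftFunctional (φ r) P ∂ν := by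
  induction P using shiftAlgebra_induction with
  | zero => simp
  | add P Q hP hQ =>
    simp only [map_add]
    refine ⟨hP.1.add hQ.1, ?_⟩
    rw [integral_add hP.1 hQ.1, hP.2, hQ.2]
  | smul c t =>
    simp only [map_smul, shiftFunctional_shift, smul_eq_mul]
    exact ⟨(hφ t).const_mul c, (integral_const_mul _ _).symm⟩

lemma shiftFunctional_add (f g : (Fin n → ℝ≥0) → ℝ) (P : ShiftAlgebra n) :
    shiftFunctional (fun t => f t + g t) P = shiftFunctional f P + shiftFunctional g P :=
  shiftFunctional_eq (shiftFunctional f + shiftFunctional g) (by simp) P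

lemma shiftFunctional_sum {ι : Type*} (s : Finset ι) (f : ι → (Fin n → ℝ≥0) → ℝ)
    (P : ShiftAlgebra n) :
    shiftFunctional (fun t => ∑ b ∈ s, f b t) P = ∑ b ∈ s, shiftFunctional (f b) P := by
  rw [shiftFunctional_eq (∑ b ∈ s, shiftFunctional (f b)) (by simp [LinearMap.sum_apply]) P,
    LinearMap.sum_apply]

/-- The factor of the difference operator in direction `i` annihilates a function independent of
that coordinate. -/
lemma shiftFunctional_diffOp_mul_eq_zero {f : (Fin n → ℝ≥0) → ℝ} {i : Fin n} {B : Finset (Fin n)}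
    (hi : i ∈ B) (hf : ∀ t c, f (t + Pi.single i c) = f t) (c : Fin n → ℝ≥0) (P : ShiftAlgebra n) :
    shiftFunctional f (diffOp B c * P) = 0 := by
  have h1 : diffOp B c * P = (diffOp (B.erase i) c * P) * axisShift i (c i) -
      diffOp (B.erase i) c * P := by
    rw [diffOp, ← Finset.mul_prod_erase _ _ hi, diffOp]; ring
  rw [h1, map_sub, axisShift, shiftFunctional_mul_shift]
  simp only [hf, sub_self]

/-- Each monomial of the exponentials is again a character, with the frequencies outside `A`
replaced by zero. This makes the action of difference operators immediate. -/
lemma HFun_exp (k : ℕ) (r t : Fin n → ℝ≥0) :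
    HFun n k (fun i => Real.exp (-((r i : ℝ) * t i))) =
      laplaceChar r (shift t) + ∑ j ∈ Finset.range k,
        (-1 : ℝ) ^ (k - j) * ((n - j - 1).choose (n - k) : ℝ) *
          ∑ A ∈ Finset.powersetCard j Finset.univ, laplaceChar (truncate A r) (shift t) := by
  have h1 : ∀ A : Finset (Fin n), ∏ i ∈ A, Real.exp (-((r i : ℝ) * t i)) =
      laplaceChar (truncate A r) (shift t) := by
    intro A
    rw [laplaceChar_shift, ← Finset.prod_subset (Finset.subset_univ A)]
    · exact Finset.prod_congr rfl fun i hi => by simp [truncate, hi]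
    · intro i _ hi; simp [truncate, hi]
  have h2 : elemSymm n n (fun i => Real.exp (-((r i : ℝ) * t i))) = laplaceChar r (shift t) := by
    rw [elemSymm_eq_sum]
    have : Finset.powersetCard n (Finset.univ : Finset (Fin n)) = {Finset.univ} := by
      simpa using Finset.powersetCard_self (Finset.univ : Finset (Fin n))
    rw [this, Finset.sum_singleton, laplaceChar_shift]
  rw [HFun, h2]
  simp only [elemSymm_eq_sum, h1]

/-- The lower terms are characters with fewer than `k` active frequencies; some direction of `B` is
inactive, so its difference kills them. The remaining sign is `(-1)^k (-1)^{k+1}`. -/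
lemma shiftFunctional_levyIntegrand {k : ℕ} {B : Finset (Fin n)} (hB : B.card = k + 1)
    (r t : Fin n → ℝ≥0) :
    shiftFunctional (fun s => levyIntegrand n k (orthantCoe n s) (orthantCoe n r))
      (diffOp B (fun _ => 1) * shift t) = -(levyWeight k B r * laplaceChar r (shift t)) := by
  set W := elemSymm n k (fun i => 1 + (r i : ℝ)) / elemSymm n k (fun i => (r i : ℝ)) with hW
  rw [shiftFunctional_eq (((-1 : ℝ) ^ k * W) • ((laplaceChar r).toLinearMap +
    ∑ j ∈ Finset.range k, ((-1 : ℝ) ^ (k - j) * ((n - j - 1).choose (n - k) : ℝ)) •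
      ∑ A ∈ Finset.powersetCard j Finset.univ, (laplaceChar (truncate A r)).toLinearMap))]
  · simp only [LinearMap.smul_apply, LinearMap.add_apply, LinearMap.sum_apply,
      AlgHom.toLinearMap_apply, map_mul, smul_eq_mul]
    rw [Finset.sum_eq_zero, add_zero, laplaceChar_diffOp, levyWeight, ← hW]
    · have h1 : ∏ i ∈ B, (Real.exp (-((r i : ℝ) * ((1 : ℝ≥0) : ℝ))) - 1) =
          (-1) ^ (k + 1) * ∏ i ∈ B, decay (r i) := by
        rw [← hB, ← Finset.prod_const, ← Finset.prod_mul_distrib]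
        refine Finset.prod_congr rfl fun i _ => ?_
        simp [decay]
      have h3 : (-1 : ℝ) ^ k * (-1) ^ k = 1 := by rw [← mul_pow]; simp
      rw [h1, pow_succ]
      linear_combination (-W * (∏ i ∈ B, decay (r i)) * laplaceChar r (shift t)) * h3
    · intro j hj
      refine mul_eq_zero_of_right _ (Finset.sum_eq_zero fun A hA => mul_eq_zero_of_left ?_ _)
      have hcard := (Finset.mem_powersetCard.1 hA).2
      have hj' := Finset.mem_range.1 hj
      have : ¬ B ⊆ A := fun h => by have := Finset.card_le_card h; omega
      obtain ⟨i, hi, hiA⟩ := Finset.not_subset.1 this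
      rw [laplaceChar_diffOp]
      exact Finset.prod_eq_zero hi (by simp [truncate, hiA])
  · intro s
    simp only [levyIntegrand, EFun, orthantCoe, LinearMap.smul_apply, LinearMap.add_apply,
      LinearMap.sum_apply, AlgHom.toLinearMap_apply, smul_eq_mul, HFun_exp]
    rw [hW, show orthantCoe n r = fun i => (r i : ℝ) from rfl]
    ring

lemma orthantCoe_mem_closedOrthant (s : Fin n → ℝ≥0) : orthantCoe n s ∈ closedOrthant n :=
  fun _ => NNReal.coe_nonneg _

/-- The size `k + 1` is chosen so that `B` is contained in no `F` of size `k`: every `ψ^F` is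
independent of some direction of `B` and disappears, leaving a quantity that depends on `η` only. -/
lemma IsBernsteinRepresentation.shiftFunctional_diffOp {k : ℕ} (hk : k ≤ n) {g : (Fin n → ℝ) → ℝ}
    {ψ : {F : Finset (Fin n) // F.card = k} → (Fin k → ℝ) → ℝ} {ν : Measure (Fin n → ℝ≥0)}
    [IsFiniteMeasure ν] (h : IsBernsteinRepresentation k g ψ (ν.map (orthantCoe n)))
    {B : Finset (Fin n)} (hB : B.card = k + 1) (t : Fin n → ℝ≥0) :
    shiftFunctional (restrictOrthant g) (diffOp B (fun _ => 1) * shift t) =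
      -∫ r, levyWeight k B r * laplaceChar r (shift t) ∂ν := by
  have hI : ∀ s : Fin n → ℝ≥0, Integrable
      (fun r => levyIntegrand n k (orthantCoe n s) (orthantCoe n r)) ν := by
    intro s
    have := integrableOn_levyIntegrand hk h.2.1 (orthantCoe_mem_closedOrthant s)
    rw [IntegrableOn, restrict_levyDomain h.2.1.2,
      (measurableEmbedding_orthantCoe n).integrable_map_iff] at this
    exact this
  have hg : restrictOrthant g = fun s => (∑ F, ψ F (subvector F (orthantCoe n s))) +
      ∫ r, levyIntegrand n k (orthantCoe n s) (orthantCoe n r) ∂ν := by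
    funext s
    rw [restrictOrthant]
    change g (orthantCoe n s) = _
    rw [h.2.2 _ (orthantCoe_mem_closedOrthant s), restrict_levyDomain h.2.1.2,
      (measurableEmbedding_orthantCoe n).integral_map]
  rw [hg, shiftFunctional_add, shiftFunctional_sum, Finset.sum_eq_zero, zero_add,
    (integrable_shiftFunctional hI _).2]
  · simp only [shiftFunctional_levyIntegrand hB, integral_neg]
  · intro F _
    have : ¬ B ⊆ F.1 := fun h => by
      have := Finset.card_le_card h
      have := F.2
      omega
    obtain ⟨i, hi, hiF⟩ := Finset.not_subset.1 this
    refine shiftFunctional_diffOp_mul_eq_zero hi (fun s c => ?_) _ _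
    congr 1
    funext j
    have hne : F.1.orderEmbOfFin F.2 j ≠ i := fun h => hiF (h ▸ F.1.orderEmbOfFin_mem F.2 j)
    simp [subvector, orthantCoe, hne]

lemma weighted_one {E : Type*} [MeasurableSpace E] (μ : Measure E) {w : E → ℝ}
    (h : ∀ᵐ x ∂μ, w x = 1) : weighted μ w = μ := by
  have : weighted μ w = μ.withDensity 1 := withDensity_congr_ae (by
    filter_upwards [h] with x hx; simp [hx])
  rw [this, withDensity_one]

lemma levyWeight_pos {k : ℕ} {r : Fin n → ℝ≥0} (hr : r ∈ manyPositive n k) :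
    0 < ∑ B ∈ Finset.powersetCard (k + 1) Finset.univ, levyWeight k B r := by
  obtain ⟨B, hB, hcard⟩ := Finset.exists_subset_card_eq (Nat.succ_le_of_lt hr)
  have h1 : 0 < elemSymm n k (fun i => (r i : ℝ)) := by
    rw [elemSymm_pos_iff fun i => NNReal.coe_nonneg _]
    have : k < (Finset.univ.filter fun i => 0 < r i).card := hr
    simpa using this.le
  have h2 : 0 < elemSymm n k (fun i => 1 + (r i : ℝ)) := by
    rw [elemSymm_pos_iff fun i => by positivity]
    have : (Finset.univ.filter fun i : Fin n => 0 < 1 + (r i : ℝ)) = Finset.univ :=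
      Finset.filter_true_of_mem fun i _ => by positivity
    rw [this, Finset.card_univ]
    have h3 := Finset.card_le_univ B
    rw [Fintype.card_fin] at h3 ⊢
    omega
  refine Finset.sum_pos' (fun B _ => levyWeight_nonneg k B r)
    ⟨B, Finset.mem_powersetCard.2 ⟨Finset.subset_univ _, hcard⟩, mul_pos (div_pos h2 h1) ?_⟩
  exact Finset.prod_pos fun i hi => decay_pos.2 (Finset.mem_filter.1 (hB hi)).2

/-- Laplace transforms of the weighted measures coincide for each `B` of size `k + 1`. One such
weight may vanish on part of the domain, but their sum is bounded and strictly positive there, so it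
can be divided out. -/
theorem IsBernsteinRepresentation.measure_unique {k : ℕ} (hk : k ≤ n) {g : (Fin n → ℝ) → ℝ}
    {ψ ψ' : {F : Finset (Fin n) // F.card = k} → (Fin k → ℝ) → ℝ} {η η' : Measure (Fin n → ℝ)}
    (h : IsBernsteinRepresentation k g ψ η) (h' : IsBernsteinRepresentation k g ψ' η') : η = η' := by
  obtain ⟨ν, hν, hν0, rfl⟩ := h.2.1.exists_map
  obtain ⟨ν', hν', hν0', rfl⟩ := h'.2.1.exists_map
  congr 1
  let w : (Fin n → ℝ≥0) → ℝ := fun r =>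
    ∑ B ∈ Finset.powersetCard (k + 1) Finset.univ, levyWeight k B r
  have hw : Measurable w := Finset.measurable_sum _ fun B _ => measurable_levyWeight k B
  have hw0 : ∀ r, 0 ≤ w r := fun r => Finset.sum_nonneg fun B _ => levyWeight_nonneg k B r
  have hcard : ∀ B ∈ Finset.powersetCard (k + 1) (Finset.univ : Finset (Fin n)), k ≤ B.card :=
    fun B hB => by rw [(Finset.mem_powersetCard.1 hB).2]; omega
  have hwC : ∀ r, w r ≤ ∑ B ∈ Finset.powersetCard (k + 1) (Finset.univ : Finset (Fin n)),
      ∑ A ∈ Finset.powersetCard k (Finset.univ : Finset (Fin n)), ∑ _D ∈ A.powerset, (1 : ℝ) :=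
    fun r => Finset.sum_le_sum fun B hB => levyWeight_le (hcard B hB) r
  have hchar : ∀ (ν : Measure (Fin n → ℝ≥0)) [IsFiniteMeasure ν] (t : Fin n → ℝ≥0),
      ∫ r, laplaceChar r (shift t) ∂(weighted ν w) =
        ∑ B ∈ Finset.powersetCard (k + 1) Finset.univ,
          ∫ r, levyWeight k B r * laplaceChar r (shift t) ∂ν := by
    intro ν _ t
    rw [integral_weighted _ hw hw0]
    simp only [w, Finset.sum_mul]
    refine integral_finsetSum _ fun B hB => ?_
    refine (integrable_laplaceChar ν _).bdd_mul (measurable_levyWeight k B).aestronglyMeasurable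
      (c := ∑ A ∈ Finset.powersetCard k (Finset.univ : Finset (Fin n)), ∑ _D ∈ A.powerset, (1 : ℝ))
      (Eventually.of_forall fun r => ?_)
    rw [Real.norm_of_nonneg (levyWeight_nonneg k B r)]
    exact levyWeight_le (hcard B hB) r
  have hf := isFiniteMeasure_weighted ν hwC
  have hf' := isFiniteMeasure_weighted ν' hwC
  have heq : weighted ν w = weighted ν' w := by
    refine measure_ext_of_laplaceChar fun t => ?_
    rw [hchar, hchar]
    refine Finset.sum_congr rfl fun B hB => ?_
    have h1 := h.shiftFunctional_diffOp hk (Finset.mem_powersetCard.1 hB).2 t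
    have h2 := h'.shiftFunctional_diffOp hk (Finset.mem_powersetCard.1 hB).2 t
    linarith
  have hinv : ∀ (ν : Measure (Fin n → ℝ≥0)), ν (manyPositive n k)ᶜ = 0 →
      weighted (weighted ν w) (fun r => (w r)⁻¹) = ν := by
    intro ν hν
    rw [weighted_weighted _ hw (v := fun r => (w r)⁻¹) hw.inv hw0]
    refine weighted_one _ ?_
    have : ∀ᵐ r ∂ν, r ∈ manyPositive n k := by rw [ae_iff]; exact hν
    filter_upwards [this] with r hr
    exact mul_inv_cancel₀ (levyWeight_pos hr).ne'
  rw [← hinv ν hν0, heq, hinv ν' hν0']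

/-- At a point supported in `F`, any other `F'` of the same size sees a zero coordinate, so only
`ψ^F` survives in the sum; the integrals agree because the measure is common. -/
theorem IsBernsteinRepresentation.functions_unique {k : ℕ} {g : (Fin n → ℝ) → ℝ}
    {ψ ψ' : {F : Finset (Fin n) // F.card = k} → (Fin k → ℝ) → ℝ} {η : Measure (Fin n → ℝ)}
    (h : IsBernsteinRepresentation k g ψ η) (h' : IsBernsteinRepresentation k g ψ' η)
    (F : {F : Finset (Fin n) // F.card = k}) : Set.EqOn (ψ F) (ψ' F) (closedOrthant k) := by
  intro u hu
  let t : Fin n → ℝ := Function.extend (F.1.orderEmbOfFin F.2) u 0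
  have hinj := (F.1.orderEmbOfFin F.2).injective
  have htF : ∀ i, i ∉ F.1 → t i = 0 := by
    intro i hi
    refine Function.extend_apply' _ _ _ ?_
    rintro ⟨j, rfl⟩
    exact hi (F.1.orderEmbOfFin_mem F.2 j)
  have htu : subvector F t = u := funext fun j => hinj.extend_apply u 0 j
  have ht : t ∈ closedOrthant n := by
    intro i
    by_cases hi : i ∈ F.1
    · have : i ∈ Set.range (F.1.orderEmbOfFin F.2) := by
        rw [Finset.range_orderEmbOfFin]; exact hi
      obtain ⟨j, rfl⟩ := this
      have := hu j
      rwa [← htu] at this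
    · rw [htF i hi]
  have hsum : ∀ {ψ : {F : Finset (Fin n) // F.card = k} → (Fin k → ℝ) → ℝ}
      (_ : IsBernsteinRepresentation k g ψ η), ∑ F', ψ F' (subvector F' t) = ψ F u := by
    intro ψ h
    rw [Finset.sum_eq_single F, htu]
    · intro F' _ hne
      refine (h.1 F').2.2 _ ⟨subvector_mem_closedOrthant F' ht, ?_⟩
      have : ¬ F'.1 ⊆ F.1 := fun hsub => hne (Subtype.ext
        (Finset.eq_of_subset_of_card_le hsub (by rw [F.2, F'.2])))
      obtain ⟨i, hi, hiF⟩ := Finset.not_subset.1 this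
      have : i ∈ Set.range (F'.1.orderEmbOfFin F'.2) := by
        rw [Finset.range_orderEmbOfFin]; exact hi
      obtain ⟨j, rfl⟩ := this
      have hj : j ∉ {j | 0 < subvector F' t j} := by
        simp only [Set.mem_ofPred_eq, subvector, htF _ hiF, lt_irrefl, not_false_eq_true]
      have := Set.ncard_lt_ncard (Set.ssubset_univ_iff.2 ((Set.ne_univ_iff_exists_notMem _).2 ⟨j, hj⟩))
      simpa [Set.ncard_univ] using this
    · simp
  have e1 := h.2.2 t ht
  have e2 := h'.2.2 t ht
  rw [hsum h] at e1
  rw [hsum h'] at e2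
  linarith

end

noncomputable section

open MeasureTheory Filter Topology NNReal

variable {n : ℕ}

/-! ### Necessity -/

lemma prod_decay_nonneg (A : Finset (Fin n)) (r : Fin n → ℝ≥0) : 0 ≤ ∏ i ∈ A, decay (r i) :=
  Finset.prod_nonneg fun _ _ => decay_nonneg _

lemma measurable_prod_decay (A : Finset (Fin n)) :
    Measurable fun r : Fin n → ℝ≥0 => ∏ i ∈ A, decay (r i) := by
  have : Continuous fun r : Fin n → ℝ≥0 => ∏ i ∈ A, decay (r i) :=
    continuous_finsetProd _ fun i _ => continuous_decay.comp (continuous_apply i)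
  exact this.measurable

lemma weighted_sum {E ι : Type*} [MeasurableSpace E] [Fintype ι] (μ : Measure E) {w : ι → E → ℝ}
    (hw : ∀ b, Measurable (w b)) (h0 : ∀ b x, 0 ≤ w b x) :
    weighted μ (fun x => ∑ b, w b x) = Measure.sum fun b => weighted μ (w b) := by
  ext s hs
  rw [Measure.sum_apply _ hs, tsum_fintype]
  simp only [weighted, withDensity_apply _ hs]
  rw [← lintegral_finsetSum _ fun b _ => (hw b).ennreal_ofReal]
  simp only [ENNReal.ofReal_sum_of_nonneg fun b _ => h0 b _]

lemma sum_weighted {E ι : Type*} [MeasurableSpace E] (μ : ι → Measure E) (w : E → ℝ) :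
    weighted (Measure.sum μ) w = Measure.sum fun b => weighted (μ b) w :=
  withDensity_sum _ _

lemma restrict_weighted {E : Type*} [MeasurableSpace E] (μ : Measure E) (w : E → ℝ) {s : Set E}
    (hs : MeasurableSet s) : (weighted μ w).restrict s = weighted (μ.restrict s) w :=
  restrict_withDensity hs _

lemma elemSymm_eq_sum_subtype (k : ℕ) (x : Fin n → ℝ) :
    elemSymm n k x = ∑ F : {F : Finset (Fin n) // F.card = k}, ∏ i ∈ F.1, x i := by
  rw [elemSymm_eq_sum]
  exact Finset.sum_subtype _ (fun F => by simp [Finset.mem_powersetCard]) _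

lemma elemSymm_coe_pos {k : ℕ} {r : Fin n → ℝ≥0} (hr : r ∈ manyPositive n k) :
    0 < elemSymm n k (fun i => (r i : ℝ)) ∧ 0 < elemSymm n k (fun i => 1 + (r i : ℝ)) ∧
      0 < elemSymm n k (fun i => decay (r i)) := by
  have hr' : k < (Finset.univ.filter fun i => 0 < r i).card := hr
  refine ⟨?_, ?_, ?_⟩
  · rw [elemSymm_pos_iff fun i => NNReal.coe_nonneg _]
    simpa using hr'.le
  · rw [elemSymm_pos_iff fun i => by positivity]
    refine hr'.le.trans (Finset.card_le_card fun i _ => ?_)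
    simp only [Finset.mem_filter, Finset.mem_univ, true_and]
    positivity
  · rw [elemSymm_pos_iff fun i => decay_nonneg _]
    simpa only [decay_pos] using hr'.le

/-! ### Gluing the measures of the mixed differences. -/

section Necessity

variable {k : ℕ} {g : (Fin n → ℝ) → ℝ}
  (μ : {F : Finset (Fin n) // F.card = k} → Measure (Fin n → ℝ≥0)) [∀ F, IsFiniteMeasure (μ F)]
  (hμ : ∀ F, ∀ (s : Fin n → ℝ≥0) (P : ShiftAlgebra n),
    shiftFunctional (restrictOrthant g) (diffOp F.1 s * P) =
      ∫ r, kernelProd F.1 0 r (fun i => s i) * laplaceChar r P ∂(μ F))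

/-- The density of the measure of the representation with respect to the sum of the measures
representing the mixed differences. -/
def levyDensity (k : ℕ) (r : Fin n → ℝ≥0) : ℝ :=
  elemSymm n k (fun i => (r i : ℝ)) / elemSymm n k (fun i => 1 + (r i : ℝ)) /
    elemSymm n k (fun i => decay (r i))

lemma levyDensity_nonneg (k : ℕ) (r : Fin n → ℝ≥0) : 0 ≤ levyDensity k r :=
  div_nonneg (div_nonneg (elemSymm_nonneg _ fun _ => by positivity)
    (elemSymm_nonneg _ fun _ => by positivity)) (elemSymm_nonneg _ fun _ => decay_nonneg _)

lemma levyDensity_le_one (k : ℕ) (r : Fin n → ℝ≥0) : levyDensity k r ≤ 1 :=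
  div_le_one_of_le₀ (elemSymm_div_le_elemSymm_decay k r) (elemSymm_nonneg _ fun _ => decay_nonneg _)

lemma measurable_elemSymm_decay (k : ℕ) :
    Measurable fun r : Fin n → ℝ≥0 => elemSymm n k fun i => decay (r i) :=
  ((continuous_elemSymm k).comp (continuous_pi fun i =>
    continuous_decay.comp (continuous_apply i))).measurable

lemma measurable_levyDensity (k : ℕ) : Measurable (levyDensity (n := n) k) := by
  have h1 : Continuous fun r : Fin n → ℝ≥0 => elemSymm n k (fun i => 1 + (r i : ℝ)) :=
    (continuous_elemSymm k).comp (by fun_prop)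
  have h2 : Continuous fun r : Fin n → ℝ≥0 => elemSymm n k (fun i => (r i : ℝ)) :=
    (continuous_elemSymm k).comp (by fun_prop)
  exact (h2.measurable.div h1.measurable).div (measurable_elemSymm_decay k)

/-- The measure of the representation, on `[0, ∞)^n`. -/
def levyMeasure : Measure (Fin n → ℝ≥0) :=
  weighted ((Measure.sum μ).restrict (manyPositive n k)) (levyDensity k)

omit [∀ F, IsFiniteMeasure (μ F)] in
lemma levyMeasure_compl : levyMeasure μ (manyPositive n k)ᶜ = 0 :=
  withDensity_absolutelyContinuous _ _ (by
    rw [Measure.restrict_apply (measurableSet_manyPositive n k).compl, Set.compl_inter_self,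
      measure_empty])

lemma isFiniteMeasure_levyMeasure : IsFiniteMeasure (levyMeasure μ) := by
  have : IsFiniteMeasure (Measure.sum μ) := by
    rw [Measure.sum_fintype]; infer_instance
  exact isFiniteMeasure_weighted _ (levyDensity_le_one k)

include hμ

/-- The compatibility over `F \ F'` and `F' \ F` is multiplied by the common decay factors over `F ∩
F'`. -/
lemma weighted_prod_decay_comm (F F' : {F : Finset (Fin n) // F.card = k}) :
    weighted (μ F') (fun r => ∏ i ∈ F.1, decay (r i)) =
      weighted (μ F) (fun r => ∏ i ∈ F'.1, decay (r i)) := by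
  have h := weighted_eq_weighted (F.2.trans F'.2.symm) (hμ F) (hμ F')
  have hAB : ∀ (A B : Finset (Fin n)) (m : Measure (Fin n → ℝ≥0)),
      weighted (weighted m fun r => ∏ i ∈ A \ B, decay (r i))
        (fun r => ∏ i ∈ A ∩ B, decay (r i)) = weighted m fun r => ∏ i ∈ A, decay (r i) := by
    intro A B m
    rw [weighted_weighted m (measurable_prod_decay _) (measurable_prod_decay _)
      (prod_decay_nonneg _)]
    congr 1
    funext r
    rw [mul_comm]; exact Finset.prod_inter_mul_prod_sdiff A B _
  rw [← hAB F.1 F'.1, ← hAB F'.1 F.1, h, Finset.inter_comm]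

/-- Summing the commutation relation over all `F'` gives `∏_{i ∈ F} (1 - e^{-r_i}) · ∑ μ_{F'} =
p_k^n(1 - e^{-r}) · μ_F`, where `1 - e^{-r}` is taken coordinatewise. On the set considered the
factor on the right is positive and can be inverted. -/
lemma restrict_manyPositive_eq (F : {F : Finset (Fin n) // F.card = k}) :
    (μ F).restrict (manyPositive n k) = weighted ((Measure.sum μ).restrict (manyPositive n k))
      (fun r => (∏ i ∈ F.1, decay (r i)) * (elemSymm n k fun i => decay (r i))⁻¹) := by
  have hD := measurableSet_manyPositive n k
  have h0 : ∀ r : Fin n → ℝ≥0, 0 ≤ elemSymm n k fun i => decay (r i) :=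
    fun r => elemSymm_nonneg _ fun _ => decay_nonneg _
  have h1 : weighted (Measure.sum μ) (fun r => ∏ i ∈ F.1, decay (r i)) =
      weighted (μ F) (fun r => elemSymm n k fun i => decay (r i)) := by
    simp only [elemSymm_eq_sum_subtype]
    rw [weighted_sum (μ F)
      (w := fun (F' : {F : Finset (Fin n) // F.card = k}) r => ∏ i ∈ F'.1, decay (r i))
      (fun F' => measurable_prod_decay F'.1) (fun F' => prod_decay_nonneg F'.1), sum_weighted]
    congr 1
    funext F'
    exact weighted_prod_decay_comm μ hμ F F'
  have hinv : Measurable fun r : Fin n → ℝ≥0 => (elemSymm n k fun i => decay (r i))⁻¹ :=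
    (measurable_elemSymm_decay k).inv
  have h2 := weighted_weighted ((Measure.sum μ).restrict (manyPositive n k))
    (measurable_prod_decay F.1) hinv (prod_decay_nonneg F.1)
  have h3 := weighted_weighted ((μ F).restrict (manyPositive n k))
    (measurable_elemSymm_decay k) hinv h0
  rw [← h2, ← restrict_weighted (Measure.sum μ) _ hD, h1, restrict_weighted (μ F) _ hD, h3]
  refine (weighted_one _ ?_).symm
  filter_upwards [ae_restrict_mem hD] with r hr
  exact mul_inv_cancel₀ (elemSymm_coe_pos hr).2.2.ne'

/-- Exchanging `i ∈ F` for `j ∉ F` and comparing the two measures shows that `{r_i = 0 < r_j}` is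
null for `μ_F`. Thus almost surely one positive frequency outside `F` forces all frequencies in `F`
to be positive, which makes at least `k + 1` of them. -/
lemma ae_support_subset (F : {F : Finset (Fin n) // F.card = k}) :
    ∀ᵐ r ∂(μ F), r ∉ manyPositive n k → ∀ j ∉ F.1, r j = 0 := by
  have h1 : ∀ i ∈ F.1, ∀ j ∉ F.1, ∀ᵐ r ∂(μ F), ¬ (r i = 0 ∧ 0 < r j) := by
    intro i hi j hj
    have hji : j ∉ F.1.erase i := fun h => hj (Finset.mem_of_mem_erase h)
    have hcard : (insert j (F.1.erase i)).card = k := by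
      rw [Finset.card_insert_of_notMem hji, Finset.card_erase_add_one hi, F.2]
    have hne : j ≠ i := fun h => hj (h ▸ hi)
    have h := weighted_eq_weighted (F.2.trans hcard.symm) (hμ F) (hμ ⟨_, hcard⟩)
    have e1 : insert j (F.1.erase i) \ F.1 = {j} := by
      ext a
      simp only [Finset.mem_sdiff, Finset.mem_insert, Finset.mem_erase, Finset.mem_singleton]
      constructor
      · rintro ⟨rfl | ⟨-, ha⟩, ha'⟩
        · rfl
        · exact absurd ha ha'
      · rintro rfl; exact ⟨Or.inl rfl, hj⟩
    have e2 : F.1 \ insert j (F.1.erase i) = {i} := by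
      ext a
      simp only [Finset.mem_sdiff, Finset.mem_insert, Finset.mem_erase, Finset.mem_singleton]
      constructor
      · rintro ⟨ha, ha'⟩
        by_contra hai
        exact ha' (Or.inr ⟨hai, ha⟩)
      · rintro rfl
        exact ⟨hi, fun h => h.elim (fun h => hne h.symm) fun h => h.1 rfl⟩
    rw [e1, e2] at h
    simp only [Finset.prod_singleton] at h
    have hm : ∀ i : Fin n, Measurable fun r : Fin n → ℝ≥0 => ENNReal.ofReal (decay (r i)) :=
      fun i => (continuous_decay.measurable.comp (measurable_pi_apply i)).ennreal_ofReal
    have hz : weighted (μ ⟨_, hcard⟩) (fun r => decay (r i)) {r | r i = 0 ∧ 0 < r j} = 0 := by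
      rw [weighted, withDensity_apply_eq_zero (hm i)]
      convert measure_empty (μ := μ ⟨_, hcard⟩)
      ext r
      simp only [Set.mem_inter_iff, Set.mem_ofPred_eq, Set.mem_empty_iff_false, iff_false, not_and]
      rintro h1 h2 -
      exact h1 (by simp [h2, decay_zero])
    rw [← h, weighted, withDensity_apply_eq_zero (hm j)] at hz
    rw [ae_iff]
    convert hz using 2
    ext r
    simp only [not_not, Set.mem_ofPred_eq, Set.mem_inter_iff]
    refine ⟨fun h => ⟨?_, h⟩, fun h => h.2⟩
    simpa using decay_pos.2 h.2
  have h2 : ∀ᵐ r ∂(μ F), ∀ i ∈ F.1, ∀ j ∉ F.1, ¬ (r i = 0 ∧ 0 < r j) := by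
    rw [ae_all_iff]
    intro i
    by_cases hi : i ∈ F.1
    · simp only [hi, forall_const]
      rw [ae_all_iff]
      intro j
      by_cases hj : j ∈ F.1
      · simp [hj]
      · simpa [hj] using h1 i hi j hj
    · simp [hi]
  filter_upwards [h2] with r hr hD j hj
  by_contra hne
  have hj0 : 0 < r j := pos_iff_ne_zero.2 hne
  refine hD ?_
  have : insert j F.1 ⊆ Finset.univ.filter fun i => 0 < r i := by
    intro i hi
    simp only [Finset.mem_filter, Finset.mem_univ, true_and]
    rcases Finset.mem_insert.1 hi with rfl | hi
    · exact hj0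
    · exact pos_iff_ne_zero.2 fun h0 => hr i hi j hj ⟨h0, hj0⟩
  have hc := Finset.card_le_card this
  rw [Finset.card_insert_of_notMem hj, F.2] at hc
  exact hc

omit [∀ F, IsFiniteMeasure (μ F)] hμ in
/-- The function of `k` variables contributed by the frequencies supported in `F`. -/
def boundaryFunction (F : {F : Finset (Fin n) // F.card = k}) : (Fin k → ℝ) → ℝ :=
  kernelIntegral Finset.univ (((μ F).restrict (manyPositive n k)ᶜ).map
    fun r j => r (F.1.orderEmbOfFin F.2 j)) 0

omit [∀ F, IsFiniteMeasure (μ F)] hμ in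
lemma boundaryFunction_subvector (F : {F : Finset (Fin n) // F.card = k}) (t : Fin n → ℝ) :
    boundaryFunction μ F (subvector F t) =
      ∫ r in (manyPositive n k)ᶜ, kernelProd F.1 0 r t ∂(μ F) := by
  rw [boundaryFunction, kernelIntegral, integral_map
    (Measurable.aemeasurable (by fun_prop)) (measurable_kernelProd _ _ _).aestronglyMeasurable]
  refine integral_congr_ae (Eventually.of_forall fun r => ?_)
  simp only [kernelProd_zero]
  exact prod_orderEmbOfFin F fun i => bernKernel 0 (r i) (t i)

/-- The integral against `μ_F` is split according to the number of positive frequencies. On the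
sparse part the extra differences over `B \ F` vanish almost everywhere, so it contributes only for
`B = F`. On the rest the densities of `μ_F` and `η` cancel against the weight, and the result no
longer depends on the choice of `F ⊆ B`. -/
lemma shiftFunctional_diffOp_eq (F : {F : Finset (Fin n) // F.card = k}) {B : Finset (Fin n)}
    (hFB : F.1 ⊆ B) (s : Fin n → ℝ≥0) :
    shiftFunctional (restrictOrthant g) (diffOp B s) =
      (if F.1 = B then boundaryFunction μ F (subvector F (orthantCoe n s)) else 0) +
        (-1) ^ (B.card + k) *
          kernelIntegral B (weighted (levyMeasure μ) (levyWeight k B)) 0 (orthantCoe n s) := by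
  have hD := measurableSet_manyPositive n k
  have hs := orthantCoe_mem_closedOrthant s
  have hcard : (B \ F.1).card = B.card - k := by rw [Finset.card_sdiff_of_subset hFB, F.2]
  have hkB : k ≤ B.card := F.2 ▸ Finset.card_le_card hFB
  have hsign : (-1 : ℝ) ^ (B \ F.1).card = (-1) ^ (B.card + k) := by
    rw [hcard]
    obtain ⟨d, hd⟩ := Nat.exists_eq_add_of_le hkB
    rw [hd, Nat.add_sub_cancel_left, show k + d + k = d + 2 * k by ring, pow_add, pow_mul]
    simp
  have hint : Integrable (fun r => kernelProd F.1 0 r (orthantCoe n s) *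
      laplaceChar r (diffOp (B \ F.1) s)) (μ F) := by
    obtain ⟨C, hC⟩ := exists_bound_laplaceChar (diffOp (B \ F.1) s)
    exact (integrable_kernelProd_zero F.1 (μ F) hs).mul_bdd (c := C)
      (continuous_laplaceChar _).aestronglyMeasurable (Eventually.of_forall hC)
  rw [← diffOp_mul_diffOp_sdiff hFB, hμ F]
  change ∫ r, kernelProd F.1 0 r (orthantCoe n s) * _ ∂(μ F) = _
  rw [← integral_add_compl hD hint, add_comm]
  congr 1
  · split_ifs with h
    · subst h
      rw [boundaryFunction_subvector]
      simp [diffOp]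
    · have hne : (B \ F.1).Nonempty := by
        rw [Finset.sdiff_nonempty]
        exact fun hBF => h (Finset.Subset.antisymm hFB hBF)
      obtain ⟨j, hj⟩ := hne
      rw [setIntegral_congr_ae (g := fun _ => (0 : ℝ)) hD.compl, integral_zero]
      filter_upwards [ae_support_subset μ hμ F] with r hr hrD
      rw [laplaceChar_diffOp, Finset.prod_eq_zero hj, mul_zero]
      simp [hr hrD j (Finset.mem_sdiff.1 hj).2]
  · have hw0 : ∀ r : Fin n → ℝ≥0,
        0 ≤ (∏ i ∈ F.1, decay (r i)) * (elemSymm n k fun i => decay (r i))⁻¹ := fun r =>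
      mul_nonneg (prod_decay_nonneg _ _)
        (inv_nonneg.2 (elemSymm_nonneg _ fun _ => decay_nonneg _))
    have hwm : Measurable fun r : Fin n → ℝ≥0 =>
        (∏ i ∈ F.1, decay (r i)) * (elemSymm n k fun i => decay (r i))⁻¹ :=
      (measurable_prod_decay _).mul (measurable_elemSymm_decay k).inv
    rw [restrict_manyPositive_eq μ hμ F, integral_weighted _ hwm hw0, kernelIntegral,
      integral_weighted _ (measurable_levyWeight k B) (levyWeight_nonneg k B), levyMeasure,
      integral_weighted _ (measurable_levyDensity k) (levyDensity_nonneg k), ← integral_const_mul]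
    refine setIntegral_congr_fun hD fun r hr => ?_
    obtain ⟨p1, p2, p3⟩ := elemSymm_coe_pos hr
    have h1 : laplaceChar r (diffOp (B \ F.1) s) = (-1) ^ (B.card + k) *
        ((∏ i ∈ B \ F.1, decay (r i)) * kernelProd (B \ F.1) 0 r (orthantCoe n s)) := by
      rw [laplaceChar_diffOp, ← hsign, kernelProd_zero, ← Finset.prod_mul_distrib,
        ← Finset.prod_const, ← Finset.prod_mul_distrib]
      refine Finset.prod_congr rfl fun i _ => ?_
      rw [decay_mul_bernKernel]
      simp [orthantCoe]
    have h2 : ∏ i ∈ B, decay (r i) = (∏ i ∈ B \ F.1, decay (r i)) * ∏ i ∈ F.1, decay (r i) :=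
      (Finset.prod_sdiff hFB).symm
    have h3 : kernelProd B 0 r (orthantCoe n s) =
        kernelProd (B \ F.1) 0 r (orthantCoe n s) * kernelProd F.1 0 r (orthantCoe n s) := by
      simp only [kernelProd_zero]
      exact (Finset.prod_sdiff hFB).symm
    simp only [h1, h3, levyWeight, levyDensity, h2]
    field_simp

end Necessity

/-- Each difference with `|B| ≥ k` is evaluated through some `F ⊆ B` of size `k`. The Lévy
contributions assemble into the integral, and the boundary contributions occur only for `|B| = k`.
-/
theorem IsBernsteinOfOrder.exists_representation {k : ℕ} (hk : k ≤ n) {g : (Fin n → ℝ) → ℝ}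
    (h : IsBernsteinOfOrder k g) (hg : ContinuousOn g (closedOrthant n))
    (hg0 : ∀ t ∈ sparsePoints n k, g t = 0) :
    ∃ (ψ : {F : Finset (Fin n) // F.card = k} → (Fin k → ℝ) → ℝ) (η : Measure (Fin n → ℝ)),
      IsBernsteinRepresentation k g ψ η := by
  choose μ hfin hμ using fun F : {F : Finset (Fin n) // F.card = k} =>
    (h.hasAlternatingDerivs F.2).exists_measure hg
  have hν := isFiniteMeasure_levyMeasure μ
  have hν0 := levyMeasure_compl μ
  refine ⟨boundaryFunction μ, (levyMeasure μ).map (orthantCoe n), fun F => ?_,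
    isLevyMeasure_map hν0, fun t ht => ?_⟩
  · refine ⟨continuousOn_kernelIntegral _ _, isBernsteinOfOrder_kernelIntegral_univ _,
      fun u hu => ?_⟩
    obtain ⟨j, hj⟩ : ∃ j, u j = 0 := by
      by_contra hcon
      have hall : {i | 0 < u i} = Set.univ := by
        ext i
        simp only [Set.mem_ofPred_eq, Set.mem_univ, iff_true]
        exact lt_of_le_of_ne (hu.1 i) fun h0 => hcon ⟨i, h0.symm⟩
      have := hu.2
      rw [hall, Set.ncard_univ] at this
      simp at this
    rw [boundaryFunction, kernelIntegral]
    refine integral_eq_zero_of_ae (Eventually.of_forall fun r => ?_)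
    change kernelProd Finset.univ 0 r u = 0
    rw [kernelProd_zero]
    exact Finset.prod_eq_zero (Finset.mem_univ j) (by rw [hj, bernKernel_zero_right])
  · obtain ⟨s, rfl⟩ : ∃ s, t = orthantCoe n s := ⟨fun i => ⟨t i, ht i⟩, rfl⟩
    rw [setIntegral_levyIntegrand hk hν0 ht]
    change restrictOrthant g s = _
    rw [restrictOrthant_eq_sum_diffOp hg0]
    -- The boundary terms are extended by zero to all subsets so that the sum over `|B| ≥ k` can be
    -- compared with the sum over sets of size `k`.
    let P : Finset (Fin n) → ℝ := fun B =>
      if hB : B.card = k then boundaryFunction μ ⟨B, hB⟩ (subvector ⟨B, hB⟩ (orthantCoe n s)) else 0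
    have h1 : ∀ B ∈ Finset.univ.filter fun B : Finset (Fin n) => k ≤ B.card,
        shiftFunctional (restrictOrthant g) (diffOp B s) = P B + (-1) ^ (B.card + k) *
          kernelIntegral B (weighted (levyMeasure μ) (levyWeight k B)) 0 (orthantCoe n s) := by
      intro B hB
      obtain ⟨F, hFB, hF⟩ := Finset.exists_subset_card_eq (Finset.mem_filter.1 hB).2
      rw [shiftFunctional_diffOp_eq μ hμ ⟨F, hF⟩ hFB]
      congr 1
      by_cases hBF : F = B
      · subst hBF
        simp [P, hF]
      · have : B.card ≠ k := fun hBk =>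
          hBF (Finset.eq_of_subset_of_card_le hFB (by rw [hF, hBk]))
        simp [P, this, hBF]
    rw [Finset.sum_congr rfl h1, Finset.sum_add_distrib]
    congr 1
    have h2 : ∑ F : {F : Finset (Fin n) // F.card = k},
        boundaryFunction μ F (subvector F (orthantCoe n s)) =
          ∑ F : {F : Finset (Fin n) // F.card = k}, P F.1 :=
      Finset.sum_congr rfl fun F _ => by simp [P, F.2]
    rw [h2, ← Finset.sum_subtype (Finset.univ.filter fun B : Finset (Fin n) => B.card = k)
      (by simp) P]
    refine (Finset.sum_subset (fun B hB => ?_) fun B _ hB => ?_).symm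
    · simp only [Finset.mem_filter, Finset.mem_univ, true_and] at hB ⊢
      exact hB.ge
    · simp only [Finset.mem_filter, Finset.mem_univ, true_and] at hB
      simp [P, hB]

end

/-! ### The theorem. -/

theorem mainTheorem5 (n k : ℕ) (hk : 1 ≤ k) (hkn : k < n) (g : (Fin n → ℝ) → ℝ)
    (hg : ContinuousOn g (closedOrthant n)) (hg0 : ∀ t ∈ sparsePoints n k, g t = 0) :
    (∀ η : MeasureTheory.Measure (Fin n → ℝ), IsLevyMeasure n k η → ∀ t ∈ closedOrthant n,
      MeasureTheory.IntegrableOn (levyIntegrand n k t) (levyDomain n k) η) ∧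
    (IsBernsteinOfOrder k g ↔
      ∃ (ψ : {F : Finset (Fin n) // F.card = k} → (Fin k → ℝ) → ℝ)
        (η : MeasureTheory.Measure (Fin n → ℝ)), IsBernsteinRepresentation k g ψ η) ∧
    (∀ (ψ ψ' : {F : Finset (Fin n) // F.card = k} → (Fin k → ℝ) → ℝ)
        (η η' : MeasureTheory.Measure (Fin n → ℝ)),
      IsBernsteinRepresentation k g ψ η → IsBernsteinRepresentation k g ψ' η' →
        (∀ F, Set.EqOn (ψ F) (ψ' F) (closedOrthant k)) ∧ η = η') := by
  refine ⟨fun η hη t ht => integrableOn_levyIntegrand hkn.le hη ht,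
    ⟨fun h => h.exists_representation hkn.le hg hg0,
      fun ⟨ψ, η, h⟩ => h.isBernsteinOfOrder hkn.le⟩, fun ψ ψ' η η' h h' => ?_⟩
  -- The measures are identified first, since uniqueness of the `ψ^F` is obtained by cancelling
  -- equal integrals.
  obtain rfl := h.measure_unique hkn.le h'
  exact ⟨h.functions_unique h', rfl⟩
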